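/- **Proposition (action of $vC_n$ on $\mathcal B(\omega_1)^n_{(1,\dots,1)}=S_n$).** *Groups.* For $1\le i<j\le n$ let $w_{ij}\in S_n$ be the permutation reversing $[i,j]$ and fixing all other points. The cactus group $C_n$ has generators $s_{ij}$ ($1\le i<j\le n$) and relations $s_{ij}^2=1$; $s_{ij}s_{kl}=s_{kl}s_{ij}$ if $[i,j]\cap[k,l]=\emptyset$; $s_{ij}s_{kl}=s_{w_{ij}(l)\,w_{ij}(k)}s_{ij}$ if $[k,l]\subset[i,j]$. The virtual cactus group $vC_n$ is the quotient of the free product $C_n*S_n$ by the relations $w s_{ij}w^{-1}=s_{w(i)w(j)}$ for all $i<j$ and all $w\in S_n$ with $w(i+k)=w(i)+k$ for $0\le k\le j-i$. *Crystals.* Let $B=B(\omega_1)$ be the $\mathfrak{sl}_n$-crystal with underlying set $\mathcal B(\omega_1)=\{1,\dots,n\}$, where $f_i$ sends $i$ to $i+1$ and kills the other letters, and the letter $k$ has as weight the class of the $k$-th basis vector in $\mathbb Z^n/\mathbb Z(1,\dots,1)$. Tensor products of crystals are defined by $e_i(b_1\otimes b_2)=e_i(b_1)\otimes b_2$ if $\varepsilon_i(b_1)>\varphi_i(b_2)$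 and $b_1\otimes e_i(b_2)$ otherwise; $f_i(b_1\otimes b_2)=f_i(b_1)\otimes b_2$ if $\varepsilon_i(b_1)\ge\varphi_i(b_2)$ and $b_1\otimes f_i(b_2)$ otherwise. A Schützenberger involution of a crystal is a map $\xi$ that preserves each connected component, acts on weights by $w_0$, and satisfies $e_i\xi=\xi f_{n-i}$ and $f_i\xi=\xi e_{n-i}$. The crystals $B$, $B^{\otimes k}$ and $B^{\otimes k}\otimes B$ ($k\ge0$) each have exactly one. The commutor is $\sigma_{X,Y}(x\otimes y)=\xi(\xi(y)\otimes\xi(x))\in Y\otimes X$. *The action.* There is a unique action of $vC_n$ on the set $\mathcal B(\omega_1)^n$ of words $(a_1,\dots,a_n)$ in which $u\in S_n$ permutes the factors (the letter in position $k$ moves to position $u(k)$), and $s_{ij}$ acts on the factors in positions $i,\dots,j$ by the long element of the cactus group and fixes the other factors; here the long element of an $m$-fold product is defined recursively as the long element of the last $m-1$ factors followed by the commutor which moves the first factor past the others. This action preserves the weight. The subset $\mathcal B(\omega_1)^n_{(1,\dots,1)}$ of words of weight $(1,\dots,1)$ consists of the words in which each letter occurs exactly once, and it is identified with $S_n$ by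 letting $w\in S_n$ correspond to the word $(w^{-1}(1),\dots,w^{-1}(n))$; that is, $w(c)$ is the position of the letter $c$. *Tableaux.* Let $\mathrm{Tab}(\lambda)$ be the set of standard Young tableaux of shape $\lambda$. RSK is the bijection $S_n\to\bigsqcup_{\lambda\vdash n}\mathrm{Tab}(\lambda)\times\mathrm{Tab}(\lambda)$, $w\mapsto(P(w),Q(w))$, where $P(w)$ is the row insertion tableau and $Q(w)$ the recording tableau of $w(1),\dots,w(n)$. The Berenstein–Kirillov action of $C_n$ on $\mathrm{Tab}(\lambda)$ is the unique action in which $s_{ij}$ acts by $q_{j-1}q_{j-i}q_{j-1}$ (so $s_{1j}$ acts by $q_{j-1}$); here $q_k=t_1(t_2t_1)\cdots(t_k\cdots t_2t_1)$ is the partial Schützenberger involution, and the Bender–Knuth involution $t_i$ exchanges the entries $i$ and $i+1$ if the result is standard and does nothing otherwise. *Statement.* All the objects above are well defined as asserted, and the induced action of $vC_n$ on $\mathcal B(\omega_1)^n_{(1,\dots,1)}=S_n$ is the unique action of $vC_n$ on the set $S_n$ with the following two properties. 1. Each $u\in S_n$ acts by left multiplication: $u\cdot w=uw$. 2. Each $s\in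 C_n$ acts through RSK by its Berenstein–Kirillov action on the left factor: if $w$ corresponds to $(P,Q)\in\mathrm{Tab}(\lambda)\times\mathrm{Tab}(\lambda)$, then $s\cdot w$ corresponds to $(s\cdot P,Q)$. -/

import Mathlib

namespace CactusCrystal

/-! ### The cactus group and the virtual cactus group

Positions and letters `1, …, n` are modelled by `Fin n = {0, …, n - 1}`. -/

/-- Pairs `i < j` of positions: the index set of the generators `s_{ij}`. -/
abbrev PosPair (n : ℕ) : Type := {p : Fin n × Fin n // p.1 < p.2}

/-- The underlying map of `w_{ij}`: reverse `[i, j]`, fix everything outside. -/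
def reverseFun {n : ℕ} (p : PosPair n) (k : Fin n) : Fin n :=
  if h : p.1.1 ≤ k ∧ k ≤ p.1.2 then
    ⟨(p.1.1 : ℕ) + (p.1.2 : ℕ) - (k : ℕ), by
      have h1 : (p.1.1 : ℕ) ≤ k := h.1
      have h2 := p.1.2.isLt
      omega⟩
  else k

theorem reverseFun_involutive {n : ℕ} (p : PosPair n) :
    Function.Involutive (reverseFun p) := by
  intro k
  unfold reverseFun
  by_cases h : p.1.1 ≤ k ∧ k ≤ p.1.2
  · have h1 : (p.1.1 : ℕ) ≤ k := h.1
    have h2 : (k : ℕ) ≤ p.1.2 := h.2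
    rw [dif_pos h, dif_pos]
    · ext
      simp only
      omega
    · constructor
      · rw [Fin.le_def]
        simp only
        omega
      · rw [Fin.le_def]
        simp only
        omega
  · rw [dif_neg h, dif_neg h]

/-- The permutation `w_{ij} ∈ S_n` which reverses `[i, j]`. -/
def reversal {n : ℕ} (p : PosPair n) : Equiv.Perm (Fin n) :=
  (reverseFun_involutive p).toPerm

/-- The defining relations of the cactus group, as words required to be trivial. -/
inductive CactusRel (n : ℕ) : FreeGroup (PosPair n) → Prop
  | sq (p : PosPair n) : CactusRel n (FreeGroup.of p * FreeGroup.of p)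
  | disjoint (p q : PosPair n)
      (h : Disjoint (Set.Icc p.1.1 p.1.2) (Set.Icc q.1.1 q.1.2)) :
      CactusRel n (FreeGroup.of p * FreeGroup.of q * (FreeGroup.of q * FreeGroup.of p)⁻¹)
  | nested (p q r : PosPair n)
      (h : Set.Icc q.1.1 q.1.2 ⊆ Set.Icc p.1.1 p.1.2)
      (h1 : r.1.1 = reversal p q.1.2) (h2 : r.1.2 = reversal p q.1.1) :
      CactusRel n (FreeGroup.of p * FreeGroup.of q * (FreeGroup.of r * FreeGroup.of p)⁻¹)

/-- The cactus group `C_n`. -/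
abbrev Cactus (n : ℕ) : Type := PresentedGroup {x | CactusRel n x}

/-- The generator `s_{ij}` of `C_n`. -/
def Cactus.s {n : ℕ} (p : PosPair n) : Cactus n := PresentedGroup.of p

/-- `w` is a translation on `[i, j]`: `w (i + k) = w i + k` for `0 ≤ k ≤ j - i`. -/
def IsTranslationOn {n : ℕ} (w : Equiv.Perm (Fin n)) (p : PosPair n) : Prop :=
  ∀ k : Fin n, p.1.1 ≤ k → k ≤ p.1.2 → (w k : ℕ) = (w p.1.1 : ℕ) + ((k : ℕ) - (p.1.1 : ℕ))

/-- The relations `w s_{ij} w⁻¹ = s_{w(i) w(j)}` for `w` a translation on `[i, j]`. -/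
inductive VirtualRel (n : ℕ) : Monoid.Coprod (Cactus n) (Equiv.Perm (Fin n)) → Prop
  | conj (w : Equiv.Perm (Fin n)) (p q : PosPair n) (h : IsTranslationOn w p)
      (h1 : q.1.1 = w p.1.1) (h2 : q.1.2 = w p.1.2) :
      VirtualRel n (Monoid.Coprod.inr w * Monoid.Coprod.inl (Cactus.s p) *
        (Monoid.Coprod.inr w)⁻¹ * (Monoid.Coprod.inl (Cactus.s q))⁻¹)

/-- The virtual cactus group `vC_n`: the quotient of the free product `C_n * S_n` by the
relations above. -/
abbrev VirtualCactus (n : ℕ) : Type :=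
  Monoid.Coprod (Cactus n) (Equiv.Perm (Fin n)) ⧸ Subgroup.normalClosure {x | VirtualRel n x}

/-- The natural map `C_n → vC_n`. -/
def VirtualCactus.ofCactus (n : ℕ) : Cactus n →* VirtualCactus n :=
  (QuotientGroup.mk' _).comp Monoid.Coprod.inl

/-- The natural map `S_n → vC_n`. -/
def VirtualCactus.ofPerm (n : ℕ) : Equiv.Perm (Fin n) →* VirtualCactus n :=
  (QuotientGroup.mk' _).comp Monoid.Coprod.inr

/-! ### Crystals for `𝔰𝔩_n` -/

/-- The weight lattice of `𝔰𝔩_n`, that is `ℤⁿ / ℤ(1, …, 1)`. -/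
abbrev Weight (n : ℕ) : Type :=
  (Fin n → ℤ) ⧸ AddSubgroup.zmultiples (fun _ : Fin n => (1 : ℤ))

/-- The class of an integer vector in the weight lattice. -/
def toWeight (n : ℕ) : (Fin n → ℤ) →+ Weight n := QuotientAddGroup.mk' _

/-- The first and the second letter attached to the vertex `i` of the Dynkin diagram
`A_{n-1}`. -/
def loLetter {n : ℕ} (i : Fin (n - 1)) : Fin n := ⟨i, by omega⟩

/-- See `loLetter`. -/
def hiLetter {n : ℕ} (i : Fin (n - 1)) : Fin n := ⟨(i : ℕ) + 1, by omega⟩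

/-- The simple root `α_i`. -/
def simpleRoot {n : ℕ} (i : Fin (n - 1)) : Weight n :=
  toWeight n (Pi.single (loLetter i) 1 - Pi.single (hiLetter i) 1)

/-- The action of the longest Weyl group element `w₀` on weights (reversal of coordinates). -/
def longestWeyl (n : ℕ) : Weight n →+ Weight n :=
  QuotientAddGroup.map _ _
    ({ toFun := fun v k => v k.rev, map_zero' := rfl, map_add' := fun _ _ => rfl } :
      (Fin n → ℤ) →+ (Fin n → ℤ))
    (by
      rw [AddSubgroup.zmultiples_le]
      exact AddSubgroup.mem_zmultiples _)

/-- An `𝔰𝔩_n`-crystal structure on a set `X`; the value `none` plays the role of `0`. -/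
structure Crystal (n : ℕ) (X : Type) where
  finite : Finite X
  wt : X → Weight n
  e : Fin (n - 1) → X → Option X
  f : Fin (n - 1) → X → Option X
  wt_e : ∀ i b b', e i b = some b' → wt b' = wt b + simpleRoot i
  wt_f : ∀ i b b', f i b = some b' → wt b' = wt b - simpleRoot i
  f_e : ∀ i b b', e i b = some b' → f i b' = some b
  e_f : ∀ i b b', f i b = some b' → e i b' = some b

/-- `maxIter g b` is the largest `k` such that the partial map `g` can be applied `k` times
to `b`. -/
noncomputable def maxIter {X : Type} (g : X → Option X) (b : X) : ℕ :=
  sSup {k : ℕ | (fun o : Option X => o.bind g)^[k] (some b) ≠ none}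

theorem nsmul_simpleRoot {n : ℕ} (i : Fin (n - 1)) (k : ℕ)
    (h : k • simpleRoot i = (0 : Weight n)) : k = 0 := by
  unfold simpleRoot at h
  rw [← map_nsmul] at h
  have h' := (QuotientAddGroup.eq_zero_iff _).1 h
  obtain ⟨m, hm⟩ := AddSubgroup.mem_zmultiples_iff.1 h'
  have hne : loLetter i ≠ hiLetter i := by
    intro h
    have := congrArg Fin.val h
    simp [loLetter, hiLetter] at this
  have h1 := congrFun hm (loLetter i)
  have h2 := congrFun hm (hiLetter i)
  simp [hne, hne.symm] at h1 h2
  omega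

theorem bddAbove_iter {n : ℕ} {X : Type} (hX : Finite X) (wt : X → Weight n)
    (g : X → Option X) (δ : Weight n) (hδ : ∀ k : ℕ, k • δ = 0 → k = 0)
    (hg : ∀ b b', g b = some b' → wt b' = wt b + δ) (b : X) :
    BddAbove {k : ℕ | (fun o : Option X => o.bind g)^[k] (some b) ≠ none} := by
  have key : ∀ (k : ℕ) (x : X), (fun o : Option X => o.bind g)^[k] (some b) = some x →
      wt x = wt b + k • δ := by
    intro k
    induction k with
    | zero =>
      intro x hx
      simp at hx
      simp [hx]
    | succ k ih =>
      intro x hx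
      rw [Function.iterate_succ_apply'] at hx
      obtain ⟨y, hy, hyx⟩ := Option.bind_eq_some_iff.1 hx
      rw [hg y x hyx, ih y hy, succ_nsmul, add_assoc]
  apply Set.Finite.bddAbove
  apply Set.Finite.of_finite_image (f := fun k : ℕ => wt b + k • δ)
  · apply (Set.finite_range wt).subset
    rintro _ ⟨k, hk, rfl⟩
    obtain ⟨x, hx⟩ := Option.ne_none_iff_exists'.1 hk
    exact ⟨x, key k x hx⟩
  · intro a _ a' _ h
    have h' : a • δ = a' • δ := add_left_cancel h
    rcases le_total a a' with hl | hl
    · obtain ⟨d, rfl⟩ := Nat.exists_eq_add_of_le hl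
      rw [add_nsmul] at h'
      have := hδ d (left_eq_add.1 h')
      omega
    · obtain ⟨d, rfl⟩ := Nat.exists_eq_add_of_le hl
      rw [add_nsmul] at h'
      have := hδ d (left_eq_add.1 h'.symm)
      omega

theorem maxIter_eq_succ {X : Type} (g : X → Option X) (b b' : X) (hb : g b = some b')
    (hbd : BddAbove {k : ℕ | (fun o : Option X => o.bind g)^[k] (some b') ≠ none}) :
    maxIter g b = maxIter g b' + 1 := by
  have hstep : ∀ k : ℕ, (fun o : Option X => o.bind g)^[k + 1] (some b) =
      (fun o : Option X => o.bind g)^[k] (some b') := by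
    intro k
    rw [Function.iterate_succ_apply]
    simp [hb]
  have hne : ({k : ℕ | (fun o : Option X => o.bind g)^[k] (some b') ≠ none}).Nonempty :=
    ⟨0, by simp⟩
  have hmem := Nat.sSup_mem hne hbd
  unfold maxIter
  apply IsGreatest.csSup_eq
  constructor
  · change _ ≠ _
    rw [hstep]
    exact hmem
  · rintro (_ | k) hk
    · omega
    · have hk' : (fun o : Option X => o.bind g)^[k + 1] (some b) ≠ none := hk
      rw [hstep] at hk'
      exact Nat.succ_le_succ (le_csSup hbd hk')

namespace Crystal

/-- `ε_i(b) = max {k : e_i^k b ≠ 0}`. -/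
noncomputable def ε {n : ℕ} {X : Type} (c : Crystal n X) (i : Fin (n - 1)) (b : X) : ℕ :=
  maxIter (c.e i) b

/-- `φ_i(b) = max {k : f_i^k b ≠ 0}`. -/
noncomputable def φ {n : ℕ} {X : Type} (c : Crystal n X) (i : Fin (n - 1)) (b : X) : ℕ :=
  maxIter (c.f i) b

theorem ε_of_e {n : ℕ} {X : Type} (c : Crystal n X) {i : Fin (n - 1)} {b b' : X}
    (h : c.e i b = some b') : c.ε i b = c.ε i b' + 1 :=
  maxIter_eq_succ _ _ _ h
    (bddAbove_iter c.finite c.wt _ (simpleRoot i) (nsmul_simpleRoot i) (c.wt_e i) _)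

theorem φ_of_f {n : ℕ} {X : Type} (c : Crystal n X) {i : Fin (n - 1)} {b b' : X}
    (h : c.f i b = some b') : c.φ i b = c.φ i b' + 1 :=
  maxIter_eq_succ _ _ _ h
    (bddAbove_iter c.finite c.wt _ (-simpleRoot i)
      (fun k hk => nsmul_simpleRoot i k (by rwa [neg_nsmul, neg_eq_zero] at hk))
      (fun b b' hb => by rw [c.wt_f i b b' hb, sub_eq_add_neg]) _)

/-- The tensor product of crystals. -/
noncomputable def tensor {n : ℕ} {X Y : Type} (c : Crystal n X) (d : Crystal n Y) :
    Crystal n (X × Y) where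
  finite := by
    have := c.finite
    have := d.finite
    infer_instance
  wt b := c.wt b.1 + d.wt b.2
  e i b :=
    if c.ε i b.1 > d.φ i b.2 then (c.e i b.1).map (fun x => (x, b.2))
    else (d.e i b.2).map (fun y => (b.1, y))
  f i b :=
    if c.ε i b.1 ≥ d.φ i b.2 then (c.f i b.1).map (fun x => (x, b.2))
    else (d.f i b.2).map (fun y => (b.1, y))
  wt_e := by
    rintro i ⟨x, y⟩ b' h
    dsimp only at h
    split_ifs at h with hc
    · obtain ⟨x', hx, rfl⟩ := Option.map_eq_some_iff.1 h
      simp only [c.wt_e i x x' hx]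
      abel
    · obtain ⟨y', hy, rfl⟩ := Option.map_eq_some_iff.1 h
      simp only [d.wt_e i y y' hy]
      abel
  wt_f := by
    rintro i ⟨x, y⟩ b' h
    dsimp only at h
    split_ifs at h with hc
    · obtain ⟨x', hx, rfl⟩ := Option.map_eq_some_iff.1 h
      simp only [c.wt_f i x x' hx]
      abel
    · obtain ⟨y', hy, rfl⟩ := Option.map_eq_some_iff.1 h
      simp only [d.wt_f i y y' hy]
      abel
  f_e := by
    rintro i ⟨x, y⟩ b' h
    dsimp only at h
    split_ifs at h with hc
    · obtain ⟨x', hx, rfl⟩ := Option.map_eq_some_iff.1 h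
      have h1 := c.ε_of_e hx
      have h2 := c.f_e i x x' hx
      dsimp only
      rw [if_pos (by omega), h2]
      rfl
    · obtain ⟨y', hy, rfl⟩ := Option.map_eq_some_iff.1 h
      have h2 := d.f_e i y y' hy
      have h1 := d.φ_of_f h2
      dsimp only
      rw [if_neg (by omega), h2]
      rfl
  e_f := by
    rintro i ⟨x, y⟩ b' h
    dsimp only at h
    split_ifs at h with hc
    · obtain ⟨x', hx, rfl⟩ := Option.map_eq_some_iff.1 h
      have h2 := c.e_f i x x' hx
      have h1 := c.ε_of_e h2
      dsimp only
      rw [if_pos (by omega), h2]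
      rfl
    · obtain ⟨y', hy, rfl⟩ := Option.map_eq_some_iff.1 h
      have h2 := d.e_f i y y' hy
      have h1 := d.φ_of_f hy
      dsimp only
      rw [if_neg (by omega), h2]
      rfl

/-- Transport of a crystal structure along a bijection of the underlying sets. -/
def transport {n : ℕ} {X Y : Type} (c : Crystal n X) (t : X ≃ Y) : Crystal n Y where
  finite := by
    have := c.finite
    exact Finite.of_equiv X t
  wt y := c.wt (t.symm y)
  e i y := (c.e i (t.symm y)).map t
  f i y := (c.f i (t.symm y)).map t
  wt_e := by
    intro i b b' h
    obtain ⟨x, hx, rfl⟩ := Option.map_eq_some_iff.1 h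
    simpa using c.wt_e i _ _ hx
  wt_f := by
    intro i b b' h
    obtain ⟨x, hx, rfl⟩ := Option.map_eq_some_iff.1 h
    simpa using c.wt_f i _ _ hx
  f_e := by
    intro i b b' h
    obtain ⟨x, hx, rfl⟩ := Option.map_eq_some_iff.1 h
    simp [c.f_e i _ _ hx]
  e_f := by
    intro i b b' h
    obtain ⟨x, hx, rfl⟩ := Option.map_eq_some_iff.1 h
    simp [c.e_f i _ _ hx]

/-- The one-element crystal of weight zero (the unit for the tensor product). -/
def unit (n : ℕ) (X : Type) [Unique X] : Crystal n X where
  finite := inferInstance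
  wt _ := 0
  e _ _ := none
  f _ _ := none
  wt_e := by simp
  wt_f := by simp
  f_e := by simp
  e_f := by simp

/-- The crystal `B(ω₁)` of the vector representation of `𝔰𝔩_n`, on the set of letters:
`1 → 2 → ⋯ → n`, the arrow out of the `i`-th letter being `f_i`, and the `k`-th letter having
the weight of the `k`-th basis vector. -/
def vector (n : ℕ) : Crystal n (Fin n) where
  finite := inferInstance
  wt b := toWeight n (Pi.single b 1)
  e i b := if b = hiLetter i then some (loLetter i) else none
  f i b := if b = loLetter i then some (hiLetter i) else none
  wt_e := by
    intro i b b' h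
    split_ifs at h with hb
    cases h
    rw [hb, simpleRoot, ← map_add]
    congr 1
    abel
  wt_f := by
    intro i b b' h
    split_ifs at h with hb
    cases h
    rw [hb, simpleRoot, ← map_sub]
    congr 1
    abel
  f_e := by
    intro i b b' h
    split_ifs at h with hb
    cases h
    simp [hb]
  e_f := by
    intro i b b' h
    split_ifs at h with hb
    cases h
    simp [hb]

/-- The `k`-fold tensor power of a crystal, on the set of words of length `k`. -/
noncomputable def power {n : ℕ} {X : Type} (c : Crystal n X) : (k : ℕ) → Crystal n (Fin k → X)
  | 0 => unit n (Fin 0 → X)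
  | k + 1 => (c.tensor (power c k)).transport (Fin.consEquiv (fun _ : Fin (k + 1) => X))

/-- `b` and `b'` lie in the same connected component of the crystal. -/
def Connected {n : ℕ} {X : Type} (c : Crystal n X) : X → X → Prop :=
  Relation.EqvGen (fun b b' => ∃ i, c.f i b = some b')

/-- `ξ` is a Schützenberger involution of the crystal: it preserves every connected component,
acts on weights by `w₀`, and interchanges `e_i` with `f_{n-i}`. -/
structure IsSchutzenberger {n : ℕ} {X : Type} (c : Crystal n X) (ξ : X → X) : Prop where
  connected : ∀ b, c.Connected b (ξ b)
  wt : ∀ b, c.wt (ξ b) = longestWeyl n (c.wt b)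
  e : ∀ i b, c.e i (ξ b) = (c.f i.rev b).map ξ
  f : ∀ i b, c.f i (ξ b) = (c.e i.rev b).map ξ

open Classical in
/-- The Schützenberger involution of a normal crystal (with the value `id` if there is none). -/
noncomputable def schutzenberger {n : ℕ} {X : Type} (c : Crystal n X) : X → X :=
  if h : ∃ ξ, c.IsSchutzenberger ξ then h.choose else id

/-- The crystal commutor `σ : X ⊗ Y → Y ⊗ X`, `(x, y) ↦ ξ (ξ y, ξ x)`. -/
noncomputable def commutor {n : ℕ} {X Y : Type} (c : Crystal n X) (d : Crystal n Y)
    (b : X × Y) : Y × X :=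
  (d.tensor c).schutzenberger (d.schutzenberger b.2, c.schutzenberger b.1)

/-- The action of the long element `s_{1m}` of the cactus group on the `m`-fold tensor power:
apply the long element `s_{2m}` to the last `m - 1` factors, then the commutor which moves the
first factor past all the others. -/
noncomputable def longElement {n : ℕ} {X : Type} (c : Crystal n X) :
    (m : ℕ) → (Fin m → X) → (Fin m → X)
  | 0 => id
  | m + 1 => fun a =>
      let b := c.commutor (c.power m) (a 0, longElement c m (Fin.tail a))
      Fin.snoc (α := fun _ => X) b.1 b.2

/-- The action of `s_{ij}` by crystal commutors: apply the long element to the factors in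
positions `i, …, j`, and leave the other factors alone. -/
noncomputable def commutorAction {n k : ℕ} {X : Type} (c : Crystal n X) (p : PosPair k)
    (a : Fin k → X) : Fin k → X := fun t =>
  if h : p.1.1 ≤ t ∧ t ≤ p.1.2 then
    c.longElement ((p.1.2 : ℕ) - (p.1.1 : ℕ) + 1)
      (fun s => a ⟨(p.1.1 : ℕ) + (s : ℕ), by
        have h1 := s.isLt
        have h2 := p.1.2.isLt
        have h3 : (p.1.1 : ℕ) < p.1.2 := p.2
        omega⟩)
      ⟨(t : ℕ) - (p.1.1 : ℕ), by
        have h1 : (p.1.1 : ℕ) ≤ t := h.1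
        have h2 : (t : ℕ) ≤ p.1.2 := h.2
        omega⟩
  else a t

end Crystal

/-- `act` is the action of `vC_n` on `𝓑(ω₁)ⁿ`: the subgroup `S_n` permutes the factors, and
`C_n` acts by crystal commutors. -/
structure IsCrystalAction (n : ℕ) (act : VirtualCactus n →* Equiv.Perm (Fin n → Fin n)) :
    Prop where
  perm : ∀ (w : Equiv.Perm (Fin n)) (a : Fin n → Fin n) (k : Fin n),
    act (VirtualCactus.ofPerm n w) a (w k) = a k
  cactus : ∀ (p : PosPair n) (a : Fin n → Fin n),
    act (VirtualCactus.ofCactus n (Cactus.s p)) a = (Crystal.vector n).commutorAction p a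

/-- The word `(a_1, …, a_n)` attached to `w ∈ S_n`: the letter `w⁻¹(k)` stands in position `k`,
so that `w(c)` is the position of the letter `c`. -/
def permWord {n : ℕ} (w : Equiv.Perm (Fin n)) : Fin n → Fin n := fun k => w⁻¹ k

/-! ### Tableaux, the RSK correspondence and the Berenstein–Kirillov action -/

/-- Partitions of `n`, as Young diagrams. -/
abbrev Shape (n : ℕ) : Type := {μ : YoungDiagram // μ.card = n}

/-- Standard Young tableaux of shape `μ`: each of `1, …, |μ|` occurs exactly once. -/
abbrev StdTableau (μ : YoungDiagram) : Type :=
  {T : SemistandardYoungTableau μ //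
    Set.BijOn (fun c : ℕ × ℕ => T c.1 c.2) (μ.cells : Set (ℕ × ℕ)) (Set.Icc 1 μ.card)}

/-- Row insertion of `x` into one row: the new row and the entry bumped out of it, if any. -/
def rowInsert (x : ℕ) : List ℕ → List ℕ × Option ℕ
  | [] => ([x], none)
  | y :: r => if x < y then (x :: r, some y) else (y :: (rowInsert x r).1, (rowInsert x r).2)

/-- Schensted insertion of `x` into a tableau given by its rows: the new tableau and the index
of the row in which it has a new cell. -/
def insertTableau (x : ℕ) : List (List ℕ) → List (List ℕ) × ℕ
  | [] => ([[x]], 0)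
  | r :: T =>
    match rowInsert x r with
    | (r', none) => (r' :: T, 0)
    | (r', some y) => (r' :: (insertTableau y T).1, (insertTableau y T).2 + 1)

/-- Put the entry `x` at the end of the row with index `i` (a new row, if `i` is the number of
rows). -/
def appendToRow (x : ℕ) : ℕ → List (List ℕ) → List (List ℕ)
  | 0, [] => [[x]]
  | 0, r :: T => (r ++ [x]) :: T
  | _ + 1, [] => [[x]]
  | i + 1, r :: T => r :: appendToRow x i T

/-- The pair (insertion tableau, recording tableau) of a word. -/
def rskPair (l : List ℕ) : List (List ℕ) × List (List ℕ) :=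
  l.zipIdx.foldl
    (fun PQ x => ((insertTableau x.1 PQ.1).1,
      appendToRow (x.2 + 1) (insertTableau x.1 PQ.1).2 PQ.2))
    ([], [])

/-- The one-line notation `w(1), …, w(n)` of a permutation, with entries in `{1, …, n}`. -/
def oneLine {n : ℕ} (w : Equiv.Perm (Fin n)) : List ℕ := List.ofFn (fun k => (w k : ℕ) + 1)

/-- The tableau `T` has the given rows. -/
def HasRows {μ : YoungDiagram} (T : StdTableau μ) (rows : List (List ℕ)) : Prop :=
  ∀ i j, T.1 i j = (rows.getD i []).getD j 0

/-- `rsk` is the Robinson–Schensted–Knuth correspondence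
`S_n ≃ ⨆ Tab(λ) × Tab(λ)`, `w ↦ (P(w), Q(w))`. -/
def IsRSK {n : ℕ}
    (rsk : Equiv.Perm (Fin n) ≃ (Σ μ : Shape n, StdTableau μ.1 × StdTableau μ.1)) : Prop :=
  ∀ w, HasRows (rsk w).2.1 (rskPair (oneLine w)).1 ∧ HasRows (rsk w).2.2 (rskPair (oneLine w)).2

open Classical in
/-- The Bender–Knuth involution `t_i` on standard tableaux: exchange the entries `i` and `i + 1`
if the result is a standard tableau, and do nothing otherwise. -/
noncomputable def benderKnuth {μ : YoungDiagram} (i : ℕ) (T : StdTableau μ) : StdTableau μ :=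
  if h : ∃ T' : StdTableau μ, ∀ r c, T'.1 r c = Equiv.swap i (i + 1) (T.1 r c) then h.choose
  else T

/-- The operator `t_k ⋯ t_2 t_1`. -/
noncomputable def partialPromotion {μ : YoungDiagram} : ℕ → StdTableau μ → StdTableau μ
  | 0 => id
  | k + 1 => benderKnuth (k + 1) ∘ partialPromotion k

/-- The partial Schützenberger involution `q_k = t_1 (t_2 t_1) ⋯ (t_k ⋯ t_2 t_1)` of Berenstein
and Kirillov, which acts on the entries `1, …, k + 1` of a tableau. -/
noncomputable def partialSchutzenberger {μ : YoungDiagram} : ℕ → StdTableau μ → StdTableau μ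
  | 0 => id
  | k + 1 => partialSchutzenberger k ∘ partialPromotion (k + 1)

/-- `β` is the Berenstein–Kirillov action of `C_n` on the sets `Tab(λ)`: the generator `s_{ij}`
acts by `q_{j-1} q_{j-i} q_{j-1}`; in particular `s_{1j}` acts by `q_{j-1}`. -/
def IsBerensteinKirillov {n : ℕ} (β : (μ : Shape n) → Cactus n →* Equiv.Perm (StdTableau μ.1)) :
    Prop :=
  ∀ (μ : Shape n) (p : PosPair n) (T : StdTableau μ.1),
    β μ (Cactus.s p) T = partialSchutzenberger (p.1.2 : ℕ)
      (partialSchutzenberger ((p.1.2 : ℕ) - (p.1.1 : ℕ)) (partialSchutzenberger (p.1.2 : ℕ) T))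

end CactusCrystal

open CactusCrystal

/-! Everything takes place on words with letters in `{0, …, n - 1}`, where the crystal operators are
given by the signature rule. Two descriptions are matched: the long element of the cactus group is a
crystal automorphism of words, and row insertion is a sequence of crystal operators. The two
therefore commute, and only the action on words of lowest weight remains to be computed.

Structure of the crystal of words. A word is a 0-1 matrix with one column per letter. The crystal
operators move units between rows; a second crystal structure moves units between adjacent columns,
and the two commute (`bisim_rowStep`, `bisim_colStep`). A matrix that is lowest for the first
structure and highest for the second is antidiagonal, hence determined by its row sums or by its
column sums. So a component has a unique lowest word (`Conn.eq_of_lowest`), and lowest words of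
equal length and content have isomorphic components (`exists_bisim_of_lowest`). With the symmetry of
weights (`count_low`) this yields a Schützenberger involution `xi`, unique by `SchLike.eq`.

The long element. The recursion by commutors collapses to `long`, the composite of `xi` with the
reverse complement (`toWord_longElement`). Its application to a factor, `seg`, commutes with all
crystal operators (`auto_seg`), and uniqueness of `xi` gives the nested cactus relation
(`long_seg`).

Tableaux. A standard tableau is encoded by the lowest word `tabWord` that lists the rows of its
entries. The isomorphism types of factors of a word are invariants of its component, and a local
rule for them (`local_rule`) shows that a product of four long elements acts on lowest words as a
Bender–Knuth involution (`bkOp_eq`, `tabWord_benderKnuth`). Hence the generators of `C_n` act on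
`tabWord` exactly as in the Berenstein–Kirillov action (`tabWord_action`).

Insertion. In the word of `w` the letter `t` stands at position `w(t)`. Maximal strings of lowering
operators insert these positions one after the other (`insertTableau_sweep`), so that the final word
`lam n` is `tabWord` of `P(w)`, while the contents of the intermediate words are the shapes recorded
by `Q(w)`. An automorphism that preserves content commutes with this process: it acts on `P` as it
acts on lowest words, and fixes `Q` (`rskPair_of_auto`). -/

namespace CactusCrystal

/-! ### String data and tensor products of lists -/

/-- A set with the structure of a normal `sl₂`-crystal. -/
structure StringData (X : Type) where
  φ : X → ℕ
  ε : X → ℕ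
  f : X → Option X
  e : X → Option X
  f_eq_none : ∀ x, f x = none ↔ φ x = 0
  e_eq_none : ∀ x, e x = none ↔ ε x = 0
  f_iff : ∀ x y, f x = some y ↔ e y = some x
  φ_f : ∀ x y, f x = some y → φ x = φ y + 1
  ε_f : ∀ x y, f x = some y → ε y = ε x + 1

namespace StringData

variable {X Y : Type}

theorem exists_f (s : StringData X) {x : X} (h : s.φ x ≠ 0) : ∃ y, s.f x = some y := by
  rw [← Option.ne_none_iff_exists']
  exact fun h' => h ((s.f_eq_none x).1 h')

theorem exists_e (s : StringData X) {x : X} (h : s.ε x ≠ 0) : ∃ y, s.e x = some y := by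
  rw [← Option.ne_none_iff_exists']
  exact fun h' => h ((s.e_eq_none x).1 h')

theorem φ_pos (s : StringData X) {x y : X} (h : s.f x = some y) : 0 < s.φ x := by
  have := s.φ_f x y h
  omega

theorem ε_pos (s : StringData X) {x y : X} (h : s.e x = some y) : 0 < s.ε x := by
  have := s.ε_f y x ((s.f_iff y x).2 h)
  omega

/-- `φ` on lists. -/
def lφ (s : StringData X) : List X → ℕ
  | [] => 0
  | x :: l => s.φ x + (lφ s l - s.ε x)

/-- `ε` on lists. -/
def lε (s : StringData X) : List X → ℕ
  | [] => 0
  | x :: l => lε s l + (s.ε x - lφ s l)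

/-- The lowering operator on lists. -/
def lf (s : StringData X) : List X → Option (List X)
  | [] => none
  | x :: l => if lφ s l ≤ s.ε x then (s.f x).map (· :: l) else (lf s l).map (x :: ·)

/-- The raising operator on lists. -/
def le (s : StringData X) : List X → Option (List X)
  | [] => none
  | x :: l => if lφ s l < s.ε x then (s.e x).map (· :: l) else (le s l).map (x :: ·)

theorem lf_eq_none (s : StringData X) : ∀ l, s.lf l = none ↔ s.lφ l = 0
  | [] => by simp [lf, lφ]
  | x :: l => by
    have ih := lf_eq_none s l
    have hx := s.f_eq_none x
    simp only [lf, lφ]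
    split_ifs with h
    · rw [Option.map_eq_none_iff, hx]
      omega
    · rw [Option.map_eq_none_iff, ih]
      omega

theorem le_eq_none (s : StringData X) : ∀ l, s.le l = none ↔ s.lε l = 0
  | [] => by simp [le, lε]
  | x :: l => by
    have ih := le_eq_none s l
    have hx := s.e_eq_none x
    simp only [le, lε]
    split_ifs with h
    · rw [Option.map_eq_none_iff, hx]
      omega
    · rw [Option.map_eq_none_iff, ih]
      omega

/-- The three claims need a single induction: after a step in the tail, the test that selects the
active factor has to be evaluated with the new value of `lφ`. -/
theorem l_step (s : StringData X) : ∀ l l', s.lf l = some l' →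
    s.lφ l = s.lφ l' + 1 ∧ s.lε l' = s.lε l + 1 ∧ s.le l' = some l
  | [], l' => by simp [lf]
  | x :: l, l' => by
    intro h
    simp only [lf] at h
    split_ifs at h with hc
    · obtain ⟨y, hy, rfl⟩ := Option.map_eq_some_iff.1 h
      have h1 := s.φ_f x y hy
      have h2 := s.ε_f x y hy
      have h3 := (s.f_iff x y).1 hy
      simp only [lφ, lε, le]
      refine ⟨by omega, by omega, ?_⟩
      rw [if_pos (by omega), h3]
      rfl
    · obtain ⟨y, hy, rfl⟩ := Option.map_eq_some_iff.1 h
      obtain ⟨h1, h2, h3⟩ := l_step s l y hy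
      simp only [lφ, lε, le]
      refine ⟨by omega, by omega, ?_⟩
      rw [if_neg (by omega), h3]
      rfl

theorem le_lf (s : StringData X) : ∀ l l', s.le l = some l' → s.lf l' = some l
  | [], l' => by simp [le]
  | x :: l, l' => by
    intro h
    simp only [le] at h
    split_ifs at h with hc
    · obtain ⟨y, hy, rfl⟩ := Option.map_eq_some_iff.1 h
      have hy' := (s.f_iff y x).2 hy
      have h2 := s.ε_f y x hy'
      simp only [lf]
      rw [if_pos (by omega), hy']
      rfl
    · obtain ⟨y, hy, rfl⟩ := Option.map_eq_some_iff.1 h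
      have hy' := le_lf s l y hy
      obtain ⟨h1, h2, h3⟩ := l_step s y l hy'
      simp only [lf]
      rw [if_neg (by omega), hy']
      rfl

/-- The tensor power structure on lists. -/
def list (s : StringData X) : StringData (List X) where
  φ := s.lφ
  ε := s.lε
  f := s.lf
  e := s.le
  f_eq_none := s.lf_eq_none
  e_eq_none := s.le_eq_none
  f_iff l l' := ⟨fun h => (s.l_step l l' h).2.2, s.le_lf l' l⟩
  φ_f l l' h := (s.l_step l l' h).1
  ε_f l l' h := (s.l_step l l' h).2.1

@[simp] theorem list_φ_nil (s : StringData X) : s.list.φ [] = 0 := rfl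
@[simp] theorem list_ε_nil (s : StringData X) : s.list.ε [] = 0 := rfl
@[simp] theorem list_f_nil (s : StringData X) : s.list.f [] = none := rfl
@[simp] theorem list_e_nil (s : StringData X) : s.list.e [] = none := rfl

theorem list_φ_cons (s : StringData X) (x : X) (l : List X) :
    s.list.φ (x :: l) = s.φ x + (s.list.φ l - s.ε x) := rfl
theorem list_ε_cons (s : StringData X) (x : X) (l : List X) :
    s.list.ε (x :: l) = s.list.ε l + (s.ε x - s.list.φ l) := rfl
theorem list_f_cons (s : StringData X) (x : X) (l : List X) : s.list.f (x :: l) =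
    if s.list.φ l ≤ s.ε x then (s.f x).map (· :: l) else (s.list.f l).map (x :: ·) := rfl
theorem list_e_cons (s : StringData X) (x : X) (l : List X) : s.list.e (x :: l) =
    if s.list.φ l < s.ε x then (s.e x).map (· :: l) else (s.list.e l).map (x :: ·) := rfl

/-- This and the next three lemmas are the associativity of the tensor product: a block of
consecutive factors behaves like one factor with its own `φ` and `ε`. -/
theorem list_φ_append (s : StringData X) (l l' : List X) :
    s.list.φ (l ++ l') = s.list.φ l + (s.list.φ l' - s.list.ε l) := by
  induction l with
  | nil => simp
  | cons x l ih =>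
    simp only [List.cons_append, list_φ_cons, list_ε_cons, ih]
    omega

theorem list_ε_append (s : StringData X) (l l' : List X) :
    s.list.ε (l ++ l') = s.list.ε l' + (s.list.ε l - s.list.φ l') := by
  induction l with
  | nil => simp
  | cons x l ih =>
    simp only [List.cons_append, list_ε_cons, list_φ_append, ih]
    omega

theorem list_f_append (s : StringData X) (l l' : List X) : s.list.f (l ++ l') =
    if s.list.φ l' ≤ s.list.ε l then (s.list.f l).map (· ++ l')
    else (s.list.f l').map (l ++ ·) := by
  induction l with
  | nil =>
    rw [List.nil_append, list_ε_nil, list_f_nil]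
    split_ifs with h
    · exact (s.list.f_eq_none l').2 (by omega)
    · simp
  | cons x l ih =>
    simp only [List.cons_append, list_f_cons, list_ε_cons, list_φ_append, ih]
    by_cases h1 : s.list.φ l' ≤ s.list.ε l <;> by_cases h2 : s.list.φ l ≤ s.ε x <;>
    by_cases h3 : s.list.φ l + (s.list.φ l' - s.list.ε l) ≤ s.ε x <;>
    by_cases h4 : s.list.φ l' ≤ s.list.ε l + (s.ε x - s.list.φ l) <;>
    first
    | (exfalso; omega)
    | simp only [h1, h2, h3, h4, if_true, if_false, Option.map_map, Function.comp_def,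
        List.cons_append]

theorem list_e_append (s : StringData X) (l l' : List X) : s.list.e (l ++ l') =
    if s.list.φ l' < s.list.ε l then (s.list.e l).map (· ++ l')
    else (s.list.e l').map (l ++ ·) := by
  induction l with
  | nil => simp
  | cons x l ih =>
    simp only [List.cons_append, list_e_cons, list_ε_cons, list_φ_append, ih]
    by_cases h1 : s.list.φ l' < s.list.ε l <;> by_cases h2 : s.list.φ l < s.ε x <;>
    by_cases h3 : s.list.φ l + (s.list.φ l' - s.list.ε l) < s.ε x <;>
    by_cases h4 : s.list.φ l' < s.list.ε l + (s.ε x - s.list.φ l) <;>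
    first
    | (exfalso; omega)
    | simp only [h1, h2, h3, h4, if_true, if_false, Option.map_map, Function.comp_def,
        List.cons_append]

theorem list_f_length (s : StringData X) : ∀ {l l' : List X}, s.list.f l = some l' →
    l'.length = l.length
  | [], l', h => by simp at h
  | x :: l, l', h => by
    rw [list_f_cons] at h
    split_ifs at h
    · obtain ⟨y, _, rfl⟩ := Option.map_eq_some_iff.1 h
      rfl
    · obtain ⟨y, hy, rfl⟩ := Option.map_eq_some_iff.1 h
      simp [list_f_length s hy]

theorem list_e_length (s : StringData X) {l l' : List X} (h : s.list.e l = some l') :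
    l'.length = l.length :=
  (s.list_f_length ((s.list.f_iff l' l).2 h)).symm

/-- A relation compatible with two string structures. -/
structure Bisim (s : StringData X) (t : StringData Y) (R : X → Y → Prop) : Prop where
  φ : ∀ x y, R x y → s.φ x = t.φ y
  ε : ∀ x y, R x y → s.ε x = t.ε y
  f : ∀ x y x', R x y → s.f x = some x' → ∃ y', t.f y = some y' ∧ R x' y'
  e : ∀ x y x', R x y → s.e x = some x' → ∃ y', t.e y = some y' ∧ R x' y'

/-- Since `φ` and `ε` agree, an operator is defined on one side exactly when it is defined on the
other, so forward transfer already implies backward transfer. -/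
theorem Bisim.symm {s : StringData X} {t : StringData Y} {R : X → Y → Prop}
    (h : Bisim s t R) : Bisim t s (fun y x => R x y) where
  φ y x r := (h.φ x y r).symm
  ε y x r := (h.ε x y r).symm
  f y x y' r hy := by
    obtain ⟨x', hx⟩ := s.exists_f (x := x) (by rw [h.φ x y r]; exact (t.φ_pos hy).ne')
    obtain ⟨y'', h1, h2⟩ := h.f x y x' r hx
    rw [hy] at h1
    cases h1
    exact ⟨x', hx, h2⟩
  e y x y' r hy := by
    obtain ⟨x', hx⟩ := s.exists_e (x := x) (by rw [h.ε x y r]; exact (t.ε_pos hy).ne')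
    obtain ⟨y'', h1, h2⟩ := h.e x y x' r hx
    rw [hy] at h1
    cases h1
    exact ⟨x', hx, h2⟩

theorem Bisim.comp {Z : Type} {s : StringData X} {t : StringData Y} {u : StringData Z}
    {R : X → Y → Prop} {S : Y → Z → Prop} (h : Bisim s t R) (k : Bisim t u S) :
    Bisim s u (fun x z => ∃ y, R x y ∧ S y z) where
  φ := fun x z ⟨y, r, r'⟩ => (h.φ x y r).trans (k.φ y z r')
  ε := fun x z ⟨y, r, r'⟩ => (h.ε x y r).trans (k.ε y z r')
  f := fun x z x' ⟨y, r, r'⟩ hx => by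
    obtain ⟨y', h1, h2⟩ := h.f x y x' r hx
    obtain ⟨z', h3, h4⟩ := k.f y z y' r' h1
    exact ⟨z', h3, y', h2, h4⟩
  e := fun x z x' ⟨y, r, r'⟩ hx => by
    obtain ⟨y', h1, h2⟩ := h.e x y x' r hx
    obtain ⟨z', h3, h4⟩ := k.e y z y' r' h1
    exact ⟨z', h3, y', h2, h4⟩

/-- The relation `R` applied to a factor of a list which starts at position `j`. -/
def Context (j : ℕ) (R : List X → List X → Prop) (l l' : List X) : Prop :=
  ∃ A m m' B, A.length = j ∧ l = A ++ (m ++ B) ∧ l' = A ++ (m' ++ B) ∧ R m m'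

/-- The signature rule chooses the active block by comparing values of `φ` and `ε`, and these are
the same for the two related blocks. The operator thus acts on the same block in both lists. -/
theorem Bisim.context {s : StringData X} {R : List X → List X → Prop}
    (h : Bisim s.list s.list R) (j : ℕ) : Bisim s.list s.list (Context j R) where
  φ := by
    rintro _ _ ⟨A, m, m', B, hA, rfl, rfl, r⟩
    simp only [list_φ_append, h.φ _ _ r, h.ε _ _ r]
  ε := by
    rintro _ _ ⟨A, m, m', B, hA, rfl, rfl, r⟩
    simp only [list_φ_append, list_ε_append, h.φ _ _ r, h.ε _ _ r]
  f := by
    rintro _ _ x' ⟨A, m, m', B, hA, rfl, rfl, r⟩ hx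
    have h1 := h.φ _ _ r
    have h2 := h.ε _ _ r
    rw [list_f_append, list_φ_append] at hx ⊢
    rw [← h1, ← h2]
    split_ifs at hx ⊢ with hc
    · obtain ⟨A', hA', rfl⟩ := Option.map_eq_some_iff.1 hx
      exact ⟨_, by rw [hA']; rfl, A', m, m', B, by rw [s.list_f_length hA', hA], rfl, rfl, r⟩
    · rw [list_f_append] at hx ⊢
      rw [← h2]
      split_ifs at hx ⊢ with hc
      · obtain ⟨_, h3, rfl⟩ := Option.map_eq_some_iff.1 hx
        obtain ⟨n, hn, rfl⟩ := Option.map_eq_some_iff.1 h3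
        obtain ⟨n', hn', r'⟩ := h.f _ _ _ r hn
        exact ⟨_, by rw [hn']; rfl, A, n, n', B, hA, rfl, rfl, r'⟩
      · obtain ⟨_, h3, rfl⟩ := Option.map_eq_some_iff.1 hx
        obtain ⟨B', hB', rfl⟩ := Option.map_eq_some_iff.1 h3
        exact ⟨_, by rw [hB']; rfl, A, m, m', B', hA, rfl, rfl, r⟩
  e := by
    rintro _ _ x' ⟨A, m, m', B, hA, rfl, rfl, r⟩ hx
    have h1 := h.φ _ _ r
    have h2 := h.ε _ _ r
    rw [list_e_append, list_φ_append] at hx ⊢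
    rw [← h1, ← h2]
    split_ifs at hx ⊢ with hc
    · obtain ⟨A', hA', rfl⟩ := Option.map_eq_some_iff.1 hx
      exact ⟨_, by rw [hA']; rfl, A', m, m', B, by rw [s.list_e_length hA', hA], rfl, rfl, r⟩
    · rw [list_e_append] at hx ⊢
      rw [← h2]
      split_ifs at hx ⊢ with hc
      · obtain ⟨_, h3, rfl⟩ := Option.map_eq_some_iff.1 hx
        obtain ⟨n, hn, rfl⟩ := Option.map_eq_some_iff.1 h3
        obtain ⟨n', hn', r'⟩ := h.e _ _ _ r hn
        exact ⟨_, by rw [hn']; rfl, A, n, n', B, hA, rfl, rfl, r'⟩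
      · obtain ⟨_, h3, rfl⟩ := Option.map_eq_some_iff.1 hx
        obtain ⟨B', hB', rfl⟩ := Option.map_eq_some_iff.1 h3
        exact ⟨_, by rw [hB']; rfl, A, m, m', B', hA, rfl, rfl, r⟩

/-- `φ - ε` is additive over factors; the equation is arranged so that no truncated subtraction
between the totals appears. -/
theorem list_φ_sub_ε (s : StringData X) (l : List X) :
    s.list.φ l + (l.map s.ε).sum = s.list.ε l + (l.map s.φ).sum := by
  induction l with
  | nil => simp
  | cons x l ih =>
    simp only [list_φ_cons, list_ε_cons, List.map_cons, List.sum_cons]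
    omega

theorem list_φ_prefix (s : StringData X) {A B : List X} (h : s.list.φ (A ++ B) = 0) :
    s.list.φ A = 0 := by
  rw [list_φ_append] at h
  omega

theorem list_ε_suffix (s : StringData X) {A B : List X} (h : s.list.ε (A ++ B) = 0) :
    s.list.ε B = 0 := by
  rw [list_ε_append] at h
  omega

/-- The lattice condition for lowest weight lists. -/
theorem list_φ_eq_zero (s : StringData X) {A : List X} {x : X} (h : s.list.φ (A ++ [x]) = 0) :
    ((A ++ [x]).map s.φ).sum ≤ (A.map s.ε).sum := by
  have h1 := s.list_φ_sub_ε A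
  have h2 := s.list_φ_prefix h
  rw [list_φ_append, list_φ_cons] at h
  simp at h ⊢
  omega

/-- The lattice condition for highest weight lists. -/
theorem list_ε_eq_zero (s : StringData X) {B : List X} {x : X} (h : s.list.ε (x :: B) = 0) :
    ((x :: B).map s.ε).sum ≤ (B.map s.φ).sum := by
  have h1 := s.list_φ_sub_ε B
  rw [list_ε_cons] at h
  simp at h ⊢
  omega

end StringData

/-- The string structure with index `i` on letters. -/
def letter (i : ℕ) : StringData ℕ where
  φ x := if x = i then 1 else 0
  ε x := if x = i + 1 then 1 else 0
  f x := if x = i then some (i + 1) else none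
  e x := if x = i + 1 then some i else none
  f_eq_none x := by split_ifs <;> simp
  e_eq_none x := by split_ifs <;> simp
  f_iff x y := by
    split_ifs
    all_goals simp
    all_goals omega
  φ_f x y := by
    split_ifs
    all_goals simp
    all_goals omega
  ε_f x y := by
    split_ifs
    all_goals simp
    all_goals omega

/-- The string structure on pairs of natural numbers: `f` moves one unit to the right. -/
def pair : StringData (ℕ × ℕ) where
  φ x := x.1
  ε x := x.2
  f x := if 0 < x.1 then some (x.1 - 1, x.2 + 1) else none
  e x := if 0 < x.2 then some (x.1 + 1, x.2 - 1) else none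
  f_eq_none x := by
    split_ifs
    all_goals simp
    all_goals omega
  e_eq_none x := by
    split_ifs
    all_goals simp
    all_goals omega
  f_iff x y := by
    obtain ⟨a, b⟩ := x
    obtain ⟨c, d⟩ := y
    split_ifs <;> simp at * <;> omega
  φ_f x y := by
    obtain ⟨a, b⟩ := x
    obtain ⟨c, d⟩ := y
    split_ifs <;> simp at * <;> omega
  ε_f x y := by
    obtain ⟨a, b⟩ := x
    obtain ⟨c, d⟩ := y
    split_ifs <;> simp at * <;> omega

end CactusCrystal

/-! ### Components of the crystal of words, by two commuting crystal structures on matrices -/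

namespace CactusCrystal

open StringData

/-! ### The bicrystal structure on matrices -/

/-- The string structure with index `i` on columns (multisets of letters). -/
def col (i : ℕ) : StringData (ℕ → ℕ) where
  φ c := c i
  ε c := c (i + 1)
  f c := if 0 < c i then
    some (fun r => if r = i then c r - 1 else if r = i + 1 then c r + 1 else c r) else none
  e c := if 0 < c (i + 1) then
    some (fun r => if r = i then c r + 1 else if r = i + 1 then c r - 1 else c r) else none
  f_eq_none c := by
    split_ifs
    all_goals simp
    all_goals omega
  e_eq_none c := by
    split_ifs
    all_goals simp
    all_goals omega
  f_iff c d := by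
    constructor
    · intro h
      split_ifs at h with hc
      cases h
      rw [if_pos (by simp)]
      congr 1
      funext r
      by_cases h1 : r = i
      · subst h1
        simp
        omega
      · by_cases h2 : r = i + 1 <;> simp [h1, h2]
    · intro h
      split_ifs at h with hc
      cases h
      rw [if_pos (by simp)]
      congr 1
      funext r
      by_cases h1 : r = i
      · subst h1
        simp
      · by_cases h2 : r = i + 1
        · subst h2
          simp
          omega
        · simp [h1, h2]
  φ_f c d h := by
    split_ifs at h with hc
    cases h
    simp
    omega
  ε_f c d h := by
    split_ifs at h with hc
    cases h
    simp

/-- The rows of the matrix with columns `c` and `d`. -/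
def rows (n : ℕ) (c d : ℕ → ℕ) : List (ℕ × ℕ) := (List.range n).map fun r => (c r, d r)

@[simp] theorem length_rows (n : ℕ) (c d : ℕ → ℕ) : (rows n c d).length = n := by
  simp [rows]

theorem rows_eq_rows_iff {n : ℕ} {c d c' d' : ℕ → ℕ} :
    rows n c d = rows n c' d' ↔ ∀ r < n, c r = c' r ∧ d r = d' r := by
  simp [rows]

theorem range_split {n r : ℕ} (h : r < n) :
    List.range n = List.range r ++ r :: List.range' (r + 1) (n - r - 1) := by
  have h1 : n = r + (n - r) := by omega
  conv_lhs => rw [h1, List.range_eq_range', ← List.range'_append_1]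
  rw [Nat.zero_add, List.range_eq_range']
  congr 1
  conv_lhs => rw [show n - r = (n - r - 1) + 1 by omega, List.range'_succ]

theorem range_split_two {n i : ℕ} (h : i + 1 < n) :
    List.range n = List.range i ++ ([i, i + 1] ++ List.range' (i + 2) (n - i - 2)) := by
  rw [range_split (show i < n by omega)]
  congr 1
  rw [show n - i - 1 = (n - i - 2) + 1 by omega, List.range'_succ]
  rfl

/-- Columns are functions on all of `ℕ`, so a list of `n` rows determines them only below `n`; `c`
and `d` supply the values from `n` on. -/
theorem rows_surjective (n : ℕ) (y : List (ℕ × ℕ)) (hy : y.length = n) (c d : ℕ → ℕ) :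
    ∃ c' d', rows n c' d' = y ∧ ∀ r, n ≤ r → c' r = c r ∧ d' r = d r := by
  refine ⟨fun r => if h : r < y.length then (y[r]).1 else c r,
    fun r => if h : r < y.length then (y[r]).2 else d r, ?_, ?_⟩
  · apply List.ext_getElem
    · simp [hy]
    · intro k h1 h2
      simp [rows, h2]
  · intro r hr
    simp [hy, Nat.not_lt.2 hr]

/-- Lowering between the two rows of a two by two matrix. -/
def RowStep (m m' : List (ℕ × ℕ)) : Prop := ∃ p q r s, m = [(p, q), (r, s)] ∧
  ((q ≤ r ∧ 0 < p ∧ m' = [(p - 1, q), (r + 1, s)]) ∨ (r < q ∧ m' = [(p, q - 1), (r, s + 1)]))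

theorem pair_list_f_two (p q r s : ℕ) : pair.list.f [(p, q), (r, s)] =
    if r ≤ q then (if 0 < p then some [(p - 1, q + 1), (r, s)] else none)
    else some [(p, q), (r - 1, s + 1)] := by
  simp only [list_f_cons, list_φ_cons, list_φ_nil, list_f_nil]
  simp only [pair]
  split_ifs <;> first | rfl | (exfalso; omega)

theorem pair_list_e_two (p q r s : ℕ) : pair.list.e [(p, q), (r, s)] =
    if r < q then some [(p + 1, q - 1), (r, s)]
    else (if 0 < s then some [(p, q), (r + 1, s - 1)] else none) := by
  simp only [list_e_cons, list_φ_cons, list_φ_nil, list_e_nil]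
  simp only [pair]
  split_ifs <;> first | rfl | (exfalso; omega)

theorem pair_list_φ_two (p q r s : ℕ) : pair.list.φ [(p, q), (r, s)] = p + (r - q) := by
  simp [list_φ_cons, pair]

theorem pair_list_ε_two (p q r s : ℕ) : pair.list.ε [(p, q), (r, s)] = s + (q - r) := by
  simp [list_ε_cons, list_φ_cons, pair]

/-- The two by two case of the commutation between the row and column structures. It is a finite
check with the explicit formulas above, and the general case is reduced to it by placing the block
in a context. -/
theorem bisim_rowStep : Bisim pair.list pair.list RowStep where
  φ := by
    rintro _ _ ⟨p, q, r, s, rfl, ⟨h1, h2, rfl⟩ | ⟨h1, rfl⟩⟩ <;>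
    · simp only [pair_list_φ_two]
      omega
  ε := by
    rintro _ _ ⟨p, q, r, s, rfl, ⟨h1, h2, rfl⟩ | ⟨h1, rfl⟩⟩ <;>
    · simp only [pair_list_ε_two]
      omega
  f := by
    rintro _ _ x' ⟨p, q, r, s, rfl, ⟨h1, h2, rfl⟩ | ⟨h1, rfl⟩⟩ hx <;>
    rw [pair_list_f_two] at hx ⊢
    · split_ifs at hx with h3
      · cases hx
        rw [if_neg (by omega)]
        refine ⟨_, rfl, _, _, _, _, rfl, ?_⟩
        simp
        omega
      · cases hx
        rw [if_neg (by omega)]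
        refine ⟨_, rfl, _, _, _, _, rfl, ?_⟩
        simp
        omega
    · split_ifs at hx with h3 h4
      · cases hx
        rw [if_pos (by omega), if_pos (by omega)]
        refine ⟨_, rfl, _, _, _, _, rfl, ?_⟩
        simp
        omega
      · omega
  e := by
    rintro _ _ x' ⟨p, q, r, s, rfl, ⟨h1, h2, rfl⟩ | ⟨h1, rfl⟩⟩ hx <;>
    rw [pair_list_e_two] at hx ⊢
    · split_ifs at hx with h3 h4
      · omega
      · cases hx
        rw [if_neg (by omega), if_pos (by omega)]
        refine ⟨_, rfl, _, _, _, _, rfl, ?_⟩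
        simp
        omega
    · split_ifs at hx with h3
      cases hx
      by_cases h4 : r < q - 1
      · rw [if_pos h4]
        refine ⟨_, rfl, _, _, _, _, rfl, ?_⟩
        simp
        omega
      · rw [if_neg h4, if_pos (by omega)]
        refine ⟨_, rfl, _, _, _, _, rfl, ?_⟩
        simp
        omega

theorem col_list_f_two (i : ℕ) (c d : ℕ → ℕ) : (col i).list.f [c, d] =
    if d i ≤ c (i + 1) then ((col i).f c).map (fun c' => [c', d])
    else ((col i).f d).map (fun d' => [c, d']) := by
  simp only [list_f_cons, list_φ_cons, list_φ_nil, list_f_nil]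
  simp only [show (col i).φ d = d i from rfl, show (col i).ε c = c (i + 1) from rfl,
    Nat.zero_sub, Nat.add_zero, Nat.zero_le, if_true, Option.map_map]
  rfl

/-- Lowering a pair of columns touches only the rows `i` and `i + 1`. In the list of rows it is
therefore a change of a two by two block with unchanged surroundings. -/
theorem rowStep_of_col {n i : ℕ} (hi : i + 1 < n) {c d : ℕ → ℕ} {x : List (ℕ → ℕ)}
    (h : (col i).list.f [c, d] = some x) : ∃ c' d', x = [c', d'] ∧
      Context i RowStep (rows n c d) (rows n c' d') ∧ ∀ r, n ≤ r → c' r = c r ∧ d' r = d r := by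
  have key : ∀ c' d' : ℕ → ℕ, (∀ r, r ≠ i → r ≠ i + 1 → c' r = c r ∧ d' r = d r) →
      RowStep [(c i, d i), (c (i + 1), d (i + 1))] [(c' i, d' i), (c' (i + 1), d' (i + 1))] →
      Context i RowStep (rows n c d) (rows n c' d') := by
    intro c' d' h1 h2
    refine ⟨(List.range i).map (fun r => (c r, d r)), _, _,
      (List.range' (i + 2) (n - i - 2)).map (fun r => (c r, d r)), by simp, ?_, ?_, h2⟩
    · rw [rows, range_split_two hi]
      simp
    · rw [rows, range_split_two hi, List.map_append, List.map_append]
      congr 1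
      · apply List.map_congr_left
        intro r hr
        have := List.mem_range.1 hr
        have := h1 r (by omega) (by omega)
        rw [this.1, this.2]
      · congr 1
        apply List.map_congr_left
        intro r hr
        have := List.mem_range'_1.1 hr
        have := h1 r (by omega) (by omega)
        rw [this.1, this.2]
  rw [col_list_f_two] at h
  split_ifs at h with hc
  · obtain ⟨c', hc', rfl⟩ := Option.map_eq_some_iff.1 h
    have h0 := (col i).φ_pos hc'
    simp only [col] at hc' h0
    rw [if_pos h0] at hc'
    cases hc'
    refine ⟨_, d, rfl, key _ _ ?_ ?_, ?_⟩
    · intro r h1 h2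
      simp [h1, h2]
    · exact ⟨_, _, _, _, rfl, Or.inl ⟨hc, h0, by simp⟩⟩
    · intro r hr
      simp [show r ≠ i by omega, show r ≠ i + 1 by omega]
  · obtain ⟨d', hd', rfl⟩ := Option.map_eq_some_iff.1 h
    have h0 := (col i).φ_pos hd'
    simp only [col] at hd' h0
    rw [if_pos h0] at hd'
    cases hd'
    refine ⟨c, _, rfl, key _ _ ?_ ?_, ?_⟩
    · intro r h1 h2
      simp [h1, h2]
    · exact ⟨_, _, _, _, rfl, Or.inr ⟨by omega, by simp⟩⟩
    · intro r hr
      simp [show r ≠ i by omega, show r ≠ i + 1 by omega]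

theorem append_inj_three {X : Type} {A A' m m' B B' : List X} (h : A ++ (m ++ B) = A' ++ (m' ++ B'))
    (hA : A.length = A'.length) (hm : m.length = m'.length) : A = A' ∧ m = m' ∧ B = B' := by
  obtain ⟨h1, h2⟩ := List.append_inj h hA
  obtain ⟨h3, h4⟩ := List.append_inj h2 hm
  exact ⟨h1, h3, h4⟩

theorem RowStep.unique {m m' m'' : List (ℕ × ℕ)} (h : RowStep m m') (h' : RowStep m m'') :
    m' = m'' := by
  obtain ⟨p, q, r, s, rfl, h⟩ := h
  obtain ⟨p', q', r', s', h1, h'⟩ := h'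
  simp only [List.cons.injEq, Prod.mk.injEq, and_true] at h1
  obtain ⟨⟨rfl, rfl⟩, rfl, rfl⟩ := h1
  rcases h with ⟨h1, h2, rfl⟩ | ⟨h1, rfl⟩ <;> rcases h' with ⟨h3, h4, rfl⟩ | ⟨h3, rfl⟩ <;>
    first | rfl | omega

theorem RowStep.length {m m' : List (ℕ × ℕ)} (h : RowStep m m') :
    m.length = 2 ∧ m'.length = 2 := by
  obtain ⟨p, q, r, s, rfl, ⟨h1, h2, rfl⟩ | ⟨h1, rfl⟩⟩ := h <;> simp

theorem context_rowStep_unique {i : ℕ} {y y' y'' : List (ℕ × ℕ)}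
    (h : Context i RowStep y y') (h' : Context i RowStep y y'') : y' = y'' := by
  obtain ⟨A, m, m', B, hA, rfl, rfl, hm⟩ := h
  obtain ⟨A1, m1, m1', B1, hA1, h1, rfl, hm1⟩ := h'
  obtain ⟨rfl, rfl, rfl⟩ := append_inj_three h1 (hA.trans hA1.symm)
    (hm.length.1.trans hm1.length.1.symm)
  rw [hm.unique hm1]

/-- A `RowStep` in a given place has only one possible result, so after `rowStep_of_col` it is
enough that the lowering operator is defined, which is read off from `φ`. -/
theorem col_of_rowStep {n i : ℕ} (hi : i + 1 < n) {c d : ℕ → ℕ} {y : List (ℕ × ℕ)}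
    (h : Context i RowStep (rows n c d) y) : ∃ c' d', y = rows n c' d' ∧
      (col i).list.f [c, d] = some [c', d'] ∧ ∀ r, n ≤ r → c' r = c r ∧ d' r = d r := by
  have hdef : ∃ x, (col i).list.f [c, d] = some x := by
    apply StringData.exists_f
    obtain ⟨A, m, m', B, hA, h1, rfl, hm⟩ := h
    have hr : rows n c d = (List.range i).map (fun r => (c r, d r)) ++
        ([(c i, d i), (c (i + 1), d (i + 1))] ++
          (List.range' (i + 2) (n - i - 2)).map (fun r => (c r, d r))) := by
      rw [rows, range_split_two hi]
      simp
    rw [hr] at h1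
    obtain ⟨-, rfl, -⟩ := append_inj_three h1 (by simp [hA]) (by simp [hm.length.1])
    obtain ⟨p, q, r, s, h2, h3⟩ := hm
    simp only [List.cons.injEq, Prod.mk.injEq, and_true] at h2
    obtain ⟨⟨rfl, rfl⟩, rfl, rfl⟩ := h2
    have : (col i).list.φ [c, d] = c i + (d i - c (i + 1)) := by
      simp [list_φ_cons, col]
    rw [this]
    rcases h3 with ⟨h1, h2, rfl⟩ | ⟨h1, rfl⟩ <;> omega
  obtain ⟨x, hx⟩ := hdef
  obtain ⟨c', d', rfl, h1, h2⟩ := rowStep_of_col hi hx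
  exact ⟨c', d', context_rowStep_unique h h1, hx, h2⟩

/-- Raising between two adjacent columns. -/
def ColStep (n : ℕ) (m m' : List (ℕ → ℕ)) : Prop := ∃ c d c' d', m = [c, d] ∧ m' = [c', d'] ∧
  pair.list.e (rows n c d) = some (rows n c' d') ∧ ∀ r, n ≤ r → c' r = c r ∧ d' r = d r

/-- Both expressions involve only the rows `i` and `i + 1`. A raising in another row leaves them
alone, and a raising inside the block is one of the two cases of `pair_list_e_two`. -/
theorem col_two_invariant {n i : ℕ} (hi : i + 1 < n) {c d c' d' : ℕ → ℕ}
    (h : pair.list.e (rows n c d) = some (rows n c' d')) :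
    c i + (d i - c (i + 1)) = c' i + (d' i - c' (i + 1)) ∧
      d (i + 1) + (c (i + 1) - d i) = d' (i + 1) + (c' (i + 1) - d' i) := by
  have hr : ∀ c d : ℕ → ℕ, rows n c d = (List.range i).map (fun r => (c r, d r)) ++
      ([(c i, d i), (c (i + 1), d (i + 1))] ++
        (List.range' (i + 2) (n - i - 2)).map (fun r => (c r, d r))) := by
    intro c d
    rw [rows, range_split_two hi]
    simp
  rw [hr, hr, list_e_append] at h
  have triv : [(c i, d i), (c (i + 1), d (i + 1))] = [(c' i, d' i), (c' (i + 1), d' (i + 1))] →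
      c i + (d i - c (i + 1)) = c' i + (d' i - c' (i + 1)) ∧
      d (i + 1) + (c (i + 1) - d i) = d' (i + 1) + (c' (i + 1) - d' i) := by
    intro h2
    simp only [List.cons.injEq, Prod.mk.injEq, and_true] at h2
    obtain ⟨⟨h1, h2⟩, h3, h4⟩ := h2
    rw [h1, h2, h3, h4]
    exact ⟨rfl, rfl⟩
  split_ifs at h with hc
  · obtain ⟨A, hA, h1⟩ := Option.map_eq_some_iff.1 h
    exact triv (append_inj_three h1 (by rw [pair.list_e_length hA]; simp) rfl).2.1
  · obtain ⟨_, hm, h1⟩ := Option.map_eq_some_iff.1 h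
    rw [list_e_append] at hm
    split_ifs at hm with hc'
    · obtain ⟨m, hm', rfl⟩ := Option.map_eq_some_iff.1 hm
      have h2 := (append_inj_three h1 (by simp) (by rw [pair.list_e_length hm']; simp)).2.1
      rw [h2, pair_list_e_two] at hm'
      split_ifs at hm' with h3 h4
      all_goals
        simp only [Option.some.injEq, List.cons.injEq, Prod.mk.injEq, and_true] at hm'
        omega
    · obtain ⟨B, hB, rfl⟩ := Option.map_eq_some_iff.1 hm
      exact triv (append_inj_three h1 (by simp) rfl).2.1

theorem col_list_φ_two (i : ℕ) (c d : ℕ → ℕ) :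
    (col i).list.φ [c, d] = c i + (d i - c (i + 1)) := by
  simp [list_φ_cons, col]

theorem col_list_ε_two (i : ℕ) (c d : ℕ → ℕ) :
    (col i).list.ε [c, d] = d (i + 1) + (c (i + 1) - d i) := by
  simp [list_ε_cons, list_φ_cons, col]

/-- The commutation of the two structures. Seen on the list of rows, lowering by `col i` is a
`RowStep` in a context, which is a bisimulation for `pair.list`; this closes the square formed by
the two kinds of operators. -/
theorem bisim_colStep {n i : ℕ} (hi : i + 1 < n) :
    Bisim (col i).list (col i).list (ColStep n) where
  φ := by
    rintro _ _ ⟨c, d, c', d', rfl, rfl, h, h'⟩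
    rw [col_list_φ_two, col_list_φ_two]
    exact (col_two_invariant hi h).1
  ε := by
    rintro _ _ ⟨c, d, c', d', rfl, rfl, h, h'⟩
    rw [col_list_ε_two, col_list_ε_two]
    exact (col_two_invariant hi h).2
  f := by
    rintro _ _ x ⟨c, d, c', d', rfl, rfl, h, h'⟩ hx
    obtain ⟨c1, d1, rfl, h1, h2⟩ := rowStep_of_col hi hx
    obtain ⟨y, hy, h3⟩ := (bisim_rowStep.context i).e _ _ _ h1 h
    obtain ⟨c2, d2, rfl, h4, h5⟩ := col_of_rowStep hi h3
    refine ⟨_, h4, c1, d1, c2, d2, rfl, rfl, hy, fun r hr => ?_⟩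
    rw [(h5 r hr).1, (h5 r hr).2, (h' r hr).1, (h' r hr).2, (h2 r hr).1, (h2 r hr).2]
    exact ⟨rfl, rfl⟩
  e := by
    rintro _ _ x ⟨c, d, c', d', rfl, rfl, h, h'⟩ hx
    have hl := (col i).list_e_length hx
    obtain ⟨c1, d1, rfl⟩ := List.length_eq_two.1 hl
    have hx' := ((col i).list.f_iff _ _).2 hx
    obtain ⟨c0, d0, h0, h1, h2⟩ := rowStep_of_col hi hx'
    simp only [List.cons.injEq, and_true] at h0
    obtain ⟨rfl, rfl⟩ := h0
    obtain ⟨y, hy, h3⟩ := (bisim_rowStep.context i).symm.e _ _ _ h1 h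
    -- The missing corner of the square is known only as a list of rows. Its entries from row `n` on
    -- are taken from `c'` and `d'`, which raising does not change.
    obtain ⟨c2, d2, rfl, h4⟩ := rows_surjective n y
      (by rw [pair.list_e_length hy, length_rows]) c' d'
    obtain ⟨c3, d3, h5, h6, h7⟩ := col_of_rowStep hi h3
    have h8 := rows_eq_rows_iff.1 h5
    have hc : c3 = c' := by
      funext r
      rcases lt_or_ge r n with hr | hr
      · exact (h8 r hr).1.symm
      · rw [(h7 r hr).1, (h4 r hr).1]
    have hd : d3 = d' := by
      funext r
      rcases lt_or_ge r n with hr | hr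
      · exact (h8 r hr).2.symm
      · rw [(h7 r hr).2, (h4 r hr).2]
    rw [hc, hd] at h6
    refine ⟨_, ((col i).list.f_iff _ _).1 h6, c1, d1, c2, d2, rfl, rfl, hy, fun r hr => ?_⟩
    rw [(h4 r hr).1, (h4 r hr).2, (h' r hr).1, (h' r hr).2, (h2 r hr).1, (h2 r hr).2]
    exact ⟨rfl, rfl⟩

end CactusCrystal

namespace CactusCrystal

open StringData

/-! ### Highest weights for columns -/

/-- Raising between the columns `j` and `j + 1` of a matrix. -/
def Raise (n j : ℕ) : List (ℕ → ℕ) → List (ℕ → ℕ) → Prop := Context j (ColStep n)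

/-- A sequence of raisings. -/
def RaiseSeq (n : ℕ) : List ℕ → List (ℕ → ℕ) → List (ℕ → ℕ) → Prop
  | [] => fun M M' => M = M'
  | j :: js => fun M M' => ∃ K, Raise n j M K ∧ RaiseSeq n js K M'

theorem bisim_eq {X : Type} (s : StringData X) : Bisim s s (· = ·) where
  φ := by rintro x _ rfl; rfl
  ε := by rintro x _ rfl; rfl
  f := by rintro x _ x' rfl h; exact ⟨x', h, rfl⟩
  e := by rintro x _ x' rfl h; exact ⟨x', h, rfl⟩

theorem bisim_raiseSeq {n i : ℕ} (hi : i + 1 < n) :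
    ∀ js, Bisim (col i).list (col i).list (RaiseSeq n js)
  | [] => bisim_eq _
  | j :: js => ((bisim_colStep hi).context j).comp (bisim_raiseSeq hi js)

theorem rows_ext {n : ℕ} {c d c' d' : ℕ → ℕ} (h : rows n c d = rows n c' d')
    (h' : ∀ r, n ≤ r → c r = c' r ∧ d r = d' r) : c = c' ∧ d = d' := by
  have h1 := rows_eq_rows_iff.1 h
  constructor <;> funext r <;> rcases lt_or_ge r n with hr | hr
  · exact (h1 r hr).1
  · exact (h' r hr).1
  · exact (h1 r hr).2
  · exact (h' r hr).2

theorem ColStep.unique {n : ℕ} {m m' m'' : List (ℕ → ℕ)} (h : ColStep n m m')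
    (h' : ColStep n m m'') : m' = m'' := by
  obtain ⟨c, d, c', d', rfl, rfl, h1, h2⟩ := h
  obtain ⟨c1, d1, c1', d1', h0, rfl, h3, h4⟩ := h'
  simp only [List.cons.injEq, and_true] at h0
  obtain ⟨rfl, rfl⟩ := h0
  rw [h1] at h3
  obtain ⟨rfl, rfl⟩ := rows_ext (Option.some.inj h3) (fun r hr => by
    rw [(h2 r hr).1, (h2 r hr).2, (h4 r hr).1, (h4 r hr).2]
    exact ⟨rfl, rfl⟩)
  rfl

theorem ColStep.injective {n : ℕ} {m m' m'' : List (ℕ → ℕ)} (h : ColStep n m' m)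
    (h' : ColStep n m'' m) : m' = m'' := by
  obtain ⟨c, d, c', d', rfl, rfl, h1, h2⟩ := h
  obtain ⟨c1, d1, c1', d1', rfl, h0, h3, h4⟩ := h'
  simp only [List.cons.injEq, and_true] at h0
  obtain ⟨rfl, rfl⟩ := h0
  rw [← pair.list.f_iff] at h1 h3
  rw [h1] at h3
  obtain ⟨rfl, rfl⟩ := rows_ext (Option.some.inj h3) (fun r hr => by
    rw [← (h2 r hr).1, ← (h2 r hr).2, ← (h4 r hr).1, ← (h4 r hr).2]
    exact ⟨rfl, rfl⟩)
  rfl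

theorem ColStep.length {n : ℕ} {m m' : List (ℕ → ℕ)} (h : ColStep n m m') :
    m.length = 2 ∧ m'.length = 2 := by
  obtain ⟨c, d, c', d', rfl, rfl, h1, h2⟩ := h
  exact ⟨rfl, rfl⟩

theorem Raise.unique {n j : ℕ} {M M' M'' : List (ℕ → ℕ)} (h : Raise n j M M')
    (h' : Raise n j M M'') : M' = M'' := by
  obtain ⟨A, m, m', B, hA, rfl, rfl, hm⟩ := h
  obtain ⟨A1, m1, m1', B1, hA1, h1, rfl, hm1⟩ := h'
  obtain ⟨rfl, rfl, rfl⟩ := append_inj_three h1 (hA.trans hA1.symm)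
    (hm.length.1.trans hm1.length.1.symm)
  rw [hm.unique hm1]

theorem Raise.injective {n j : ℕ} {M M' M'' : List (ℕ → ℕ)} (h : Raise n j M' M)
    (h' : Raise n j M'' M) : M' = M'' := by
  obtain ⟨A, m, m', B, hA, rfl, rfl, hm⟩ := h
  obtain ⟨A1, m1, m1', B1, hA1, rfl, h1, hm1⟩ := h'
  obtain ⟨rfl, rfl, rfl⟩ := append_inj_three h1 (hA.trans hA1.symm)
    (hm.length.2.trans hm1.length.2.symm)
  rw [hm.injective hm1]

theorem Raise.length {n j : ℕ} {M M' : List (ℕ → ℕ)} (h : Raise n j M M') :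
    M'.length = M.length := by
  obtain ⟨A, m, m', B, hA, rfl, rfl, hm⟩ := h
  simp [hm.length.1, hm.length.2]

theorem RaiseSeq.unique {n : ℕ} : ∀ {js : List ℕ} {M M' M'' : List (ℕ → ℕ)},
    RaiseSeq n js M M' → RaiseSeq n js M M'' → M' = M''
  | [], _, _, _, h, h' => h.symm.trans h'
  | _ :: _, _, _, _, ⟨K, h1, h2⟩, ⟨K', h3, h4⟩ => by
    rw [h1.unique h3] at h2
    exact h2.unique h4

theorem RaiseSeq.injective {n : ℕ} : ∀ {js : List ℕ} {M M' M'' : List (ℕ → ℕ)},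
    RaiseSeq n js M' M → RaiseSeq n js M'' M → M' = M''
  | [], _, _, _, h, h' => h.trans h'.symm
  | _ :: _, _, _, _, ⟨K, h1, h2⟩, ⟨K', h3, h4⟩ => by
    rw [h2.injective h4] at h1
    exact h1.injective h3

theorem RaiseSeq.length {n : ℕ} : ∀ {js : List ℕ} {M M' : List (ℕ → ℕ)},
    RaiseSeq n js M M' → M'.length = M.length
  | [], _, _, h => by rw [h]
  | _ :: _, _, _, ⟨K, h1, h2⟩ => by rw [h2.length, h1.length]

theorem Raise.zero {n j : ℕ} {M M' : List (ℕ → ℕ)} (h : Raise n j M M')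
    (h0 : ∀ c ∈ M, ∀ r, n ≤ r → c r = 0) : ∀ c ∈ M', ∀ r, n ≤ r → c r = 0 := by
  obtain ⟨A, m, m', B, hA, rfl, rfl, c, d, c', d', rfl, rfl, h1, h2⟩ := h
  intro x hx r hr
  simp only [List.cons_append, List.nil_append, List.mem_append, List.mem_cons] at hx h0
  rcases hx with hx | rfl | rfl | hx
  · exact h0 x (Or.inl hx) r hr
  · rw [(h2 r hr).1, h0 c (by simp) r hr]
  · rw [(h2 r hr).2, h0 d (by simp) r hr]
  · exact h0 x (by simp [hx]) r hr

theorem RaiseSeq.zero {n : ℕ} : ∀ {js : List ℕ} {M M' : List (ℕ → ℕ)}, RaiseSeq n js M M' →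
    (∀ c ∈ M, ∀ r, n ≤ r → c r = 0) → ∀ c ∈ M', ∀ r, n ≤ r → c r = 0
  | [], _, _, h, h0 => by rwa [← h]
  | _ :: _, _, _, ⟨K, h1, h2⟩, h0 => h2.zero (h1.zero h0)

/-- The sum of the entries of a column. -/
def tot (n : ℕ) (c : ℕ → ℕ) : ℕ := ((List.range n).map c).sum

theorem pair_list_e_sum : ∀ {l l' : List (ℕ × ℕ)}, pair.list.e l = some l' →
    (l'.map Prod.fst).sum = (l.map Prod.fst).sum + 1 ∧
      (l.map Prod.snd).sum = (l'.map Prod.snd).sum + 1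
  | [], _, h => by simp at h
  | x :: l, l', h => by
    rw [list_e_cons] at h
    split_ifs at h
    · obtain ⟨y, hy, rfl⟩ := Option.map_eq_some_iff.1 h
      simp only [pair] at hy
      split_ifs at hy
      cases hy
      simp
      omega
    · obtain ⟨y, hy, rfl⟩ := Option.map_eq_some_iff.1 h
      have := pair_list_e_sum hy
      simp
      omega

/-- A weighted sum which decreases under raising. -/
def weightedSum : List ℕ → ℕ
  | [] => 0
  | _ :: l => weightedSum l + l.sum

theorem weightedSum_lt (A B : List ℕ) (x y : ℕ) :
    weightedSum (A ++ (x + 1) :: y :: B) < weightedSum (A ++ x :: (y + 1) :: B) := by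
  induction A with
  | nil => simp [weightedSum]
  | cons a A ih =>
    simp only [List.cons_append, weightedSum, List.sum_append, List.sum_cons]
    omega

theorem Raise.tot {n j : ℕ} {M M' : List (ℕ → ℕ)} (h : Raise n j M M') :
    ∃ A B x y, M.map (tot n) = A ++ x :: (y + 1) :: B ∧
      M'.map (CactusCrystal.tot n) = A ++ (x + 1) :: y :: B := by
  obtain ⟨A, m, m', B, hA, rfl, rfl, c, d, c', d', rfl, rfl, h1, h2⟩ := h
  have h3 := pair_list_e_sum h1
  simp only [rows, List.map_map, Function.comp_def] at h3
  refine ⟨A.map (CactusCrystal.tot n), B.map (CactusCrystal.tot n), CactusCrystal.tot n c,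
    CactusCrystal.tot n d', ?_, ?_⟩
  · have : CactusCrystal.tot n d = CactusCrystal.tot n d' + 1 := h3.2
    simp [this]
  · have : CactusCrystal.tot n c' = CactusCrystal.tot n c + 1 := h3.1
    simp [this]

theorem exists_highest_columns (n : ℕ) (M : List (ℕ → ℕ)) :
    ∃ js M', RaiseSeq n js M M' ∧ ∀ j K, ¬ Raise n j M' K := by
  induction h : weightedSum (M.map (tot n)) using Nat.strong_induction_on generalizing M with
  | _ k ih =>
    by_cases hM : ∃ j K, Raise n j M K
    · obtain ⟨j, K, hK⟩ := hM
      have hlt : weightedSum (K.map (tot n)) < k := by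
        obtain ⟨A, B, x, y, h1, h2⟩ := hK.tot
        rw [← h, h1, h2]
        exact weightedSum_lt _ _ _ _
      obtain ⟨js, M', h1, h2⟩ := ih _ hlt K rfl
      exact ⟨j :: js, M', ⟨K, hK, h1⟩, h2⟩
    · push Not at hM
      exact ⟨[], M, rfl, hM⟩

theorem col_f_tot {n i : ℕ} (hi : i + 1 < n) {c d : ℕ → ℕ} (h : (col i).f c = some d) :
    tot n d = tot n c := by
  have h0 := (col i).φ_pos h
  simp only [col] at h h0
  rw [if_pos h0] at h
  cases h
  unfold tot
  rw [range_split_two hi]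
  simp only [List.map_append, List.sum_append, List.map_cons, List.map_nil, List.sum_cons,
    List.sum_nil]
  have h1 : (List.range i).map (fun r => if r = i then c r - 1 else if r = i + 1 then c r + 1
      else c r) = (List.range i).map c := by
    apply List.map_congr_left
    intro r hr
    have := List.mem_range.1 hr
    simp [show r ≠ i by omega, show r ≠ i + 1 by omega]
  have h2 : (List.range' (i + 2) (n - i - 2)).map (fun r => if r = i then c r - 1
      else if r = i + 1 then c r + 1 else c r) = (List.range' (i + 2) (n - i - 2)).map c := by
    apply List.map_congr_left
    intro r hr
    have := List.mem_range'_1.1 hr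
    simp [show r ≠ i by omega, show r ≠ i + 1 by omega]
  rw [h1, h2]
  simp
  omega

theorem col_list_f_tot {n i : ℕ} (hi : i + 1 < n) : ∀ {M M' : List (ℕ → ℕ)},
    (col i).list.f M = some M' → M'.map (tot n) = M.map (tot n)
  | [], _, h => by simp at h
  | c :: M, M', h => by
    rw [list_f_cons] at h
    split_ifs at h
    · obtain ⟨y, hy, rfl⟩ := Option.map_eq_some_iff.1 h
      simp [col_f_tot hi hy]
    · obtain ⟨y, hy, rfl⟩ := Option.map_eq_some_iff.1 h
      simp [col_list_f_tot hi hy]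

/-! ### Doubly extremal matrices -/

theorem sum_map_eq_zero {X : Type} {l : List X} {g : X → ℕ} (h : ∀ x ∈ l, g x = 0) :
    (l.map g).sum = 0 := by
  apply List.sum_eq_zero
  intro y hy
  obtain ⟨x, hx, rfl⟩ := List.mem_map.1 hy
  exact h x hx

/-- By the lattice condition the entry in row `r` is at most the sum of the entries of row `r + 1`
in the earlier columns. Those lie above the antidiagonal as well, and vanish by induction on the
number of preceding columns. -/
theorem zero_of_lowest {n : ℕ} {M : List (ℕ → ℕ)}
    (hM : ∀ i, i + 1 < n → (col i).list.φ M = 0) (A : List (ℕ → ℕ)) (c : ℕ → ℕ)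
    (B : List (ℕ → ℕ)) (h : M = A ++ c :: B) (r : ℕ) (hr : r + A.length + 1 < n) : c r = 0 := by
  induction hk : A.length using Nat.strong_induction_on generalizing A c B r with
  | _ k ih =>
    have h1 : (col r).list.φ (A ++ [c]) = 0 := by
      apply list_φ_prefix (B := B)
      rw [List.append_assoc, List.singleton_append, ← h]
      exact hM r (by omega)
    have h2 := list_φ_eq_zero _ h1
    have h3 : (A.map (col r).ε).sum = 0 := by
      apply sum_map_eq_zero
      intro x hx
      obtain ⟨A1, A2, rfl⟩ := List.append_of_mem hx
      simp only [List.length_append, List.length_cons] at hk hr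
      exact ih A1.length (by omega) A1 x (A2 ++ c :: B) (by simp [h]) (r + 1) (by omega) rfl
    rw [h3] at h2
    simp only [List.map_append, List.sum_append, List.map_cons, List.map_nil,
      List.sum_singleton] at h2
    change _ + c r ≤ 0 at h2
    omega

theorem ε_rows_eq_zero {n : ℕ} {A B : List (ℕ → ℕ)} {c d : ℕ → ℕ}
    (hM : ∀ j K, ¬ Raise n j (A ++ c :: d :: B) K) : pair.list.ε (rows n c d) = 0 := by
  by_contra h
  obtain ⟨y, hy⟩ := pair.list.exists_e h
  obtain ⟨c', d', rfl, h1⟩ := rows_surjective n y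
    (by rw [pair.list_e_length hy, length_rows]) c d
  exact hM A.length _ ⟨A, [c, d], [c', d'], B, rfl, rfl, rfl, c, d, c', d', rfl, rfl, hy, h1⟩

/-- The transposed argument: in two adjacent columns, the entries of the second one from row `r` on
are bounded by the entries of the first one strictly below row `r`, and these vanish by induction on
the column. -/
theorem zero_of_highest_columns {n : ℕ} {M : List (ℕ → ℕ)} (hM : ∀ j K, ¬ Raise n j M K)
    (A : List (ℕ → ℕ)) (c : ℕ → ℕ) (B : List (ℕ → ℕ)) (h : M = A ++ c :: B) (r : ℕ)
    (hn : r < n) (hr : n ≤ r + A.length) : c r = 0 := by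
  induction A using List.reverseRecOn generalizing c B r with
  | nil =>
    simp at hr
    omega
  | append_singleton A c0 ih =>
    have h' : M = A ++ c0 :: c :: B := by simp [h]
    rw [h'] at hM
    have h1 := ε_rows_eq_zero hM
    rw [rows, range_split hn, List.map_append, List.map_cons] at h1
    have h2 := list_ε_eq_zero _ (pair.list_ε_suffix h1)
    have h3 : ((List.map (fun r => (c0 r, c r)) (List.range' (r + 1) (n - r - 1))).map
        pair.φ).sum = 0 := by
      apply sum_map_eq_zero
      intro x hx
      obtain ⟨r', hr', rfl⟩ := List.mem_map.1 hx
      have := List.mem_range'_1.1 hr'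
      simp at hr
      exact ih c0 (c :: B) h' r' (by omega) (by omega)
    rw [h3] at h2
    simp only [List.map_cons, List.sum_cons] at h2
    change c r + _ ≤ 0 at h2
    omega

/-- Lowest weight for the rows, highest weight for the columns, and no entries outside. -/
structure Extremal (n : ℕ) (M : List (ℕ → ℕ)) : Prop where
  lowest : ∀ i, i + 1 < n → (col i).list.φ M = 0
  highest : ∀ j K, ¬ Raise n j M K
  zero : ∀ c ∈ M, ∀ r, n ≤ r → c r = 0

/-- One extremality condition kills the entries above the antidiagonal, the other one those below
it. -/
theorem Extremal.apply_eq_zero {n : ℕ} {M : List (ℕ → ℕ)} (hM : Extremal n M)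
    (A : List (ℕ → ℕ)) (c : ℕ → ℕ) (B : List (ℕ → ℕ)) (h : M = A ++ c :: B) (r : ℕ)
    (hr : r + A.length + 1 ≠ n) : c r = 0 := by
  rcases lt_or_ge r n with h1 | h1
  · rcases lt_or_gt_of_ne hr with h2 | h2
    · exact zero_of_lowest hM.lowest A c B h r h2
    · exact zero_of_highest_columns hM.highest A c B h r h1 (by omega)
  · exact hM.zero c (by simp [h]) r h1

theorem Extremal.tot_eq {n : ℕ} {M : List (ℕ → ℕ)} (hM : Extremal n M)
    (A : List (ℕ → ℕ)) (c : ℕ → ℕ) (B : List (ℕ → ℕ)) (h : M = A ++ c :: B) (r : ℕ)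
    (hr : r + A.length + 1 = n) : tot n c = c r := by
  unfold tot
  rw [range_split (show r < n by omega), List.map_append, List.sum_append, List.map_cons,
    List.sum_cons, sum_map_eq_zero, sum_map_eq_zero]
  · omega
  · intro r' hr'
    have := List.mem_range'_1.1 hr'
    exact hM.apply_eq_zero A c B h r' (by omega)
  · intro r' hr'
    have := List.mem_range.1 hr'
    exact hM.apply_eq_zero A c B h r' (by omega)

theorem split_at {X : Type} (M : List X) (k : ℕ) (h : k < M.length) :
    M = M.take k ++ M[k] :: M.drop (k + 1) := by
  rw [← List.drop_eq_getElem_cons h, List.take_append_drop]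

/-- Each column of an antidiagonal matrix has at most one nonzero entry, which is then its sum. The
same holds for the rows in `Extremal.eq_of_content`. -/
theorem Extremal.eq_of_tot {n : ℕ} {M M' : List (ℕ → ℕ)} (hM : Extremal n M)
    (hM' : Extremal n M') (h : M.map (tot n) = M'.map (tot n)) : M = M' := by
  have hl : M.length = M'.length := by simpa using congrArg List.length h
  apply List.ext_getElem hl
  intro k h1 h2
  funext r
  by_cases hr : r + k + 1 = n
  · rw [← hM.tot_eq _ _ _ (split_at M k h1) r (by simp; omega),
      ← hM'.tot_eq _ _ _ (split_at M' k h2) r (by simp; omega)]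
    have := congrArg (fun l => l[k]?) h
    simpa [h1, h2] using this
  · rw [hM.apply_eq_zero _ _ _ (split_at M k h1) r (by simp; omega),
      hM'.apply_eq_zero _ _ _ (split_at M' k h2) r (by simp; omega)]

theorem Extremal.sum_eq {n : ℕ} {M : List (ℕ → ℕ)} (hM : Extremal n M) (k : ℕ)
    (hk : k < M.length) (r : ℕ) (hr : r + k + 1 = n) : (M.map (fun c => c r)).sum = M[k] r := by
  conv_lhs => rw [split_at M k hk]
  rw [List.map_append, List.sum_append, List.map_cons, List.sum_cons, sum_map_eq_zero,
    sum_map_eq_zero]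
  · omega
  · intro x hx
    obtain ⟨A, B, h⟩ := List.append_of_mem hx
    apply hM.apply_eq_zero (M.take k ++ M[k] :: A) x B
    · rw [List.append_assoc, List.cons_append, ← h]
      exact split_at M k hk
    · simp
      omega
  · intro x hx
    obtain ⟨A, B, h⟩ := List.append_of_mem hx
    apply hM.apply_eq_zero A x (B ++ M[k] :: M.drop (k + 1))
    · rw [← List.cons_append, ← List.append_assoc, ← h]
      exact split_at M k hk
    · have := congrArg List.length h
      simp at this
      omega

theorem Extremal.eq_of_content {n : ℕ} {M M' : List (ℕ → ℕ)} (hM : Extremal n M)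
    (hM' : Extremal n M') (hl : M.length = M'.length)
    (h : ∀ r < n, (M.map (fun c => c r)).sum = (M'.map (fun c => c r)).sum) : M = M' := by
  apply List.ext_getElem hl
  intro k h1 h2
  funext r
  by_cases hr : r + k + 1 = n
  · rw [← hM.sum_eq k h1 r hr, ← hM'.sum_eq k h2 r hr]
    exact h r (by omega)
  · rw [hM.apply_eq_zero _ _ _ (split_at M k h1) r (by simp; omega),
      hM'.apply_eq_zero _ _ _ (split_at M' k h2) r (by simp; omega)]

end CactusCrystal

namespace CactusCrystal

open StringData

/-! ### Components of words -/

/-- The string structure with index `i` on words. -/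
abbrev wordData (i : ℕ) : StringData (List ℕ) := (letter i).list

/-- All letters of the word are smaller than `n`. -/
def IsWord (n : ℕ) (l : List ℕ) : Prop := ∀ x ∈ l, x < n

/-- The word is of lowest weight. -/
def Lowest (n : ℕ) (l : List ℕ) : Prop := ∀ i, i + 1 < n → (wordData i).φ l = 0

/-- The word is of highest weight. -/
def Highest (n : ℕ) (l : List ℕ) : Prop := ∀ i, i + 1 < n → (wordData i).ε l = 0

/-- The two words lie in the same connected component. -/
def Conn (n : ℕ) : List ℕ → List ℕ → Prop :=
  Relation.EqvGen fun l l' => ∃ i, i + 1 < n ∧ (wordData i).f l = some l'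

theorem Conn.refl {n : ℕ} (l : List ℕ) : Conn n l l := Relation.EqvGen.refl l
theorem Conn.symm {n : ℕ} {l l' : List ℕ} (h : Conn n l l') : Conn n l' l :=
  Relation.EqvGen.symm _ _ h
theorem Conn.trans {n : ℕ} {l l' l'' : List ℕ} (h : Conn n l l') (h' : Conn n l' l'') :
    Conn n l l'' := Relation.EqvGen.trans _ _ _ h h'
theorem Conn.of_f {n i : ℕ} (hi : i + 1 < n) {l l' : List ℕ} (h : (wordData i).f l = some l') :
    Conn n l l' := Relation.EqvGen.rel _ _ ⟨i, hi, h⟩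

theorem Conn.of_e {n i : ℕ} (hi : i + 1 < n) {l l' : List ℕ} (h : (wordData i).e l = some l') :
    Conn n l l' := (Conn.of_f hi (((wordData i).f_iff _ _).2 h)).symm

/-- An effective description of lowering: one letter changes. -/
theorem word_f_split {i : ℕ} : ∀ {l l' : List ℕ}, (wordData i).f l = some l' →
    ∃ A B, l = A ++ i :: B ∧ l' = A ++ (i + 1) :: B
  | [], _, h => by simp at h
  | x :: l, l', h => by
    rw [list_f_cons] at h
    split_ifs at h
    · obtain ⟨y, hy, rfl⟩ := Option.map_eq_some_iff.1 h
      simp only [letter] at hy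
      split_ifs at hy with hx
      cases hy
      subst hx
      exact ⟨[], l, rfl, rfl⟩
    · obtain ⟨y, hy, rfl⟩ := Option.map_eq_some_iff.1 h
      obtain ⟨A, B, rfl, rfl⟩ := word_f_split hy
      exact ⟨x :: A, B, rfl, rfl⟩

theorem isWord_iff_of_f {n i : ℕ} (hi : i + 1 < n) {l l' : List ℕ}
    (h : (wordData i).f l = some l') : IsWord n l ↔ IsWord n l' := by
  obtain ⟨A, B, rfl, rfl⟩ := word_f_split h
  unfold IsWord
  constructor <;>
  · intro h x hx
    simp only [List.mem_append, List.mem_cons] at hx h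
    rcases hx with hx | rfl | hx
    · exact h x (Or.inl hx)
    · omega
    · exact h x (Or.inr (Or.inr hx))

theorem Conn.isWord_iff {n : ℕ} {l l' : List ℕ} (h : Conn n l l') : IsWord n l ↔ IsWord n l' := by
  induction h with
  | rel l l' h =>
    obtain ⟨i, hi, h⟩ := h
    exact isWord_iff_of_f hi h
  | refl => exact Iff.rfl
  | symm _ _ _ ih => exact ih.symm
  | trans _ _ _ _ _ ih ih' => exact ih.trans ih'

theorem Conn.length {n : ℕ} {l l' : List ℕ} (h : Conn n l l') : l.length = l'.length := by
  induction h with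
  | rel l l' h =>
    obtain ⟨i, hi, h⟩ := h
    exact ((letter i).list_f_length h).symm
  | refl => rfl
  | symm _ _ _ ih => exact ih.symm
  | trans _ _ _ _ _ ih ih' => exact ih.trans ih'

/-- The column with one entry, in row `x`. -/
def single (x : ℕ) : ℕ → ℕ := fun r => if r = x then 1 else 0

theorem single_injective : Function.Injective single := by
  intro x y h
  have := congrFun h x
  simp only [single, if_true] at this
  split_ifs at this with h1
  exact h1

theorem col_single_φ (i x : ℕ) : (col i).φ (single x) = (letter i).φ x := by
  simp [col, single, letter, eq_comm]

theorem col_single_ε (i x : ℕ) : (col i).ε (single x) = (letter i).ε x := by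
  simp [col, single, letter, eq_comm]

theorem col_single_f (i x : ℕ) : (col i).f (single x) = ((letter i).f x).map single := by
  simp only [col, letter, single]
  by_cases h : x = i
  · subst h
    simp only [if_true, Nat.lt_one_iff, Option.map_some]
    congr 1
    funext r
    by_cases h1 : r = x
    · subst h1
      simp [single]
    · by_cases h2 : r = x + 1 <;> simp [single, h2, h1]
  · simp [h, Ne.symm h]

theorem col_single_e (i x : ℕ) : (col i).e (single x) = ((letter i).e x).map single := by
  simp only [col, letter, single]
  by_cases h : x = i + 1
  · subst h
    simp only [if_true, Nat.lt_one_iff, Option.map_some]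
    congr 1
    funext r
    by_cases h1 : r = i
    · subst h1
      simp [single]
    · by_cases h2 : r = i + 1 <;> simp [single, h2, h1]
  · simp [h, Ne.symm h]

/-- The matrix of a word. -/
def matrix (l : List ℕ) : List (ℕ → ℕ) := l.map single

theorem matrix_injective : Function.Injective matrix :=
  List.map_injective_iff.2 single_injective

theorem col_matrix_φ (i : ℕ) : ∀ l, (col i).list.φ (matrix l) = (wordData i).φ l
  | [] => rfl
  | x :: l => by
    have ih := col_matrix_φ i l
    unfold matrix at ih ⊢
    rw [List.map_cons, list_φ_cons, list_φ_cons, ih, col_single_φ, col_single_ε]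

theorem col_matrix_ε (i : ℕ) : ∀ l, (col i).list.ε (matrix l) = (wordData i).ε l
  | [] => rfl
  | x :: l => by
    have ih := col_matrix_ε i l
    have ih' := col_matrix_φ i l
    unfold matrix at ih ih' ⊢
    rw [List.map_cons, list_ε_cons, list_ε_cons, ih, ih', col_single_ε]

theorem col_matrix_f (i : ℕ) : ∀ l, (col i).list.f (matrix l) = ((wordData i).f l).map matrix
  | [] => rfl
  | x :: l => by
    have ih := col_matrix_f i l
    have ih' := col_matrix_φ i l
    unfold matrix at ih ih' ⊢
    rw [List.map_cons, list_f_cons, list_f_cons, ih, ih', col_single_f, col_single_ε]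
    split_ifs <;> simp [Function.comp_def]

theorem col_matrix_e (i : ℕ) : ∀ l, (col i).list.e (matrix l) = ((wordData i).e l).map matrix
  | [] => rfl
  | x :: l => by
    have ih := col_matrix_e i l
    have ih' := col_matrix_φ i l
    unfold matrix at ih ih' ⊢
    rw [List.map_cons, list_e_cons, list_e_cons, ih, ih', col_single_e, col_single_ε]
    split_ifs <;> simp [Function.comp_def]

theorem bisim_matrix (i : ℕ) : Bisim (wordData i) (col i).list (fun l M => M = matrix l) where
  φ := by rintro l _ rfl; exact (col_matrix_φ i l).symm
  ε := by rintro l _ rfl; exact (col_matrix_ε i l).symm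
  f := by rintro l _ l' rfl h; exact ⟨_, by rw [col_matrix_f, h]; rfl, rfl⟩
  e := by rintro l _ l' rfl h; exact ⟨_, by rw [col_matrix_e, h]; rfl, rfl⟩

/-- The matrix `M` is obtained from the word `l` by the raisings `js`. -/
def WordRaise (n : ℕ) (js : List ℕ) (l : List ℕ) (M : List (ℕ → ℕ)) : Prop :=
  RaiseSeq n js (matrix l) M

theorem bisim_wordRaise {n i : ℕ} (hi : i + 1 < n) (js : List ℕ) :
    Bisim (wordData i) (col i).list (WordRaise n js) := by
  have h : WordRaise n js = fun l M => ∃ K, K = matrix l ∧ RaiseSeq n js K M := by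
    funext l M
    simp [WordRaise]
  rw [h]
  exact (bisim_matrix i).comp (bisim_raiseSeq hi js)

theorem Raise.transfer {n i j : ℕ} (hi : i + 1 < n) {M M' : List (ℕ → ℕ)}
    (h : (col i).list.f M = some M') : (∃ K, Raise n j M K) ↔ ∃ K, Raise n j M' K := by
  constructor
  · rintro ⟨K, hK⟩
    obtain ⟨K', _, h1⟩ := ((bisim_colStep hi).context j).f _ _ _ hK h
    exact ⟨K', h1⟩
  · rintro ⟨K, hK⟩
    obtain ⟨K', _, h1⟩ := ((bisim_colStep hi).context j).e _ _ _ hK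
      (((col i).list.f_iff _ _).1 h)
    exact ⟨K', h1⟩

/-- Raisings of columns commute with the crystal operators, so the same sequence `js` applies
throughout a component. The operators preserve column sums and also the possibility of raising
further. -/
theorem Conn.wordRaise {n : ℕ} {js : List ℕ} {l l' : List ℕ} (h : Conn n l l') :
    (∀ M, WordRaise n js l M → ∃ M', WordRaise n js l' M' ∧ M'.map (tot n) = M.map (tot n) ∧
      ((∀ j K, ¬ Raise n j M K) ↔ ∀ j K, ¬ Raise n j M' K)) ∧
    (∀ M, WordRaise n js l' M → ∃ M', WordRaise n js l M' ∧ M'.map (tot n) = M.map (tot n) ∧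
      ((∀ j K, ¬ Raise n j M K) ↔ ∀ j K, ¬ Raise n j M' K)) := by
  induction h with
  | rel l l' h =>
    obtain ⟨i, hi, h⟩ := h
    constructor
    · intro M hM
      obtain ⟨M', h1, h2⟩ := (bisim_wordRaise hi js).f _ _ _ hM h
      refine ⟨M', h2, col_list_f_tot hi h1, forall_congr' fun j => ?_⟩
      have := Raise.transfer (j := j) hi h1
      simpa using not_congr this
    · intro M hM
      obtain ⟨M', h1, h2⟩ := (bisim_wordRaise hi js).e _ _ _ hM (((wordData i).f_iff _ _).1 h)
      have h1' := ((col i).list.f_iff _ _).2 h1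
      refine ⟨M', h2, (col_list_f_tot hi h1').symm, forall_congr' fun j => ?_⟩
      have := Raise.transfer (j := j) hi h1'
      simpa using not_congr this.symm
  | refl => exact ⟨fun M hM => ⟨M, hM, rfl, Iff.rfl⟩, fun M hM => ⟨M, hM, rfl, Iff.rfl⟩⟩
  | symm _ _ _ ih => exact ih.symm
  | trans _ _ _ _ _ ih ih' =>
    constructor
    · intro M hM
      obtain ⟨M', h1, h2, h3⟩ := ih.1 M hM
      obtain ⟨M'', h4, h5, h6⟩ := ih'.1 M' h1
      exact ⟨M'', h4, h5.trans h2, h3.trans h6⟩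
    · intro M hM
      obtain ⟨M', h1, h2, h3⟩ := ih'.2 M hM
      obtain ⟨M'', h4, h5, h6⟩ := ih.2 M' h1
      exact ⟨M'', h4, h5.trans h2, h3.trans h6⟩

theorem WordRaise.zero {n : ℕ} {js : List ℕ} {l : List ℕ} {M : List (ℕ → ℕ)} (hl : IsWord n l)
    (h : WordRaise n js l M) : ∀ c ∈ M, ∀ r, n ≤ r → c r = 0 := by
  apply RaiseSeq.zero h
  intro c hc r hr
  obtain ⟨x, hx, rfl⟩ := List.mem_map.1 hc
  have := hl x hx
  simp [single, show r ≠ x by omega]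

theorem WordRaise.extremal {n : ℕ} {js : List ℕ} {l : List ℕ} {M : List (ℕ → ℕ)} (hl : IsWord n l)
    (hl' : Lowest n l) (h : WordRaise n js l M) (hM : ∀ j K, ¬ Raise n j M K) : Extremal n M where
  lowest i hi := by rw [← (bisim_wordRaise hi js).φ l M h]; exact hl' i hi
  highest := hM
  zero := h.zero hl

/-- Each component contains at most one word of lowest weight. -/
theorem Conn.eq_of_lowest {n : ℕ} {l l' : List ℕ} (h : Conn n l l') (hw : IsWord n l)
    (hl : Lowest n l) (hl' : Lowest n l') : l = l' := by
  -- The same raisings bring both words to extremal matrices with equal column sums. These coincide,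
  -- and raisings are injective.
  obtain ⟨js, M, hM, hM'⟩ := exists_highest_columns n (matrix l)
  obtain ⟨M', h1, h2, h3⟩ := (h.wordRaise (js := js)).1 M hM
  have e1 := WordRaise.extremal hw hl hM hM'
  have e2 := WordRaise.extremal (h.isWord_iff.1 hw) hl' h1 (h3.1 hM')
  have : M' = M := e2.eq_of_tot e1 h2
  subst this
  exact matrix_injective (RaiseSeq.injective hM h1)

theorem sum_matrix (l : List ℕ) (r : ℕ) : ((matrix l).map (fun c => c r)).sum = l.count r := by
  induction l with
  | nil => rfl
  | cons x l ih =>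
    simp only [matrix, List.map_cons, List.sum_cons] at ih ⊢
    rw [ih, List.count_cons]
    by_cases h : x = r
    · subst h
      simp [single]
      omega
    · simp [single, h, Ne.symm h]

theorem Raise.sum_eq {n j : ℕ} {M M' : List (ℕ → ℕ)} (h : Raise n j M M') (r : ℕ) :
    (M'.map (fun c => c r)).sum = (M.map (fun c => c r)).sum := by
  obtain ⟨A, m, m', B, hA, rfl, rfl, c, d, c', d', rfl, rfl, h1, h2⟩ := h
  have key : c' r + d' r = c r + d r := by
    rcases lt_or_ge r n with hr | hr
    · have aux : ∀ (L L' : List (ℕ × ℕ)), pair.list.e L = some L' →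
          L'.map (fun x => x.1 + x.2) = L.map (fun x => x.1 + x.2) := by
        intro L
        induction L with
        | nil => intro L' h; simp at h
        | cons x L ih =>
          intro L' h
          rw [list_e_cons] at h
          split_ifs at h
          · obtain ⟨y, hy, rfl⟩ := Option.map_eq_some_iff.1 h
            simp only [pair] at hy
            split_ifs at hy
            cases hy
            simp
            omega
          · obtain ⟨y, hy, rfl⟩ := Option.map_eq_some_iff.1 h
            simp [ih y hy]
      have h3 := aux _ _ h1
      simp only [rows, List.map_map, List.map_inj_left, List.mem_range, Function.comp_def] at h3
      exact h3 r hr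
    · rw [(h2 r hr).1, (h2 r hr).2]
  simp
  omega

theorem RaiseSeq.sum_eq {n : ℕ} : ∀ {js : List ℕ} {M M' : List (ℕ → ℕ)}, RaiseSeq n js M M' →
    ∀ r, (M'.map (fun c => c r)).sum = (M.map (fun c => c r)).sum
  | [], _, _, h, r => by rw [h]
  | _ :: _, _, _, ⟨K, h1, h2⟩, r => by rw [h2.sum_eq r, h1.sum_eq r]

/-- Words of lowest weight with the same length and the same content have isomorphic
components. -/
theorem exists_bisim_of_lowest {n : ℕ} {l l' : List ℕ} (hw : IsWord n l) (hw' : IsWord n l')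
    (hl : Lowest n l) (hl' : Lowest n l') (hlen : l.length = l'.length)
    (hc : ∀ r < n, l.count r = l'.count r) :
    ∃ R : List ℕ → List ℕ → Prop, (∀ i, i + 1 < n → Bisim (wordData i) (wordData i) R) ∧
      (∀ x y y', R x y → R x y' → y = y') ∧ (∀ x x' y, R x y → R x' y → x = x') ∧ R l l' := by
  obtain ⟨js, M, hM, hM'⟩ := exists_highest_columns n (matrix l)
  obtain ⟨ks, K, hK, hK'⟩ := exists_highest_columns n (matrix l')
  have e1 := WordRaise.extremal hw hl hM hM'
  have e2 := WordRaise.extremal hw' hl' hK hK'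
  -- Raising preserves row sums, which are the numbers of occurrences of the letters; both extremal
  -- matrices thus have the same row sums. The isomorphism relates the words from which `js` and
  -- `ks` reach a common matrix.
  have : M = K := by
    apply e1.eq_of_content e2
    · rw [hM.length, hK.length]
      simp [matrix, hlen]
    · intro r hr
      rw [hM.sum_eq, hK.sum_eq, sum_matrix, sum_matrix, hc r hr]
  subst this
  refine ⟨fun x y => ∃ M, WordRaise n js x M ∧ WordRaise n ks y M, ?_, ?_, ?_, M, hM, hK⟩
  · intro i hi
    exact (bisim_wordRaise hi js).comp (bisim_wordRaise hi ks).symm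
  · rintro x y y' ⟨M, h1, h2⟩ ⟨M', h3, h4⟩
    have : M = M' := RaiseSeq.unique h1 h3
    subst this
    exact matrix_injective (RaiseSeq.injective h2 h4)
  · rintro x x' y ⟨M, h1, h2⟩ ⟨M', h3, h4⟩
    have : M = M' := RaiseSeq.unique h2 h4
    subst this
    exact matrix_injective (RaiseSeq.injective h1 h3)

end CactusCrystal

namespace CactusCrystal

open StringData

/-! ### Lowest and highest words of a component -/

theorem word_f_count {i : ℕ} {l l' : List ℕ} (h : (wordData i).f l = some l') :
    l'.count i + 1 = l.count i ∧ l'.count (i + 1) = l.count (i + 1) + 1 ∧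
      ∀ r, r ≠ i → r ≠ i + 1 → l'.count r = l.count r := by
  obtain ⟨A, B, rfl, rfl⟩ := word_f_split h
  refine ⟨?_, ?_, ?_⟩
  · simp
    omega
  · simp
    omega
  · intro r h1 h2
    simp [Ne.symm h1, Ne.symm h2]

theorem word_f_sum {i : ℕ} {l l' : List ℕ} (h : (wordData i).f l = some l') :
    l'.sum = l.sum + 1 := by
  obtain ⟨A, B, rfl, rfl⟩ := word_f_split h
  simp
  omega

/-- The number of letters smaller than `k`. -/
def below (k : ℕ) (l : List ℕ) : ℕ := l.countP (· < k)

theorem below_of_f {i : ℕ} {l l' : List ℕ} (h : (wordData i).f l = some l') (k : ℕ) :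
    below k l' ≤ below k l := by
  obtain ⟨A, B, rfl, rfl⟩ := word_f_split h
  simp only [below, List.countP_append, List.countP_cons]
  split_ifs with h1 h2
  all_goals simp at *
  all_goals omega

theorem IsWord.sum_le {n : ℕ} {l : List ℕ} (h : IsWord n l) : l.sum ≤ n * l.length := by
  induction l with
  | nil => simp
  | cons x l ih =>
    have h1 := h x (by simp)
    have h2 := ih (fun y hy => h y (by simp [hy]))
    simp only [List.sum_cons, List.length_cons, Nat.mul_succ]
    omega

/-- Lowering steps. -/
def Lowers (n : ℕ) : List ℕ → List ℕ → Prop :=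
  Relation.ReflTransGen fun l l' => ∃ i, i + 1 < n ∧ (wordData i).f l = some l'

theorem Lowers.conn {n : ℕ} {l l' : List ℕ} (h : Lowers n l l') : Conn n l l' := by
  induction h with
  | refl => exact Conn.refl l
  | tail _ h ih =>
    obtain ⟨i, hi, h⟩ := h
    exact ih.trans (Conn.of_f hi h)

theorem Lowers.below {n : ℕ} {l l' : List ℕ} (h : Lowers n l l') (k : ℕ) :
    below k l' ≤ below k l := by
  induction h with
  | refl => exact le_rfl
  | tail _ h ih =>
    obtain ⟨i, hi, h⟩ := h
    exact (below_of_f h k).trans ih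

theorem exists_lowers {n : ℕ} {l : List ℕ} (hl : IsWord n l) :
    ∃ l', Lowers n l l' ∧ Lowest n l' := by
  induction hk : n * l.length - l.sum using Nat.strong_induction_on generalizing l with
  | _ k ih =>
    by_cases h : Lowest n l
    · exact ⟨l, Relation.ReflTransGen.refl, h⟩
    · simp only [Lowest, not_forall] at h
      obtain ⟨i, hi, h⟩ := h
      obtain ⟨l1, h1⟩ := (wordData i).exists_f h
      have hw := (isWord_iff_of_f hi h1).1 hl
      have h2 := hw.sum_le
      have h3 := word_f_sum h1
      have h4 : l1.length = l.length := (letter i).list_f_length h1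
      rw [h4] at h2
      obtain ⟨l', h5, h6⟩ := ih (n * l1.length - l1.sum) (by rw [h4]; omega) hw rfl
      exact ⟨l', Relation.ReflTransGen.head ⟨i, hi, h1⟩ h5, h6⟩

theorem exists_raises {n : ℕ} (l : List ℕ) : ∃ l', Lowers n l' l ∧ Highest n l' := by
  induction hk : l.sum using Nat.strong_induction_on generalizing l with
  | _ k ih =>
    by_cases h : Highest n l
    · exact ⟨l, Relation.ReflTransGen.refl, h⟩
    · simp only [Highest, not_forall] at h
      obtain ⟨i, hi, h⟩ := h
      obtain ⟨l1, h1⟩ := (wordData i).exists_e h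
      have h1' := ((wordData i).f_iff _ _).2 h1
      have h3 := word_f_sum h1'
      obtain ⟨l', h5, h6⟩ := ih l1.sum (by omega) l1 rfl
      exact ⟨l', Relation.ReflTransGen.tail h5 ⟨i, hi, h1'⟩, h6⟩

open Classical in
/-- The word of lowest weight in the component of `l`. -/
noncomputable def low (n : ℕ) (l : List ℕ) : List ℕ :=
  if h : ∃ l', Lowers n l l' ∧ Lowest n l' then h.choose else l

open Classical in
/-- The word of highest weight in the component of `l`. -/
noncomputable def high (n : ℕ) (l : List ℕ) : List ℕ :=
  if h : ∃ l', Lowers n l' l ∧ Highest n l' then h.choose else l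

theorem low_spec {n : ℕ} {l : List ℕ} (hl : IsWord n l) :
    Lowers n l (low n l) ∧ Lowest n (low n l) := by
  have h := exists_lowers hl
  rw [low, dif_pos h]
  exact h.choose_spec

theorem high_spec (n : ℕ) (l : List ℕ) : Lowers n (high n l) l ∧ Highest n (high n l) := by
  have h := exists_raises (n := n) l
  rw [high, dif_pos h]
  exact h.choose_spec

theorem IsWord.low {n : ℕ} {l : List ℕ} (hl : IsWord n l) : IsWord n (low n l) :=
  (low_spec hl).1.conn.isWord_iff.1 hl

theorem IsWord.high {n : ℕ} {l : List ℕ} (hl : IsWord n l) : IsWord n (high n l) :=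
  (high_spec n l).1.conn.isWord_iff.2 hl

theorem low_eq {n : ℕ} {l l' : List ℕ} (hl : IsWord n l) (h : Conn n l l') (h' : Lowest n l') :
    low n l = l' :=
  ((low_spec hl).1.conn.symm.trans h).eq_of_lowest hl.low (low_spec hl).2 h'

theorem Conn.low_eq {n : ℕ} {l l' : List ℕ} (hl : IsWord n l) (h : Conn n l l') :
    low n l = low n l' :=
  CactusCrystal.low_eq hl (h.trans (low_spec (h.isWord_iff.1 hl)).1.conn)
    (low_spec (h.isWord_iff.1 hl)).2

theorem Lowest.low_eq {n : ℕ} {l : List ℕ} (hl : IsWord n l) (h : Lowest n l) : low n l = l :=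
  CactusCrystal.low_eq hl (Conn.refl l) h

/-! ### Reverse complement -/

/-- The reverse complement of a word. -/
def revComp (n : ℕ) (l : List ℕ) : List ℕ := (l.map (fun x => n - 1 - x)).reverse

@[simp] theorem length_revComp (n : ℕ) (l : List ℕ) : (revComp n l).length = l.length := by
  simp [revComp]

theorem revComp_append (n : ℕ) (l l' : List ℕ) :
    revComp n (l ++ l') = revComp n l' ++ revComp n l := by
  simp [revComp]

theorem revComp_cons (n x : ℕ) (l : List ℕ) :
    revComp n (x :: l) = revComp n l ++ [n - 1 - x] := by
  simp [revComp]

theorem IsWord.of_cons {n x : ℕ} {l : List ℕ} (h : IsWord n (x :: l)) : x < n ∧ IsWord n l :=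
  ⟨h x (by simp), fun y hy => h y (by simp [hy])⟩

theorem isWord_append {n : ℕ} {l l' : List ℕ} :
    IsWord n (l ++ l') ↔ IsWord n l ∧ IsWord n l' := by
  simp only [IsWord, List.mem_append, or_imp, forall_and]

theorem isWord_cons {n x : ℕ} {l : List ℕ} : IsWord n (x :: l) ↔ x < n ∧ IsWord n l := by
  simp [IsWord]

theorem IsWord.revComp {n : ℕ} {l : List ℕ} (h : IsWord n l) :
    IsWord n (revComp n l) := by
  intro x hx
  simp only [CactusCrystal.revComp, List.mem_reverse, List.mem_map] at hx
  obtain ⟨y, hy, rfl⟩ := hx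
  have := h y hy
  omega

theorem revComp_revComp {n : ℕ} {l : List ℕ} (h : IsWord n l) :
    revComp n (revComp n l) = l := by
  simp only [revComp, List.map_reverse, List.reverse_reverse, List.map_map]
  conv_rhs => rw [← List.map_id l]
  apply List.map_congr_left
  intro x hx
  have := h x hx
  simp
  omega

/-- Complementing letters exchanges raising and lowering, and reversing the order turns the
signature rule for one into that for the other. The index is reflected: with vertices `0, …, n - 2`
the diagram automorphism is `i ↦ n - 2 - i`. -/
theorem revComp_data {n i : ℕ} (hi : i + 1 < n) : ∀ {l : List ℕ}, IsWord n l →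
    (wordData i).φ (revComp n l) = (wordData (n - 2 - i)).ε l ∧
    (wordData i).ε (revComp n l) = (wordData (n - 2 - i)).φ l ∧
    (wordData i).f (revComp n l) = ((wordData (n - 2 - i)).e l).map (revComp n) ∧
    (wordData i).e (revComp n l) = ((wordData (n - 2 - i)).f l).map (revComp n)
  | [], _ => by simp [revComp]
  | x :: l, h => by
    obtain ⟨hx, hl⟩ := h.of_cons
    obtain ⟨h1, h2, h3, h4⟩ := revComp_data hi hl
    have hφ : (wordData i).φ [n - 1 - x] = (letter (n - 2 - i)).ε x := by
      rw [list_φ_cons]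
      simp only [letter, list_φ_nil]
      split_ifs <;> omega
    have hε : (wordData i).ε [n - 1 - x] = (letter (n - 2 - i)).φ x := by
      rw [list_ε_cons]
      simp only [letter, list_ε_nil, list_φ_nil]
      split_ifs <;> omega
    have hf : (wordData i).f [n - 1 - x] =
        ((letter (n - 2 - i)).e x).map (fun y => [n - 1 - y]) := by
      rw [list_f_cons]
      simp only [letter, list_φ_nil]
      split_ifs <;> first | omega | simp
      omega
    have he : (wordData i).e [n - 1 - x] =
        ((letter (n - 2 - i)).f x).map (fun y => [n - 1 - y]) := by
      rw [list_e_cons]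
      simp only [letter, list_φ_nil, list_e_nil]
      split_ifs <;> first | omega | simp
      omega
    rw [revComp_cons, list_φ_append, list_ε_append, list_f_append, list_e_append, h1, h2, h3, h4,
      hφ, hε, hf, he, list_φ_cons, list_ε_cons, list_f_cons, list_e_cons]
    simp only [wordData]
    refine ⟨trivial, trivial, ?_, ?_⟩
    · split_ifs <;> first
        | (exfalso; omega)
        | simp [Option.map_map, Function.comp_def, revComp_cons]
    · split_ifs <;> first
        | (exfalso; omega)
        | simp [Option.map_map, Function.comp_def, revComp_cons]

theorem Conn.revComp {n : ℕ} {l l' : List ℕ} (h : Conn n l l') (hl : IsWord n l) :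
    Conn n (revComp n l) (revComp n l') := by
  induction h with
  | rel l l' h =>
    obtain ⟨i, hi, h⟩ := h
    have h1 := (revComp_data (i := n - 2 - i) (by omega) hl).2.2.2
    rw [show n - 2 - (n - 2 - i) = i by omega, h] at h1
    exact Conn.of_e (by omega) h1
  | refl => exact Conn.refl _
  | symm x y h' ih => exact (ih (Conn.isWord_iff h' |>.2 hl)).symm
  | trans x y z h1 h2 ih ih' => exact (ih hl).trans (ih' ((Conn.isWord_iff h1).1 hl))

theorem Highest.revComp {n : ℕ} {l : List ℕ} (hl : IsWord n l) (h : Highest n l) :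
    Lowest n (revComp n l) := by
  intro i hi
  rw [(revComp_data hi hl).1]
  exact h _ (by omega)

theorem count_revComp {n : ℕ} {l : List ℕ} (hl : IsWord n l) {r : ℕ} (hr : r < n) :
    (revComp n l).count r = l.count (n - 1 - r) := by
  induction l with
  | nil => rfl
  | cons x l ih =>
    obtain ⟨hx, hl⟩ := hl.of_cons
    rw [revComp_cons, List.count_append, ih hl, List.count_cons, List.count_cons, List.count_nil,
      Nat.zero_add]
    congr 1
    by_cases h : x = n - 1 - r
    · rw [if_pos (by simp; omega), if_pos (by simpa using h)]
    · rw [if_neg (by simp; omega), if_neg (by simpa using h)]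

theorem below_revComp {n : ℕ} {l : List ℕ} (hl : IsWord n l) {k : ℕ} (hk : k ≤ n) :
    below k (revComp n l) + below (n - k) l = l.length := by
  induction l with
  | nil => rfl
  | cons x l ih =>
    obtain ⟨hx, hl⟩ := hl.of_cons
    have := ih hl
    rw [revComp_cons]
    simp only [below, List.countP_append, List.countP_cons, List.countP_nil,
      List.length_cons] at this ⊢
    by_cases h : x < n - k
    · rw [if_neg (by simp; omega), if_pos (by simpa using h)]
      omega
    · rw [if_pos (by simp; omega), if_neg (by simpa using h)]
      omega

/-! ### Symmetry of weights -/

theorem word_φ_sub_ε (i : ℕ) (l : List ℕ) :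
    (wordData i).φ l + l.count (i + 1) = (wordData i).ε l + l.count i := by
  have h := (letter i).list_φ_sub_ε l
  have h1 : ∀ j, (l.map (fun x => if x = j then 1 else 0)).sum = l.count j := by
    intro j
    induction l with
    | nil => rfl
    | cons x l ih =>
      have := (letter i).list_φ_sub_ε l
      rw [List.map_cons, List.sum_cons, ih this, List.count_cons]
      simp
      omega
  have h2 := h1 i
  have h3 := h1 (i + 1)
  change _ + (l.map (fun x => if x = i + 1 then 1 else 0)).sum =
    _ + (l.map (fun x => if x = i then 1 else 0)).sum at h
  rw [h2, h3] at h
  exact h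

theorem exists_f_iterate {n i : ℕ} (hi : i + 1 < n) : ∀ (k : ℕ) (l : List ℕ),
    k ≤ (wordData i).φ l → ∃ l', Conn n l l' ∧ l'.count i + k = l.count i ∧
      l'.count (i + 1) = l.count (i + 1) + k ∧ ∀ r, r ≠ i → r ≠ i + 1 → l'.count r = l.count r
  | 0, l, _ => ⟨l, Conn.refl l, rfl, rfl, fun _ _ _ => rfl⟩
  | k + 1, l, h => by
    obtain ⟨l1, h1⟩ := (wordData i).exists_f (x := l) (by omega)
    have h2 := (wordData i).φ_f _ _ h1
    obtain ⟨c1, c2, c3⟩ := word_f_count h1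
    obtain ⟨l', h3, d1, d2, d3⟩ := exists_f_iterate hi k l1 (by omega)
    exact ⟨l', (Conn.of_f hi h1).trans h3, by omega, by omega,
      fun r hr hr' => (d3 r hr hr').trans (c3 r hr hr')⟩

theorem exists_e_iterate {n i : ℕ} (hi : i + 1 < n) : ∀ (k : ℕ) (l : List ℕ),
    k ≤ (wordData i).ε l → ∃ l', Conn n l l' ∧ l'.count i = l.count i + k ∧
      l'.count (i + 1) + k = l.count (i + 1) ∧ ∀ r, r ≠ i → r ≠ i + 1 → l'.count r = l.count r
  | 0, l, _ => ⟨l, Conn.refl l, rfl, rfl, fun _ _ _ => rfl⟩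
  | k + 1, l, h => by
    obtain ⟨l1, h1⟩ := (wordData i).exists_e (x := l) (by omega)
    have h1' := ((wordData i).f_iff _ _).2 h1
    have h2 := (wordData i).ε_f _ _ h1'
    obtain ⟨c1, c2, c3⟩ := word_f_count h1'
    obtain ⟨l', h3, d1, d2, d3⟩ := exists_e_iterate hi k l1 (by omega)
    exact ⟨l', (Conn.of_e hi h1).trans h3, by omega, by omega,
      fun r hr hr' => (d3 r hr hr').trans (c3 r hr hr').symm⟩

/-- The action of a simple reflection of the Weyl group on weights: walking `|φ - ε|` steps along
the `i`-string exchanges the numbers of letters `i` and `i + 1`. -/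
theorem exists_reflection {n i : ℕ} (hi : i + 1 < n) (l : List ℕ) :
    ∃ l', Conn n l l' ∧ l'.count i = l.count (i + 1) ∧ l'.count (i + 1) = l.count i ∧
      ∀ r, r ≠ i → r ≠ i + 1 → l'.count r = l.count r := by
  have h := word_φ_sub_ε i l
  rcases le_total (l.count (i + 1)) (l.count i) with hc | hc
  · obtain ⟨l', h1, h2, h3, h4⟩ := exists_f_iterate hi (l.count i - l.count (i + 1)) l (by omega)
    exact ⟨l', h1, by omega, by omega, h4⟩
  · obtain ⟨l', h1, h2, h3, h4⟩ := exists_e_iterate hi (l.count (i + 1) - l.count i) l (by omega)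
    exact ⟨l', h1, by omega, by omega, h4⟩

/-- Adjacent transpositions generate the symmetric group, so the set of contents occurring in a
component is invariant under all permutations of the letters. -/
theorem exists_conn_count_perm {n : ℕ} (π : Equiv.Perm (Fin n)) :
    ∀ l : List ℕ, ∃ l', Conn n l l' ∧ ∀ r : Fin n, l'.count (r : ℕ) = l.count (π r : ℕ) := by
  cases n with
  | zero => exact fun l => ⟨l, Conn.refl l, fun r => r.elim0⟩
  | succ n =>
    have hπ : π ∈ Submonoid.closure
        (Set.range fun i : Fin n => Equiv.swap i.castSucc i.succ) := by
      rw [Equiv.Perm.mclosure_swap_castSucc_succ]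
      trivial
    induction hπ using Submonoid.closure_induction with
    | mem π h =>
      obtain ⟨i, rfl⟩ := h
      intro l
      obtain ⟨l', h1, h2, h3, h4⟩ := exists_reflection (n := n + 1) (i := i) (by omega) l
      refine ⟨l', h1, fun r => ?_⟩
      by_cases hr : r = i.castSucc
      · subst hr
        simpa using h2
      · by_cases hr' : r = i.succ
        · subst hr'
          simpa using h3
        · rw [Equiv.swap_apply_of_ne_of_ne hr hr']
          apply h4
          · intro h
            exact hr (Fin.ext h)
          · intro h
            exact hr' (Fin.ext h)
    | one => exact fun l => ⟨l, Conn.refl l, fun r => rfl⟩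
    | mul σ τ _ _ ih ih' =>
      intro l
      obtain ⟨l1, h1, h2⟩ := ih l
      obtain ⟨l2, h3, h4⟩ := ih' l1
      exact ⟨l2, h1.trans h3, fun r => by rw [h4, h2]; rfl⟩

theorem below_succ (k : ℕ) (l : List ℕ) : below (k + 1) l = below k l + l.count k := by
  induction l with
  | nil => rfl
  | cons x l ih =>
    simp only [below, List.countP_cons, List.count_cons] at ih ⊢
    rw [ih]
    by_cases h : x = k
    · subst h
      simp
      omega
    · by_cases h' : x < k
      · simp [h, h', show x < k + 1 by omega]
        omega
      · simp [h, h', show ¬ x < k + 1 by omega]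

theorem below_zero (l : List ℕ) : below 0 l = 0 := by
  simp [below]

theorem below_congr {n : ℕ} {l l' : List ℕ} (h : ∀ r < n, l.count r = l'.count r) :
    ∀ k ≤ n, below k l = below k l'
  | 0, _ => by rw [below_zero, below_zero]
  | k + 1, hk => by rw [below_succ, below_succ, below_congr h k (by omega), h k hk]

theorem exists_conn_count_revComp {n : ℕ} {l : List ℕ} (hl : IsWord n l) :
    ∃ l', Conn n l l' ∧ ∀ k ≤ n, below k l' = below k (revComp n l) := by
  obtain ⟨l', h1, h2⟩ := exists_conn_count_perm Fin.revPerm l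
  refine ⟨l', h1, below_congr fun r hr => ?_⟩
  have h3 := h2 ⟨r, hr⟩
  simp only [Fin.revPerm_apply, Fin.val_rev] at h3
  rw [h3, count_revComp hl hr]
  congr 1
  omega

/-- Every word of a component can be lowered to the unique lowest one, and lowering never increases
the number of small letters. Hence the lowest word is extremal in the dominance order. -/
theorem below_low_le {n : ℕ} {l l' : List ℕ} (hl : IsWord n l) (h : Conn n l l') (k : ℕ) :
    below k (low n l) ≤ below k l' := by
  rw [h.low_eq hl]
  exact (low_spec (h.isWord_iff.1 hl)).1.below k

/-- Uniqueness of the highest word follows from uniqueness of the lowest one by passing to the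
reverse complement. -/
theorem high_eq {n : ℕ} {l l' : List ℕ} (hl : IsWord n l) (h : Conn n l l') (h' : Highest n l') :
    high n l = l' := by
  have h1 := h.isWord_iff.1 hl
  have := ((high_spec n l).1.conn.trans h).revComp hl.high
  have := this.eq_of_lowest hl.high.revComp ((high_spec n l).2.revComp hl.high) (h'.revComp h1)
  rw [← revComp_revComp hl.high, this, revComp_revComp h1]

theorem Conn.high_eq {n : ℕ} {l l' : List ℕ} (hl : IsWord n l) (h : Conn n l l') :
    high n l = high n l' :=
  CactusCrystal.high_eq hl (h.trans (high_spec n l').1.conn.symm) (high_spec n l').2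

theorem below_le_high {n : ℕ} {l l' : List ℕ} (hl : IsWord n l) (h : Conn n l l') (k : ℕ) :
    below k l' ≤ below k (high n l) := by
  rw [h.high_eq hl]
  exact (high_spec n l').1.below k

/-- The highest weight of a component is the reversal of its lowest weight. -/
theorem count_low {n : ℕ} {l : List ℕ} (hl : IsWord n l) (r : ℕ) (hr : r < n) :
    (low n l).count r = (revComp n (high n l)).count r := by
  have c1 := (low_spec hl).1.conn
  have c2 := (high_spec n l).1.conn
  -- The lowest word minimises and the highest word maximises each `below k` on the component. The
  -- reversed contents of both words occur in the component too, and testing the extremality on them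
  -- gives the two inequalities.
  have key : ∀ k ≤ n, below k (low n l) = below k (revComp n (high n l)) := by
    intro k hk
    obtain ⟨a, h1, h2⟩ := exists_conn_count_revComp hl.high
    obtain ⟨b, h3, h4⟩ := exists_conn_count_revComp hl.low
    have h5 := below_low_le hl (c2.symm.trans h1) k
    have h6 := below_le_high hl (c1.trans h3) (n - k)
    rw [h2 k hk] at h5
    rw [h4 (n - k) (by omega)] at h6
    have h7 := below_revComp hl.high hk
    have h8 := below_revComp hl.low (show n - k ≤ n by omega)
    rw [show n - (n - k) = k by omega] at h8
    have h9 := c1.length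
    have h10 := c2.length
    omega
  have h1 := key r hr.le
  have h2 := key (r + 1) hr
  rw [below_succ, below_succ] at h2
  omega

end CactusCrystal

/-! ### The Schützenberger involution, the long element, and types of factors -/

namespace CactusCrystal

open StringData

/-! ### The Schützenberger involution on words -/

/-- `ζ` behaves like the Schützenberger involution on words of length `N`. -/
structure SchLike (n N : ℕ) (ζ : List ℕ → List ℕ) : Prop where
  conn : ∀ l, IsWord n l → l.length = N → Conn n l (ζ l)
  f : ∀ l, IsWord n l → l.length = N → ∀ i, i + 1 < n →
    (wordData i).f (ζ l) = ((wordData (n - 2 - i)).e l).map ζ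
  e : ∀ l, IsWord n l → l.length = N → ∀ i, i + 1 < n →
    (wordData i).e (ζ l) = ((wordData (n - 2 - i)).f l).map ζ

/-- `g` is an automorphism of the crystal of words of length `N`. -/
structure Auto (n N : ℕ) (g : List ℕ → List ℕ) : Prop where
  word : ∀ l, IsWord n l → l.length = N → IsWord n (g l)
  length : ∀ l, IsWord n l → l.length = N → (g l).length = N
  f : ∀ l, IsWord n l → l.length = N → ∀ i, i + 1 < n →
    (wordData i).f (g l) = ((wordData i).f l).map g
  e : ∀ l, IsWord n l → l.length = N → ∀ i, i + 1 < n →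
    (wordData i).e (g l) = ((wordData i).e l).map g

theorem isWord_of_f {n i : ℕ} (hi : i + 1 < n) {l l' : List ℕ} (h : (wordData i).f l = some l')
    (hl : IsWord n l) : IsWord n l' := (isWord_iff_of_f hi h).1 hl

theorem isWord_of_e {n i : ℕ} (hi : i + 1 < n) {l l' : List ℕ} (h : (wordData i).e l = some l')
    (hl : IsWord n l) : IsWord n l' :=
  (isWord_iff_of_f hi (((wordData i).f_iff _ _).2 h)).2 hl

/-- A map which preserves the components and commutes with lowering is the identity. -/
theorem eq_self_of_commutes {n N : ℕ} {ζ : List ℕ → List ℕ}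
    (hc : ∀ l, IsWord n l → l.length = N → Conn n l (ζ l))
    (hf : ∀ l, IsWord n l → l.length = N → ∀ i, i + 1 < n →
      (wordData i).f (ζ l) = ((wordData i).f l).map ζ) (l : List ℕ) (hl : IsWord n l)
    (hN : l.length = N) : ζ l = l := by
  induction hk : n * N - l.sum using Nat.strong_induction_on generalizing l with
  | _ k ih =>
    by_cases h : Lowest n l
    -- Commuting with the lowering operators makes `ζ l` lowest as well, and its component has only
    -- one lowest word. Other words follow from their lowerings, since a lowering operator is
    -- injective where defined.
    · refine ((hc l hl hN).eq_of_lowest hl h fun i hi => ?_).symm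
      rw [← (wordData i).f_eq_none, hf l hl hN i hi,
        ((wordData i).f_eq_none _).2 (h i hi)]
      rfl
    · simp only [Lowest, not_forall] at h
      obtain ⟨i, hi, h⟩ := h
      obtain ⟨l1, h1⟩ := (wordData i).exists_f h
      have hw := isWord_of_f hi h1 hl
      have h2 := hw.sum_le
      have h3 := word_f_sum h1
      have h4 : l1.length = N := ((letter i).list_f_length h1).trans hN
      rw [h4] at h2
      have h5 := ih (n * N - l1.sum) (by omega) l1 hw h4 rfl
      have h6 := hf l hl hN i hi
      rw [h1, Option.map_some, h5, (wordData i).f_iff] at h6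
      rw [(wordData i).f_iff, h6] at h1
      exact Option.some.inj h1

theorem SchLike.length {n N : ℕ} {ζ : List ℕ → List ℕ} (h : SchLike n N ζ) {l : List ℕ}
    (hl : IsWord n l) (hN : l.length = N) : (ζ l).length = N :=
  (h.conn l hl hN).length.symm.trans hN

theorem SchLike.word {n N : ℕ} {ζ : List ℕ → List ℕ} (h : SchLike n N ζ) {l : List ℕ}
    (hl : IsWord n l) (hN : l.length = N) : IsWord n (ζ l) :=
  (h.conn l hl hN).isWord_iff.1 hl

/-- The composite of two such maps commutes with lowering and preserves components, hence is the
identity. This gives involutivity and uniqueness at once. -/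
theorem SchLike.comp_eq {n N : ℕ} {ζ ξ : List ℕ → List ℕ} (h : SchLike n N ζ)
    (h' : SchLike n N ξ) {l : List ℕ} (hl : IsWord n l) (hN : l.length = N) : ζ (ξ l) = l := by
  refine eq_self_of_commutes (ζ := ζ ∘ ξ) (n := n) (N := N) ?_ ?_ l hl hN
  · intro l hl hN
    exact (h'.conn l hl hN).trans (h.conn _ (h'.word hl hN) (h'.length hl hN))
  · intro l hl hN i hi
    simp only [Function.comp_apply]
    rw [h.f _ (h'.word hl hN) (h'.length hl hN) i hi, h'.e l hl hN _ (by omega),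
      show n - 2 - (n - 2 - i) = i by omega, Option.map_map]

theorem SchLike.eq {n N : ℕ} {ζ ξ : List ℕ → List ℕ} (h : SchLike n N ζ)
    (h' : SchLike n N ξ) {l : List ℕ} (hl : IsWord n l) (hN : l.length = N) : ζ l = ξ l := by
  have h1 := h'.comp_eq h' hl hN
  have h2 := h.comp_eq h' (h'.word hl hN) (h'.length hl hN)
  rw [h1] at h2
  exact h2

/-- The conditions on an isomorphism between the components of `a` and `b`. -/
def IsIso (n : ℕ) (a b : List ℕ) (R : List ℕ → List ℕ → Prop) : Prop :=
  (∀ i, i + 1 < n → Bisim (wordData i) (wordData i) R) ∧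
      (∀ x y y', R x y → R x y' → y = y') ∧ (∀ x x' y, R x y → R x' y → x = x') ∧ R a b

open Classical in
/-- An isomorphism between the components of `a` and `b`, as a relation. -/
noncomputable def isoRel (n : ℕ) (a b : List ℕ) : List ℕ → List ℕ → Prop :=
  if h : ∃ R, IsIso n a b R then h.choose else fun _ _ => False

open Classical in
/-- The Schützenberger involution on words. -/
noncomputable def xi (n : ℕ) (l : List ℕ) : List ℕ :=
  revComp n (if h : ∃ y, isoRel n (low n l) (revComp n (high n l)) l y then h.choose else l)

/-- By `count_low` the lowest word of the component and the reverse complement of its highest word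
have the same content, so their components are isomorphic. The reverse complement carries the second
component back to that of `l`, which is why `xi` lands in the component it starts from. -/
theorem isIso_isoRel {n : ℕ} {l : List ℕ} (hl : IsWord n l) :
    IsIso n (low n l) (revComp n (high n l)) (isoRel n (low n l) (revComp n (high n l))) := by
  have h : ∃ R, IsIso n (low n l) (revComp n (high n l)) R := by
    apply exists_bisim_of_lowest hl.low hl.high.revComp (low_spec hl).2
      ((high_spec n l).2.revComp hl.high)
    · rw [length_revComp, ← (low_spec hl).1.conn.length, (high_spec n l).1.conn.length]
    · exact count_low hl
  rw [isoRel, dif_pos h]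
  exact h.choose_spec

theorem word_f_count_eq {i : ℕ} {l l' : List ℕ} (h : (wordData i).f l = some l') (r : ℕ) :
    l'.count r + (if r = i then 1 else 0) = l.count r + (if r = i + 1 then 1 else 0) := by
  obtain ⟨h1, h2, h3⟩ := word_f_count h
  split_ifs with h4 h5 h5
  · omega
  · subst h4
    omega
  · subst h5
    omega
  · rw [h3 r h4 h5]

/-- A path in one component is copied to the other with the same indices, so contents change by the
same amount on both sides. Both directions are carried along because connectedness is generated
symmetrically. -/
theorem bisim_conn {n : ℕ} {R : List ℕ → List ℕ → Prop}
    (hR : ∀ i, i + 1 < n → Bisim (wordData i) (wordData i) R) {a x : List ℕ} (h : Conn n a x) :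
    (∀ b, R a b → ∃ y, R x y ∧ Conn n b y ∧ ∀ r, x.count r + b.count r = y.count r + a.count r) ∧
    (∀ b, R x b → ∃ y, R a y ∧ Conn n b y ∧
      ∀ r, a.count r + b.count r = y.count r + x.count r) := by
  induction h with
  | rel l l' h =>
    obtain ⟨i, hi, h⟩ := h
    constructor
    · intro b hb
      obtain ⟨y, h1, h2⟩ := (hR i hi).f _ _ _ hb h
      refine ⟨y, h2, Conn.of_f hi h1, fun r => ?_⟩
      have h3 := word_f_count_eq h r
      have h4 := word_f_count_eq h1 r
      omega
    · intro b hb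
      obtain ⟨y, h1, h2⟩ := (hR i hi).e _ _ _ hb (((wordData i).f_iff _ _).1 h)
      refine ⟨y, h2, Conn.of_e hi h1, fun r => ?_⟩
      have h3 := word_f_count_eq h r
      have h4 := word_f_count_eq (((wordData i).f_iff _ _).2 h1) r
      omega
  | refl =>
    exact ⟨fun b hb => ⟨b, hb, Conn.refl b, fun r => by omega⟩,
      fun b hb => ⟨b, hb, Conn.refl b, fun r => by omega⟩⟩
  | symm _ _ _ ih => exact ih.symm
  | trans _ _ _ _ _ ih ih' =>
    constructor
    · intro b hb
      obtain ⟨y, h1, h2, h3⟩ := ih.1 b hb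
      obtain ⟨z, h4, h5, h6⟩ := ih'.1 y h1
      exact ⟨z, h4, h2.trans h5, fun r => by have := h3 r; have := h6 r; omega⟩
    · intro b hb
      obtain ⟨y, h1, h2, h3⟩ := ih'.2 b hb
      obtain ⟨z, h4, h5, h6⟩ := ih.2 y h1
      exact ⟨z, h4, h2.trans h5, fun r => by have := h3 r; have := h6 r; omega⟩

theorem xi_spec {n : ℕ} {l : List ℕ} (hl : IsWord n l) : ∃ y,
    isoRel n (low n l) (revComp n (high n l)) l y ∧ xi n l = revComp n y ∧
      Conn n (revComp n (high n l)) y ∧ ∀ r < n, y.count r = l.count r := by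
  have hR := isIso_isoRel hl
  obtain ⟨y, h1, h2, h3⟩ := (bisim_conn hR.1 (low_spec hl).1.conn.symm).1 _ hR.2.2.2
  have h : ∃ y, isoRel n (low n l) (revComp n (high n l)) l y := ⟨y, h1⟩
  have h4 : h.choose = y := hR.2.1 _ _ _ h.choose_spec h1
  refine ⟨y, h1, ?_, h2, fun r hr => ?_⟩
  · rw [xi, dif_pos h, h4]
  · have := h3 r
    have := count_low hl r hr
    omega

theorem xi_conn {n : ℕ} {l : List ℕ} (hl : IsWord n l) : Conn n l (xi n l) := by
  obtain ⟨y, h1, h2, h3, h4⟩ := xi_spec hl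
  rw [h2]
  have := h3.revComp hl.high.revComp
  rw [revComp_revComp hl.high] at this
  exact (high_spec n l).1.conn.symm.trans this

theorem IsWord.xi {n : ℕ} {l : List ℕ} (hl : IsWord n l) : IsWord n (xi n l) :=
  (xi_conn hl).isWord_iff.1 hl

theorem count_xi {n : ℕ} {l : List ℕ} (hl : IsWord n l) {r : ℕ} (hr : r < n) :
    (xi n l).count r = l.count (n - 1 - r) := by
  obtain ⟨y, h1, h2, h3, h4⟩ := xi_spec hl
  rw [h2, count_revComp (h3.isWord_iff.1 hl.high.revComp) hr, h4 _ (by omega)]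

theorem xi_apply_eq {n : ℕ} {l l' y' : List ℕ} (hl : IsWord n l) (hl' : IsWord n l')
    (hc : Conn n l l')
    (h : isoRel n (low n l) (revComp n (high n l)) l' y') : xi n l' = revComp n y' := by
  obtain ⟨z, h1, h2, h3, h4⟩ := xi_spec hl'
  rw [← hc.low_eq hl, ← hc.high_eq hl] at h1
  rw [h2, (isIso_isoRel hl).2.1 _ _ _ h1 h]

theorem xi_schLike (n N : ℕ) : SchLike n N (xi n) where
  conn l hl _ := xi_conn hl
  f l hl _ i hi := by
    obtain ⟨y, h1, h2, h3, h4⟩ := xi_spec hl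
    have hR := (isIso_isoRel hl).1 (n - 2 - i) (by omega)
    have hy := h3.isWord_iff.1 hl.high.revComp
    rw [h2, (revComp_data hi hy).2.2.1]
    cases he : (wordData (n - 2 - i)).e l with
    | none =>
      rw [(wordData _).e_eq_none, hR.ε _ _ h1, ← (wordData _).e_eq_none] at he
      rw [he]
      rfl
    | some l' =>
      obtain ⟨y', h5, h6⟩ := hR.e _ _ _ h1 he
      rw [h5, Option.map_some, Option.map_some]
      congr 1
      exact (xi_apply_eq hl (isWord_of_e (by omega) he hl)
        (Conn.of_e (by omega) he) h6).symm
  e l hl _ i hi := by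
    obtain ⟨y, h1, h2, h3, h4⟩ := xi_spec hl
    have hR := (isIso_isoRel hl).1 (n - 2 - i) (by omega)
    have hy := h3.isWord_iff.1 hl.high.revComp
    rw [h2, (revComp_data hi hy).2.2.2]
    cases he : (wordData (n - 2 - i)).f l with
    | none =>
      rw [(wordData _).f_eq_none, hR.φ _ _ h1, ← (wordData _).f_eq_none] at he
      rw [he]
      rfl
    | some l' =>
      obtain ⟨y', h5, h6⟩ := hR.f _ _ _ h1 he
      rw [h5, Option.map_some, Option.map_some]
      congr 1
      exact (xi_apply_eq hl (isWord_of_f (by omega) he hl)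
        (Conn.of_f (by omega) he) h6).symm

theorem length_xi {n : ℕ} {l : List ℕ} (hl : IsWord n l) : (xi n l).length = l.length :=
  (xi_conn hl).length.symm

theorem xi_xi {n : ℕ} {l : List ℕ} (hl : IsWord n l) : xi n (xi n l) = l :=
  (xi_schLike n l.length).comp_eq (xi_schLike n l.length) hl rfl

/-- The conjugate of `xi` by the reverse complement again satisfies `SchLike`, hence equals `xi`. -/
theorem revComp_xi {n : ℕ} {l : List ℕ} (hl : IsWord n l) :
    revComp n (xi n l) = xi n (revComp n l) := by
  have h : SchLike n l.length (fun l => revComp n (xi n (revComp n l))) := by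
    constructor
    · intro l hl hN
      have := (xi_conn hl.revComp).revComp hl.revComp
      rwa [revComp_revComp hl] at this
    · intro l hl hN i hi
      rw [(revComp_data hi hl.revComp.xi).2.2.1,
        (xi_schLike n l.length).e _ hl.revComp (length_revComp n l) _ (by omega),
        show n - 2 - (n - 2 - i) = i by omega, (revComp_data hi hl).2.2.1, Option.map_map,
        Option.map_map]
      rfl
    · intro l hl hN i hi
      rw [(revComp_data hi hl.revComp.xi).2.2.2,
        (xi_schLike n l.length).f _ hl.revComp (length_revComp n l) _ (by omega),
        show n - 2 - (n - 2 - i) = i by omega, (revComp_data hi hl).2.2.2, Option.map_map,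
        Option.map_map]
      rfl
  have h1 := h.eq (xi_schLike n l.length) hl.revComp (length_revComp n l)
  rwa [revComp_revComp hl] at h1

/-! ### The long element on words -/

/-- The long element of the cactus group on words. -/
noncomputable def long (n : ℕ) (l : List ℕ) : List ℕ := xi n (revComp n l)

theorem IsWord.long {n : ℕ} {l : List ℕ} (hl : IsWord n l) : IsWord n (long n l) :=
  hl.revComp.xi

theorem length_long {n : ℕ} {l : List ℕ} (hl : IsWord n l) : (long n l).length = l.length := by
  rw [long, length_xi hl.revComp, length_revComp]

theorem count_long {n : ℕ} {l : List ℕ} (hl : IsWord n l) {r : ℕ} (hr : r < n) :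
    (long n l).count r = l.count r := by
  rw [long, count_xi hl.revComp hr, count_revComp hl (by omega)]
  congr 1
  omega

theorem long_long {n : ℕ} {l : List ℕ} (hl : IsWord n l) : long n (long n l) = l := by
  unfold long
  rw [revComp_xi hl.revComp, revComp_revComp hl, xi_xi hl]

theorem revComp_long {n : ℕ} {l : List ℕ} (hl : IsWord n l) :
    revComp n (long n l) = long n (revComp n l) := by
  unfold long
  rw [revComp_xi hl.revComp]

/-- Both `xi` and the reverse complement exchange raising and lowering and reflect the index; their
composite respects the operators. It need not preserve components: `long n l` lies in the component
of `revComp n l`. -/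
theorem auto_long (n N : ℕ) : Auto n N (long n) where
  word l hl _ := hl.long
  length l hl hN := by rw [length_long hl, hN]
  f l hl hN i hi := by
    unfold long
    rw [(xi_schLike n N).f _ hl.revComp (by simpa) i hi, (revComp_data (by omega) hl).2.2.2,
      show n - 2 - (n - 2 - i) = i by omega, Option.map_map]
    rfl
  e l hl hN i hi := by
    unfold long
    rw [(xi_schLike n N).e _ hl.revComp (by simpa) i hi, (revComp_data (by omega) hl).2.2.1,
      show n - 2 - (n - 2 - i) = i by omega, Option.map_map]
    rfl

theorem Auto.φ_eq {n N : ℕ} {g : List ℕ → List ℕ} (h : Auto n N g) {l : List ℕ}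
    (hl : IsWord n l) (hN : l.length = N) {i : ℕ} (hi : i + 1 < n) :
    (wordData i).φ (g l) = (wordData i).φ l := by
  induction hk : (wordData i).φ l generalizing l with
  | zero =>
    rw [← (wordData i).f_eq_none] at hk ⊢
    rw [h.f l hl hN i hi, hk]
    rfl
  | succ k ih =>
    obtain ⟨l', h1⟩ := (wordData i).exists_f (x := l) (by omega)
    have h2 := h.f l hl hN i hi
    rw [h1] at h2
    have h3 := (wordData i).φ_f _ _ h1
    have h4 := (wordData i).φ_f _ _ h2
    rw [h4, ih (isWord_of_f hi h1 hl) (((letter i).list_f_length h1).trans hN) (by omega)]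

theorem Auto.ε_eq {n N : ℕ} {g : List ℕ → List ℕ} (h : Auto n N g) {l : List ℕ}
    (hl : IsWord n l) (hN : l.length = N) {i : ℕ} (hi : i + 1 < n) :
    (wordData i).ε (g l) = (wordData i).ε l := by
  induction hk : (wordData i).ε l generalizing l with
  | zero =>
    rw [← (wordData i).e_eq_none] at hk ⊢
    rw [h.e l hl hN i hi, hk]
    rfl
  | succ k ih =>
    obtain ⟨l', h1⟩ := (wordData i).exists_e (x := l) (by omega)
    have h2 := h.e l hl hN i hi
    rw [h1, Option.map_some] at h2
    have h3 := (wordData i).ε_f _ _ (((wordData i).f_iff _ _).2 h1)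
    have h4 := (wordData i).ε_f _ _ (((wordData i).f_iff _ _).2 h2)
    rw [h4, ih (isWord_of_e hi h1 hl) (((letter i).list_e_length h1).trans hN) (by omega)]

theorem Auto.lowest {n N : ℕ} {g : List ℕ → List ℕ} (h : Auto n N g) {l : List ℕ}
    (hl : IsWord n l) (hN : l.length = N) (h' : Lowest n l) : Lowest n (g l) := by
  intro i hi
  rw [h.φ_eq hl hN hi, h' i hi]

theorem Auto.conn {n N : ℕ} {g : List ℕ → List ℕ} (h : Auto n N g) {l l' : List ℕ}
    (hc : Conn n l l') (hl : IsWord n l) (hN : l.length = N) : Conn n (g l) (g l') := by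
  induction hc with
  | rel l l' hc =>
    obtain ⟨i, hi, hc⟩ := hc
    have := h.f l hl hN i hi
    rw [hc] at this
    exact Conn.of_f hi this
  | refl => exact Conn.refl _
  | symm x y h' ih =>
    exact (ih (Conn.isWord_iff h' |>.2 hl) ((Conn.length h').trans hN)).symm
  | trans x y z h1 h2 ih ih' =>
    exact (ih hl hN).trans (ih' ((Conn.isWord_iff h1).1 hl) ((Conn.length h1).symm.trans hN))

theorem Auto.low {n N : ℕ} {g : List ℕ → List ℕ} (h : Auto n N g) {l : List ℕ}
    (hl : IsWord n l) (hN : l.length = N) : low n (g l) = g (low n l) := by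
  have h1 := (low_spec hl).1.conn
  exact low_eq (h.word l hl hN) (h.conn h1 hl hN)
    (h.lowest hl.low (h1.length.symm.trans hN) (low_spec hl).2)

/-! ### Acting on a factor -/

/-- The long element on the factors in the positions `i, …, i + m - 1`. -/
noncomputable def seg (n i m : ℕ) (l : List ℕ) : List ℕ :=
  l.take i ++ (long n ((l.drop i).take m) ++ (l.drop i).drop m)

theorem seg_append {n i m : ℕ} {A U V : List ℕ} (hA : A.length = i) (hU : U.length = m) :
    seg n i m (A ++ (U ++ V)) = A ++ (long n U ++ V) := by
  subst hA hU
  simp [seg]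

theorem exists_split {X : Type} {i m : ℕ} {l : List X} (h : i + m ≤ l.length) :
    ∃ A U V, A.length = i ∧ U.length = m ∧ l = A ++ (U ++ V) := by
  refine ⟨l.take i, (l.drop i).take m, (l.drop i).drop m, ?_, ?_, ?_⟩
  · simp
    omega
  · simp
    omega
  · rw [List.take_append_drop, List.take_append_drop]

theorem isWord_append_three {n : ℕ} {A U V : List ℕ} :
    IsWord n (A ++ (U ++ V)) ↔ IsWord n A ∧ IsWord n U ∧ IsWord n V := by
  rw [isWord_append, isWord_append]

theorem seg_word {n i m : ℕ} {l : List ℕ} (hl : IsWord n l) (h : i + m ≤ l.length) :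
    IsWord n (seg n i m l) ∧ (seg n i m l).length = l.length := by
  obtain ⟨A, U, V, hA, hU, rfl⟩ := exists_split h
  rw [seg_append hA hU]
  rw [isWord_append_three] at hl ⊢
  exact ⟨⟨hl.1, hl.2.1.long, hl.2.2⟩, by simp [length_long hl.2.1]⟩

theorem count_seg {n i m : ℕ} {l : List ℕ} (hl : IsWord n l) (h : i + m ≤ l.length) {r : ℕ}
    (hr : r < n) : (seg n i m l).count r = l.count r := by
  obtain ⟨A, U, V, hA, hU, rfl⟩ := exists_split h
  rw [seg_append hA hU]
  rw [isWord_append_three] at hl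
  simp [count_long hl.2.1 hr]

theorem seg_seg {n i m : ℕ} {l : List ℕ} (hl : IsWord n l) (h : i + m ≤ l.length) :
    seg n i m (seg n i m l) = l := by
  obtain ⟨A, U, V, hA, hU, rfl⟩ := exists_split h
  rw [isWord_append_three] at hl
  rw [seg_append hA hU, seg_append hA (by rw [length_long hl.2.1, hU]), long_long hl.2.1]

theorem auto_seg {n i m N : ℕ} (h : i + m ≤ N) : Auto n N (seg n i m) where
  word l hl hN := (seg_word hl (by omega)).1
  length l hl hN := ((seg_word hl (by omega)).2).trans hN
  f l hl hN j hj := by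
    subst hN
    obtain ⟨A, U, V, hA, hU, rfl⟩ := exists_split h
    rw [isWord_append_three] at hl
    have hL := auto_long n U.length
    rw [seg_append hA hU, list_f_append, list_f_append, list_φ_append, list_f_append,
      list_f_append, list_φ_append]
    have h1 := hL.φ_eq hl.2.1 rfl hj
    have h2 := hL.ε_eq hl.2.1 rfl hj
    have h3 := hL.f U hl.2.1 rfl j hj
    simp only [wordData] at h1 h2 h3
    rw [h1, h2, h3]
    split_ifs with c1 c2
    · cases hf : (letter j).list.f A with
      | none => rfl
      | some A' =>
        simp only [Option.map_some]
        rw [seg_append (((letter j).list_f_length hf).trans hA) hU]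
    · cases hf : (letter j).list.f U with
      | none => rfl
      | some U' =>
        simp only [Option.map_some]
        rw [seg_append hA (((letter j).list_f_length hf).trans hU)]
    · cases hf : (letter j).list.f V with
      | none => rfl
      | some V' =>
        simp only [Option.map_some]
        rw [seg_append hA hU]
  e l hl hN j hj := by
    subst hN
    obtain ⟨A, U, V, hA, hU, rfl⟩ := exists_split h
    rw [isWord_append_three] at hl
    have hL := auto_long n U.length
    rw [seg_append hA hU, list_e_append, list_e_append, list_φ_append, list_e_append,
      list_e_append, list_φ_append]
    have h1 := hL.φ_eq hl.2.1 rfl hj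
    have h2 := hL.ε_eq hl.2.1 rfl hj
    have h3 := hL.e U hl.2.1 rfl j hj
    simp only [wordData] at h1 h2 h3
    rw [h1, h2, h3]
    split_ifs with c1 c2
    · cases hf : (letter j).list.e A with
      | none => rfl
      | some A' =>
        simp only [Option.map_some]
        rw [seg_append (((letter j).list_e_length hf).trans hA) hU]
    · cases hf : (letter j).list.e U with
      | none => rfl
      | some U' =>
        simp only [Option.map_some]
        rw [seg_append hA (((letter j).list_e_length hf).trans hU)]
    · cases hf : (letter j).list.e V with
      | none => rfl
      | some V' =>
        simp only [Option.map_some]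
        rw [seg_append hA hU]

/-- Conjugating `xi` by the involutive automorphism `seg` yields a map satisfying `SchLike`, which
is `xi` by uniqueness. -/
theorem xi_seg {n i m : ℕ} {l : List ℕ} (hl : IsWord n l) (h : i + m ≤ l.length) :
    xi n (seg n i m l) = seg n i m (xi n l) := by
  have hA := auto_seg (n := n) h
  have hS := xi_schLike n l.length
  have hζ : SchLike n l.length (fun l => seg n i m (xi n (seg n i m l))) := by
    have hlen : ∀ k, IsWord n k → k.length = l.length → (xi n (seg n i m k)).length = l.length :=
      fun k hk hN => by rw [length_xi (hA.word k hk hN), hA.length k hk hN]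
    constructor
    · intro k hk hN
      have := hA.conn (xi_conn (hA.word k hk hN)) (hA.word k hk hN) (hA.length k hk hN)
      rwa [seg_seg hk (by omega)] at this
    · intro k hk hN j hj
      rw [hA.f _ (hA.word k hk hN).xi (hlen k hk hN) j hj,
        hS.f _ (hA.word k hk hN) (hA.length k hk hN) j hj, hA.e k hk hN _ (by omega),
        Option.map_map, Option.map_map]
      rfl
    · intro k hk hN j hj
      rw [hA.e _ (hA.word k hk hN).xi (hlen k hk hN) j hj,
        hS.e _ (hA.word k hk hN) (hA.length k hk hN) j hj, hA.f k hk hN _ (by omega),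
        Option.map_map, Option.map_map]
      rfl
  have h1 := hζ.eq hS (hA.word l hl rfl) (hA.length l hl rfl)
  rw [seg_seg hl h] at h1
  exact h1.symm

theorem revComp_seg {n i m : ℕ} {l : List ℕ} (hl : IsWord n l) (h : i + m ≤ l.length) :
    revComp n (seg n i m l) = seg n (l.length - i - m) m (revComp n l) := by
  obtain ⟨A, U, V, hA, hU, rfl⟩ := exists_split h
  rw [isWord_append_three] at hl
  rw [seg_append hA hU, revComp_append, revComp_append, revComp_append, revComp_append,
    List.append_assoc, List.append_assoc, seg_append _ (by simpa), revComp_long hl.2.1]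
  simp
  omega

/-- The nested relation of the cactus group. -/
theorem long_seg {n i m : ℕ} {l : List ℕ} (hl : IsWord n l) (h : i + m ≤ l.length) :
    long n (seg n i m l) = seg n (l.length - i - m) m (long n l) := by
  unfold long
  rw [revComp_seg hl h, xi_seg hl.revComp (by simp; omega)]

/-! ### Types of factors -/

/-- The type of a word: the content of the word of lowest weight in its component. -/
noncomputable def wordType (n : ℕ) (l : List ℕ) (r : ℕ) : ℕ := (low n l).count r

theorem Conn.wordType {n : ℕ} {l l' : List ℕ} (hl : IsWord n l) (h : Conn n l l') :
    wordType n l = wordType n l' := by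
  funext r
  unfold CactusCrystal.wordType
  rw [h.low_eq hl]

/-- The lowest word in the component of the reverse complement comes from the highest word of `l`,
and `count_low` compares its content with that of the lowest word. -/
theorem wordType_revComp {n : ℕ} {l : List ℕ} (hl : IsWord n l) :
    wordType n (revComp n l) = wordType n l := by
  funext r
  unfold wordType
  rw [low_eq hl.revComp ((high_spec n l).1.conn.symm.revComp hl)
      ((high_spec n l).2.revComp hl.high)]
  rcases lt_or_ge r n with hr | hr
  · exact (count_low hl r hr).symm
  · rw [List.count_eq_zero_of_not_mem, List.count_eq_zero_of_not_mem]
    · intro h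
      have := hl.low r h
      omega
    · intro h
      have := hl.high.revComp r h
      omega

/-- A crystal operator changes a single block of a tensor product. Consequently connectedness passes
to prefixes, suffixes and factors, and the types of all factors are invariants of a component. -/
theorem word_f_take {i k : ℕ} {l l' : List ℕ} (h : (wordData i).f l = some l') :
    (l'.take k = l.take k ∨ (wordData i).f (l.take k) = some (l'.take k)) ∧
    (l'.drop k = l.drop k ∨ (wordData i).f (l.drop k) = some (l'.drop k)) := by
  have hl := (letter i).list_f_length h
  rw [← List.take_append_drop k l, list_f_append] at h
  have key : ∀ A B : List ℕ, A ++ B = l' → A.length = (l.take k).length →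
      l'.take k = A ∧ l'.drop k = B := by
    rintro A B rfl hA
    rw [List.length_take] at hA
    rcases le_total k l.length with h1 | h1
    · rw [min_eq_left h1] at hA
      subst hA
      simp
    · rw [min_eq_right h1] at hA
      rw [List.length_append] at hl
      have : B = [] := List.length_eq_zero_iff.1 (by omega)
      subst this
      simp only [List.append_nil]
      exact ⟨List.take_of_length_le (by omega), List.drop_of_length_le (by omega)⟩
  split_ifs at h with hc
  · obtain ⟨A, hA, h1⟩ := Option.map_eq_some_iff.1 h
    obtain ⟨h2, h3⟩ := key A _ h1 ((letter i).list_f_length hA)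
    rw [h2, h3]
    exact ⟨Or.inr hA, Or.inl rfl⟩
  · obtain ⟨B, hB, h1⟩ := Option.map_eq_some_iff.1 h
    obtain ⟨h2, h3⟩ := key _ B h1 rfl
    rw [h2, h3]
    exact ⟨Or.inl rfl, Or.inr hB⟩

theorem Conn.take {n : ℕ} {l l' : List ℕ} (h : Conn n l l') (k : ℕ) :
    Conn n (l.take k) (l'.take k) := by
  induction h with
  | rel l l' h =>
    obtain ⟨i, hi, h⟩ := h
    rcases (word_f_take (k := k) h).1 with h | h
    · rw [h]
      exact Conn.refl _
    · exact Conn.of_f hi h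
  | refl => exact Conn.refl _
  | symm _ _ _ ih => exact ih.symm
  | trans _ _ _ _ _ ih ih' => exact ih.trans ih'

theorem Conn.drop {n : ℕ} {l l' : List ℕ} (h : Conn n l l') (k : ℕ) :
    Conn n (l.drop k) (l'.drop k) := by
  induction h with
  | rel l l' h =>
    obtain ⟨i, hi, h⟩ := h
    rcases (word_f_take (k := k) h).2 with h | h
    · rw [h]
      exact Conn.refl _
    · exact Conn.of_f hi h
  | refl => exact Conn.refl _
  | symm _ _ _ ih => exact ih.symm
  | trans _ _ _ _ _ ih ih' => exact ih.trans ih'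

theorem IsWord.take {n : ℕ} {l : List ℕ} (h : IsWord n l) (k : ℕ) : IsWord n (l.take k) :=
  fun x hx => h x (List.mem_of_mem_take hx)

theorem IsWord.drop {n : ℕ} {l : List ℕ} (h : IsWord n l) (k : ℕ) : IsWord n (l.drop k) :=
  fun x hx => h x (List.mem_of_mem_drop hx)

/-- As `long n l` is connected to `revComp n l`, its factors have the types of the factors of
`revComp n l`. These are reverse complements of the mirrored factors of `l`, and reverse complement
preserves types. -/
theorem wordType_long_factor {n p q : ℕ} {l : List ℕ} (hl : IsWord n l) (h : p + q ≤ l.length) :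
    wordType n (((long n l).drop p).take q) =
      wordType n ((l.drop (l.length - p - q)).take q) := by
  unfold long
  rw [← (((xi_conn hl.revComp).drop p).take q).wordType ((hl.revComp.drop p).take q)]
  obtain ⟨A, U, V, hA, hU, rfl⟩ := exists_split (i := l.length - p - q) (m := q) (l := l) (by omega)
  have h1 : ((revComp n (A ++ (U ++ V))).drop p).take q = revComp n U := by
    have hV : (revComp n V).length = p := by
      simp only [List.length_append] at hA h
      rw [length_revComp]
      omega
    rw [revComp_append, revComp_append, List.append_assoc, ← hV, List.drop_left]
    rw [show q = (revComp n U).length by simp [hU], List.take_left]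
  rw [h1]
  have h2 : ((A ++ (U ++ V)).drop ((A ++ (U ++ V)).length - p - q)).take q = U := by
    rw [← hA, List.drop_left, ← hU, List.take_left]
  rw [h2]
  rw [isWord_append_three] at hl
  exact wordType_revComp hl.2.1

end CactusCrystal

/-! ### The local rule and Bender–Knuth involutions on words of lowest weight -/

namespace CactusCrystal

open StringData

/-! ### Words of lowest weight -/

theorem Lowest.of_append {n : ℕ} {A B : List ℕ} (h : Lowest n (A ++ B)) : Lowest n A :=
  fun i hi => (letter i).list_φ_prefix (h i hi)

theorem Lowest.take {n : ℕ} {l : List ℕ} (h : Lowest n l) (k : ℕ) : Lowest n (l.take k) := by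
  rw [← List.take_append_drop k l] at h
  exact h.of_append

theorem word_φ_singleton (i x : ℕ) : (wordData i).φ [x] = if x = i then 1 else 0 := by
  rw [list_φ_cons]
  simp [letter]

/-- The lattice word condition. -/
theorem lowest_snoc {n x : ℕ} {A : List ℕ} :
    Lowest n (A ++ [x]) ↔ Lowest n A ∧ (x + 1 < n → A.count x < A.count (x + 1)) := by
  constructor
  · intro h
    refine ⟨h.of_append, fun hx => ?_⟩
    have h1 := h x hx
    have h2 := h.of_append x hx
    have h3 := word_φ_sub_ε x A
    have h4 := word_φ_singleton x x
    rw [list_φ_append] at h1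
    simp only [wordData, if_true] at *
    omega
  · rintro ⟨h1, h2⟩ i hi
    have h3 := h1 i hi
    have h4 := word_φ_sub_ε i A
    have h5 := word_φ_singleton i x
    rw [list_φ_append]
    simp only [wordData] at *
    split_ifs at h5 with hx
    · subst hx
      have := h2 hi
      omega
    · omega

theorem Lowest.wordType {n : ℕ} {l : List ℕ} (hl : IsWord n l) (h : Lowest n l) (r : ℕ) :
    wordType n l r = l.count r := by
  rw [CactusCrystal.wordType, h.low_eq hl]

theorem take_eq_of_count {l l' : List ℕ} (m : ℕ) (hm : m ≤ l.length) (hm' : m ≤ l'.length)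
    (h : ∀ j ≤ m, ∀ r, (l.take j).count r = (l'.take j).count r) : l.take m = l'.take m := by
  induction m with
  | zero => rfl
  | succ m ih =>
    have h1 := ih (by omega) (by omega) (fun j hj => h j (by omega))
    have h2 := h (m + 1) le_rfl l[m]
    rw [← List.take_concat_get' l m (by omega), ← List.take_concat_get' l' m (by omega), h1] at h2
    rw [← List.take_concat_get' l m (by omega), ← List.take_concat_get' l' m (by omega), h1]
    rw [List.count_append, List.count_append] at h2
    by_cases he : l[m] = l'[m]
    · rw [he]
    · simp [Ne.symm he] at h2

/-- Lowering with index `j` does not affect `φ_i` for `i` far from `j`. -/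
theorem word_data_of_f_far {i j : ℕ} (h : i + 1 < j) : ∀ {l l' : List ℕ},
    (wordData j).f l = some l' →
      (wordData i).φ l' = (wordData i).φ l := by
  intro l
  induction l with
  | nil => intro l' h; simp at h
  | cons x l ih =>
    intro l' h
    rw [list_f_cons] at h
    split_ifs at h
    · obtain ⟨y, hy, rfl⟩ := Option.map_eq_some_iff.1 h
      simp only [letter] at hy
      split_ifs at hy with hx
      cases hy
      subst hx
      rw [list_φ_cons, list_φ_cons]
      simp only [letter]
      split_ifs <;> omega
    · obtain ⟨y, hy, rfl⟩ := Option.map_eq_some_iff.1 h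
      rw [list_φ_cons, list_φ_cons]
      have := ih hy
      simp only [wordData] at this
      rw [this]

/-- The lowest word minimises `below (i + 1)` on its component, whereas applying `f_i` would
decrease it by one. Where the minimum is attained, `f_i` is therefore not applicable. -/
theorem below_eq_of_type {n : ℕ} {u v : List ℕ} (hu : IsWord n u) (hv : Conn n u v) {i : ℕ}
    (hi : i + 1 < n) (h : below (i + 1) v = below (i + 1) (low n u)) : (wordData i).φ v = 0 := by
  by_contra h0
  obtain ⟨w, hw⟩ := (wordData i).exists_f h0
  have h1 := below_low_le hu (hv.trans (Conn.of_f hi hw)) (i + 1)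
  have h2 := (word_f_count hw).1
  have h3 : below i w = below i v := below_congr (n := i)
    (fun r hr => (word_f_count hw).2.2 r (by omega) (by omega)) i le_rfl
  rw [below_succ] at h1 h
  rw [below_succ] at h h1
  omega

/-- The indicator function of `r`. -/
abbrev ind (r k : ℕ) : ℕ := if k = r then 1 else 0

theorem below_eq_of_count {a b : List ℕ} {r j i : ℕ} (hr : r ≤ i) (hj : j ≤ i)
    (h : ∀ k, a.count k + ind j k = b.count k + ind r k) :
    below (i + 1) a = below (i + 1) b := by
  have key : ∀ k, below k a + (if j < k then 1 else 0) = below k b + (if r < k then 1 else 0) := by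
    intro k
    induction k with
    | zero => simp [below_zero]
    | succ k ih =>
      have h1 := h k
      rw [below_succ, below_succ]
      simp only [ind] at h1
      split_ifs at * <;> omega
  have := key (i + 1)
  rw [if_pos (by omega), if_pos (by omega)] at this
  omega

/-- The chain of lowerings of the factor `u` of a word `x u` of lowest weight, in the presence of
a further factor `s`. -/
theorem exists_lowering_chain {n r s : ℕ} {u : List ℕ} (hu : IsWord n u) (hrs : r ≠ s)
    (hcount : ∀ k, u.count k + ind (n - 1) k = wordType n u k + ind r k)
    (hφ : ∀ i, i + 1 < n - 1 → (wordData i).φ u = 0)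
    (hs : s + 1 < n → wordType n u s < wordType n u (s + 1)) :
    ∀ d, r + d ≤ n - 1 → ∃ v, Conn n u v ∧ Conn n (u ++ [s]) (v ++ [s]) ∧
      (∀ k, v.count k + ind (n - 1 - d) k = wordType n u k + ind r k) ∧
      ∀ i, i + 1 < n - 1 - d → (wordData i).φ v = 0
  | 0, _ => ⟨u, Conn.refl _, Conn.refl _, hcount, hφ⟩
  | d + 1, hd => by
    obtain ⟨v, h1, h2, h3, h4⟩ := exists_lowering_chain hu hrs hcount hφ hs d (by omega)
    have hv := h1.isWord_iff.1 hu
    -- A lowest word has its type as content, but `v` lacks one letter `n - 1 - d` and `r` is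
    -- smaller.
    have hnl : ¬ Lowest n v := by
      intro hl
      have e1 : wordType n u = wordType n v := h1.wordType hu
      have e2 := h3 (n - 1 - d)
      rw [e1, hl.wordType hv] at e2
      have e3 : ind (n - 1 - d) (n - 1 - d) = 1 := if_pos rfl
      have e4 : ind r (n - 1 - d) = 0 := if_neg (by omega)
      omega
    simp only [Lowest, not_forall] at hnl
    obtain ⟨i, hi, hne⟩ := hnl
    -- Smaller indices are excluded by the invariant on `φ`. For larger ones the missing letter and
    -- the extra letter are both counted by `below (i + 1)`, which is then minimal.
    have hij : i + 1 = n - 1 - d := by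
      rcases lt_trichotomy (i + 1) (n - 1 - d) with h | h | h
      · exact absurd (h4 i h) hne
      · exact h
      · exact absurd (below_eq_of_type hu h1 hi
          (below_eq_of_count (r := r) (j := n - 1 - d) (by omega) (by omega) h3)) hne
    obtain ⟨w, hw⟩ := (wordData i).exists_f hne
    refine ⟨w, h1.trans (Conn.of_f hi hw), h2.trans (Conn.of_f hi ?_), ?_, ?_⟩
    -- The letter `s` competes for the operator only if `s = i`. Then `v` contains at least as many
    -- letters `s + 1` as letters `s` by `hs`, and `φ` of `v` is positive, so `ε` is positive too
    -- and the operator acts on `v`.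
    · have hcond : (wordData i).φ [s] ≤ (wordData i).ε v := by
        rw [word_φ_singleton]
        split_ifs with hsi
        · subst hsi
          have e1 := word_φ_sub_ε s v
          have e2 := h3 s
          have e3 := h3 (s + 1)
          have e4 := hs hi
          simp only [ind] at e2 e3
          rw [if_neg (by omega), if_neg (by omega)] at e2
          rw [if_pos (by omega), if_neg (by omega)] at e3
          omega
        · omega
      rw [list_f_append, if_pos hcond]
      simp only [wordData] at hw
      rw [hw]
      rfl
    · intro k
      have e1 := h3 k
      have e2 := word_f_count_eq hw k
      have : n - 1 - (d + 1) = i := by omega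
      rw [this]
      rw [← hij] at e1
      simp only [ind] at *
      omega
    · intro k hk
      rw [word_data_of_f_far (by omega) hw]
      exact h4 k (by omega)

theorem conn_letter_lowest {n x : ℕ} {u : List ℕ} (hx : x < n) (h : Lowest n (x :: u)) :
    x = n - 1 := by
  by_contra hne
  have h1 : Lowest n [x] := Lowest.of_append (B := u) h
  have h2 := h1 x (by omega)
  rw [word_φ_singleton, if_pos rfl] at h2
  omega

/-- The local rule for the types of the factors of a word, for a word of lowest weight. -/
theorem local_rule_of_lowest {n x y r s : ℕ} {u : List ℕ} (hw : IsWord n (x :: (u ++ [y])))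
    (hl : Lowest n (x :: (u ++ [y]))) (hr : r < n) (hrs : r ≠ s)
    (h1 : ∀ k, wordType n (x :: u) k = wordType n u k + ind r k)
    (h2 : ∀ k, wordType n (x :: (u ++ [y])) k = wordType n u k + ind r k + ind s k)
    (hs : s + 1 < n → wordType n u s < wordType n u (s + 1)) (k : ℕ) :
    wordType n (u ++ [y]) k = wordType n u k + ind s k := by
  have hl' : Lowest n (x :: u) := Lowest.of_append (B := [y]) (by simpa using hl)
  have hw' := hw
  rw [isWord_cons, isWord_append] at hw'
  obtain ⟨hx, hu, hy⟩ := hw'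
  have hxu : IsWord n (x :: u) := isWord_cons.2 ⟨hx, hu⟩
  have hx' := conn_letter_lowest hx hl'
  have hys : y = s := by
    have e1 := h1 y
    have e2 := h2 y
    rw [hl'.wordType hxu] at e1
    rw [hl.wordType hw] at e2
    simp only [ind, List.count_cons, List.count_append, List.count_nil] at e1 e2
    by_contra hne
    simp [hne] at e1 e2
    omega
  subst hys
  have hcount : ∀ k, u.count k + ind (n - 1) k = wordType n u k + ind r k := by
    intro k
    have e1 := h1 k
    rw [hl'.wordType hxu, List.count_cons, hx'] at e1
    simp only [ind, beq_iff_eq, eq_comm (a := n - 1)] at e1 ⊢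
    exact e1
  have hφ : ∀ i, i + 1 < n - 1 → (wordData i).φ u = 0 := by
    intro i hi
    have e1 := hl' i (by omega)
    have e2 : (letter i).ε x = 0 := if_neg (by omega)
    rw [list_φ_cons, e2] at e1
    simp only [wordData]
    omega
  -- Here `x = n - 1` and `y = s`, so that `u` differs from a lowest content by one letter `r` in
  -- place of `n - 1`. The chain lowers `u` to its lowest word `v` without touching `y`, and `v`
  -- followed by `y` is lowest by the lattice condition.
  obtain ⟨v, c1, c2, c3, c4⟩ := exists_lowering_chain hu hrs hcount hφ hs (n - 1 - r) (by omega)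
  rw [show n - 1 - (n - 1 - r) = r by omega] at c3
  have hcv : ∀ k, v.count k = wordType n u k := by
    intro k
    have := c3 k
    omega
  have hv : Lowest n v := by
    intro i hi
    exact below_eq_of_type hu c1 hi (below_congr (n := n) (fun r _ => hcv r) _ (by omega))
  have hvs : Lowest n (v ++ [y]) := by
    rw [lowest_snoc]
    refine ⟨hv, fun hy' => ?_⟩
    rw [hcv, hcv]
    exact hs hy'
  have huy : IsWord n (u ++ [y]) := isWord_append.2 ⟨hu, hy⟩
  rw [c2.wordType huy, hvs.wordType (c2.isWord_iff.1 huy), List.count_append, hcv]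
  simp only [List.count_singleton, ind, beq_iff_eq, eq_comm (a := y)]

/-- The local rule for the types of the factors of a word. -/
theorem local_rule {n r s : ℕ} {c : List ℕ} {m : ℕ} (hc : c.length = m + 2) (hw : IsWord n c)
    (hr : r < n) (hrs : r ≠ s)
    (h1 : ∀ k, wordType n (c.take (m + 1)) k = wordType n ((c.drop 1).take m) k + ind r k)
    (h2 : ∀ k, wordType n c k = wordType n ((c.drop 1).take m) k + ind r k + ind s k)
    (hs : s + 1 < n →
      wordType n ((c.drop 1).take m) s < wordType n ((c.drop 1).take m) (s + 1)) (k : ℕ) :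
    wordType n (c.drop 1) k = wordType n ((c.drop 1).take m) k + ind s k := by
  -- All hypotheses and the conclusion concern types of factors, so `c` may be replaced by the
  -- lowest word of its component.
  have hcl := (low_spec hw).1.conn
  have hll := (low_spec hw).2
  have hwl := hw.low
  rw [hcl.wordType hw] at h2
  rw [(hcl.take (m + 1)).wordType (hw.take _)] at h1
  have e1 := ((hcl.drop 1).take m).wordType ((hw.drop 1).take m)
  rw [e1] at h1 h2 hs ⊢
  rw [(hcl.drop 1).wordType (hw.drop 1)]
  have hlen := hcl.length.symm.trans hc
  generalize low n c = b at *
  obtain ⟨x, b, rfl⟩ : ∃ x b', b = x :: b' := by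
    cases b with
    | nil => simp at hlen
    | cons x b => exact ⟨x, b, rfl⟩
  simp only [List.length_cons] at hlen
  obtain ⟨u, y, rfl⟩ : ∃ u y, b = u ++ [y] := by
    rcases List.eq_nil_or_concat b with rfl | ⟨u, y, h⟩
    · simp at hlen
    · exact ⟨u, y, by simpa using h⟩
  have hum : u.length = m := by simp at hlen; omega
  subst hum
  simp only [List.drop_succ_cons, List.drop_zero, List.take_left, List.take_succ_cons] at *
  exact local_rule_of_lowest hwl hll hr hrs h1 h2 hs k

/-! ### The action on words of lowest weight -/

theorem seg_zero (n k : ℕ) (l : List ℕ) : seg n 0 k l = long n (l.take k) ++ l.drop k := by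
  simp [seg]

theorem seg_take {n k m : ℕ} {l : List ℕ} (hl : IsWord n l) (hk : k ≤ m) (hm : m ≤ l.length) :
    (seg n 0 k l).take m = seg n 0 k (l.take m) := by
  have h1 : (long n (l.take k)).length = k := by
    rw [length_long (hl.take k)]
    simp
    omega
  rw [seg_zero, seg_zero, List.take_append, List.take_of_length_le (by omega), h1, List.take_take,
    min_eq_left hk, List.drop_take]

theorem seg_append_right {n k : ℕ} {l l' : List ℕ} (hk : k ≤ l.length) :
    seg n 0 k (l ++ l') = seg n 0 k l ++ l' := by
  rw [seg_zero, seg_zero, List.take_append_of_le_length hk, List.drop_append_of_le_length hk,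
    List.append_assoc]

theorem wordType_seg {n i m : ℕ} {l : List ℕ} (hl : IsWord n l) (h : i + m ≤ l.length) :
    wordType n (seg n i m l) = wordType n l := by
  have hA := auto_seg (n := n) h
  have hlen := (low_spec hl).1.conn.length
  funext r
  unfold wordType
  rw [hA.low hl rfl]
  rcases lt_or_ge r n with hr | hr
  · exact count_seg hl.low (by omega) hr
  · rw [List.count_eq_zero_of_not_mem, List.count_eq_zero_of_not_mem]
    · intro h
      have := hl.low r h
      omega
    · intro h
      have := hA.word _ hl.low hlen.symm r h
      omega

/-- Moving the first factor past the following `k` factors shifts the types of the prefixes. -/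
theorem wordType_slide {n k j : ℕ} {c : List ℕ} (hw : IsWord n c) (hk : k + 1 ≤ c.length)
    (hj : j ≤ k) : wordType n ((seg n 0 k (seg n 0 (k + 1) c)).take j) =
      wordType n ((c.drop 1).take j) := by
  have hw1 : IsWord n (c.take (k + 1)) := hw.take _
  have hl1 : (c.take (k + 1)).length = k + 1 := by simp; omega
  have hL : (long n (c.take (k + 1))).length = k + 1 := by rw [length_long hw1, hl1]
  have hw2 : IsWord n ((long n (c.take (k + 1))).take k) := hw1.long.take k
  have hl2 : ((long n (c.take (k + 1))).take k).length = k := by simp [hL]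
  have e1 : seg n 0 (k + 1) c = long n (c.take (k + 1)) ++ c.drop (k + 1) := seg_zero _ _ _
  have e0 : (long n (c.take (k + 1)) ++ c.drop (k + 1)).take k = (long n (c.take (k + 1))).take k :=
    List.take_append_of_le_length (by omega)
  rw [e1, seg_zero, e0, List.take_append_of_le_length (by rw [length_long hw2, hl2]; exact hj)]
  -- Each of the two long elements reverses the order of the factors as far as types are concerned.
  -- Reversing `k + 1` factors and then the first `k` is a shift by one.
  have e2 := wordType_long_factor (p := 0) (q := j) hw2 (by omega)
  rw [List.drop_zero] at e2
  rw [e2, hl2, Nat.sub_zero]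
  have e3 := wordType_long_factor (p := k - j) (q := j) hw1 (by omega)
  rw [hl1, show k + 1 - (k - j) - j = 1 by omega] at e3
  rw [List.drop_take, List.take_take, min_eq_left (by omega), e3, List.drop_take, List.take_take,
    min_eq_left (by omega)]

/-- The operator which acts on words of lowest weight as a Bender–Knuth involution. -/
noncomputable def bkOp (n m : ℕ) (l : List ℕ) : List ℕ :=
  -- If `q_k` corresponds to `seg n 0 (k + 1)`, the recursion defining `q_k` is solved by `t_{m+1} =
  -- q_m q_{m+1} q_m q_{m-1}`.
  seg n 0 (m + 1) (seg n 0 (m + 2) (seg n 0 (m + 1) (seg n 0 m l)))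

theorem pair_eq_of_count {p q a a' : ℕ} (h : ∀ r, [p, q].count r = [a, a'].count r) :
    (p = a ∧ q = a') ∨ (p = a' ∧ q = a) := by
  have hperm : [p, q].Perm [a, a'] := List.perm_iff_count.2 h
  have hp : p ∈ [a, a'] := hperm.subset (by simp)
  rcases List.mem_pair.1 hp with rfl | rfl
  · have := (List.perm_cons p).1 hperm
    exact Or.inl ⟨rfl, by simpa using this⟩
  · have := (List.perm_cons p).1 (hperm.trans (List.Perm.swap p a []))
    exact Or.inr ⟨rfl, by simpa using this⟩

/-- Let `c` be the word after the first two of the four long elements. By `wordType_slide` both the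
original word and the result have, up to length `m`, the prefix types of `c` without its first
letter. For lowest words prefix types are prefix contents, so the first `m` letters stay fixed;
total content is preserved, so the last two letters are kept or exchanged. The local rule forces the
exchange whenever it gives a lowest word. -/
theorem bkOp_eq {n m : ℕ} {d : List ℕ} {a a' : ℕ} (hd : d.length = m)
    (hw : IsWord n (d ++ [a, a'])) (hl : Lowest n (d ++ [a, a'])) :
    (a ≠ a' → Lowest n (d ++ [a', a]) → bkOp n m (d ++ [a, a']) = d ++ [a', a]) ∧
    (¬ (a ≠ a' ∧ Lowest n (d ++ [a', a])) → bkOp n m (d ++ [a, a']) = d ++ [a, a']) := by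
  obtain ⟨b, hb⟩ : ∃ b, b = d ++ [a, a'] := ⟨_, rfl⟩
  rw [← hb] at hw hl ⊢
  have hblen : b.length = m + 2 := by simp [hb, hd]
  have w1 := seg_word (i := 0) (m := m) hw (by omega)
  obtain ⟨c, hcdef⟩ : ∃ c, c = seg n 0 (m + 1) (seg n 0 m b) := ⟨_, rfl⟩
  have w2 := seg_word (i := 0) (m := m + 1) w1.1 (by omega)
  rw [← hcdef] at w2
  have hclen : c.length = m + 2 := by omega
  have hbc : b = seg n 0 m (seg n 0 (m + 1) c) := by
    rw [hcdef, seg_seg w1.1 (by omega), seg_seg hw (by omega)]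
  have w3 := seg_word (i := 0) (m := m + 2) w2.1 (by omega)
  have w4 := seg_word (i := 0) (m := m + 1) w3.1 (by omega)
  obtain ⟨b', hb'⟩ : ∃ b', b' = seg n 0 (m + 1) (seg n 0 (m + 2) c) := ⟨_, rfl⟩
  rw [← hb'] at w4
  have hbk : bkOp n m b = b' := by rw [bkOp, hb', hcdef]
  have hb'len : b'.length = m + 2 := by omega
  have hlc : Lowest n c := by
    rw [hcdef]
    refine (auto_seg (N := m + 2) (by omega)).lowest w1.1 (by omega) ?_
    exact (auto_seg (N := m + 2) (by omega)).lowest hw (by omega) hl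
  have hl' : Lowest n b' := by
    rw [hb']
    refine (auto_seg (N := m + 2) (by omega)).lowest w3.1 (by omega) ?_
    exact (auto_seg (N := m + 2) (by omega)).lowest w2.1 (by omega) hlc
  have hcount : ∀ r, b'.count r = b.count r := by
    intro r
    rcases lt_or_ge r n with hr | hr
    · rw [hb', count_seg w3.1 (by omega) hr, count_seg w2.1 (by omega) hr, hcdef,
        count_seg w1.1 (by omega) hr, count_seg hw (by omega) hr]
    · rw [List.count_eq_zero_of_not_mem, List.count_eq_zero_of_not_mem]
      · intro h
        have := hw r h
        omega
      · intro h
        have := w4.1 r h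
        omega
  have htb : ∀ j ≤ m, wordType n (b.take j) = wordType n ((c.drop 1).take j) := by
    intro j hj
    conv_lhs => rw [hbc]
    exact wordType_slide w2.1 (by omega) hj
  have htb' : ∀ j ≤ m + 1, wordType n (b'.take j) = wordType n ((c.drop 1).take j) := by
    intro j hj
    rw [hb']
    exact wordType_slide w2.1 (by omega) hj
  have hpre : b'.take m = d := by
    have h1 : b'.take m = b.take m := by
      apply take_eq_of_count m (by omega) (by omega)
      intro j hj r
      rw [← (hl'.take j).wordType (w4.1.take j), ← (hl.take j).wordType (hw.take j), htb j hj,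
        htb' j (by omega)]
    rw [h1, hb, ← hd, List.take_left]
  obtain ⟨p, q, hpq⟩ : ∃ p q, b' = d ++ [p, q] := by
    have h1 := List.take_append_drop m b'
    rw [hpre] at h1
    have h2 : (b'.drop m).length = 2 := by simp; omega
    obtain ⟨p, q, h3⟩ := List.length_eq_two.1 h2
    exact ⟨p, q, by rw [← h1, h3]⟩
  have hcases : (p = a ∧ q = a') ∨ (p = a' ∧ q = a) := by
    apply pair_eq_of_count
    intro r
    have e1 := hcount r
    rw [hpq, hb, List.count_append, List.count_append] at e1
    omega
  have hwd := hw
  rw [hb, isWord_append, isWord_cons, isWord_cons] at hwd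
  obtain ⟨hwd, ha, ha', -⟩ := hwd
  rw [hbk]
  constructor
  · intro hne hsw
    have hdt : wordType n ((c.drop 1).take m) = fun k => d.count k := by
      funext k
      rw [← htb m le_rfl, (hl.take m).wordType (hw.take m), hb, ← hd, List.take_left]
    have hba : b.take (m + 1) = d ++ [a] := by
      rw [hb, List.take_append, hd, List.take_of_length_le (by omega)]
      simp
    have hba' : b'.take (m + 1) = d ++ [p] := by
      rw [hpq, List.take_append, hd, List.take_of_length_le (by omega)]
      simp
    have hdrop : (c.drop 1).take (m + 1) = c.drop 1 := List.take_of_length_le (by simp; omega)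
    have hs1 := lowest_snoc.1 (Lowest.of_append (A := d ++ [a']) (B := [a]) (by simpa using hsw))
    -- With the content of `d` as base type, adding the first letter of `c` adds `a`, and adding
    -- both ends adds `a` and `a'`. The rule says that adding the last letter alone adds `a'`, which
    -- is therefore the letter of the result after `d`.
    have key := local_rule (r := a) (s := a') hclen w2.1 ha hne
      (by
        intro k
        have e1 : wordType n (c.take (m + 1)) = wordType n (b.take (m + 1)) := by
          conv_rhs => rw [hbc]
          have w5 := seg_word (i := 0) (m := m + 1) w2.1 (by omega)
          rw [seg_take w5.1 (by omega) (by omega), wordType_seg (w5.1.take _) (by simp; omega),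
            seg_take w2.1 le_rfl (by omega), wordType_seg (w2.1.take _) (by simp; omega)]
        rw [e1, (hl.take _).wordType (hw.take _), hba, hdt]
        simp only [List.count_append, List.count_singleton, ind, beq_iff_eq]
        split_ifs <;> omega)
      (by
        intro k
        have e1 : wordType n c = wordType n b := by
          conv_rhs => rw [hbc]
          have w5 := seg_word (i := 0) (m := m + 1) w2.1 (by omega)
          rw [wordType_seg w5.1 (by omega), wordType_seg w2.1 (by omega)]
        rw [e1, hl.wordType hw, hdt, hb]
        simp only [List.count_append, List.count_cons, List.count_nil, ind, beq_iff_eq]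
        split_ifs <;> omega)
      (by
        intro h
        rw [hdt]
        exact hs1.2 h)
    have e5 : wordType n (c.drop 1) p = (d ++ [p]).count p := by
      rw [← hdrop, ← htb' (m + 1) le_rfl, (hl'.take _).wordType (w4.1.take _), hba']
    have hp := key p
    rw [e5, hdt] at hp
    simp only [List.count_append, List.count_singleton_self, ind] at hp
    have hpa : p = a' := by
      by_contra h
      rw [if_neg h] at hp
      omega
    rcases hcases with ⟨h1, h2⟩ | ⟨h1, h2⟩
    · exact absurd (h1.symm.trans hpa) hne
    · rw [hpq, h1, h2]
  · intro hns
    rcases hcases with ⟨h1, h2⟩ | ⟨h1, h2⟩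
    · rw [hpq, h1, h2, hb]
    -- The result is always a lowest word, so a genuine exchange would contradict `hns`.
    · have : a = a' := by
        by_contra hne
        apply hns
        rw [hpq, h1, h2] at hl'
        exact ⟨hne, hl'⟩
      rw [hpq, h1, h2, hb, this]

theorem bkOp_append {n m : ℕ} {l l' : List ℕ} (hw : IsWord n l) (h : l.length = m + 2) :
    bkOp n m (l ++ l') = bkOp n m l ++ l' := by
  have w1 := seg_word (i := 0) (m := m) hw (by omega)
  have w2 := seg_word (i := 0) (m := m + 1) w1.1 (by omega)
  have w3 := seg_word (i := 0) (m := m + 2) w2.1 (by omega)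
  unfold bkOp
  rw [seg_append_right (by omega), seg_append_right (by omega), seg_append_right (by omega),
    seg_append_right (by omega)]

end CactusCrystal

/-! ### From words to the crystals and the group actions of the statement -/

namespace CactusCrystal

open StringData

/-! ### Crystals of words -/

theorem maxIter_eq_zero {X : Type} {g : X → Option X} {b : X} (h : g b = none) :
    maxIter g b = 0 := by
  have hk : {k : ℕ | (fun o : Option X => o.bind g)^[k] (some b) ≠ none} = {0} := by
    ext k
    rcases k with _ | k
    · simp
    · have : (fun o : Option X => o.bind g)^[k] none = none :=
        Function.iterate_fixed (by rfl) k
      simp [Function.iterate_succ_apply, h, this]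
  rw [maxIter, hk, csSup_singleton]

/-- The words `g b` are a model for the crystal `c`. -/
structure IsWordModel {n : ℕ} {X : Type} (c : Crystal n X) (N : ℕ) (g : X → List ℕ) : Prop where
  e : ∀ i b, (c.e i b).map g = (wordData i).e (g b)
  f : ∀ i b, (c.f i b).map g = (wordData i).f (g b)
  injective : Function.Injective g
  surj : ∀ l, IsWord n l → l.length = N → ∃ b, g b = l
  word : ∀ b, IsWord n (g b)
  length : ∀ b, (g b).length = N
  wt : ∀ b, c.wt b = toWeight n (fun r => ((g b).count (r : ℕ) : ℤ))

namespace IsWordModel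

variable {n N M : ℕ} {X Y : Type} {c : Crystal n X} {d : Crystal n Y} {g : X → List ℕ}
  {h : Y → List ℕ}

theorem φ_eq (H : IsWordModel c N g) (i : Fin (n - 1)) (b : X) :
    c.φ i b = (wordData i).φ (g b) := by
  induction hk : (wordData i).φ (g b) generalizing b with
  | zero =>
    rw [← (wordData i).f_eq_none, ← H.f, Option.map_eq_none_iff] at hk
    exact maxIter_eq_zero hk
  | succ k ih =>
    obtain ⟨y, hy⟩ := (wordData i).exists_f (x := g b) (by omega)
    have h1 := H.f i b
    rw [hy] at h1
    obtain ⟨b', hb', rfl⟩ := Option.map_eq_some_iff.1 h1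
    have h2 := (wordData i).φ_f _ _ hy
    rw [c.φ_of_f hb', ih b' (by omega)]

theorem ε_eq (H : IsWordModel c N g) (i : Fin (n - 1)) (b : X) :
    c.ε i b = (wordData i).ε (g b) := by
  induction hk : (wordData i).ε (g b) generalizing b with
  | zero =>
    rw [← (wordData i).e_eq_none, ← H.e, Option.map_eq_none_iff] at hk
    exact maxIter_eq_zero hk
  | succ k ih =>
    obtain ⟨y, hy⟩ := (wordData i).exists_e (x := g b) (by omega)
    have h1 := H.e i b
    rw [hy] at h1
    obtain ⟨b', hb', rfl⟩ := Option.map_eq_some_iff.1 h1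
    have h2 := (wordData i).ε_f _ _ (((wordData i).f_iff _ _).2 hy)
    rw [c.ε_of_e hb', ih b' (by omega)]

theorem tensor (H : IsWordModel c N g) (K : IsWordModel d M h) :
    IsWordModel (c.tensor d) (N + M) (fun b => g b.1 ++ h b.2) where
  e i b := by
    have e1 := H.e i b.1
    have e2 := K.e i b.2
    simp only [wordData] at e1 e2 ⊢
    rw [list_e_append, ← e1, ← e2]
    simp only [Crystal.tensor, H.ε_eq, K.φ_eq, gt_iff_lt]
    split_ifs <;> simp [Option.map_map, Function.comp_def]
  f i b := by
    have e1 := H.f i b.1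
    have e2 := K.f i b.2
    simp only [wordData] at e1 e2 ⊢
    rw [list_f_append, ← e1, ← e2]
    simp only [Crystal.tensor, H.ε_eq, K.φ_eq, ge_iff_le]
    split_ifs <;> simp [Option.map_map, Function.comp_def]
  injective b b' hb := by
    have := List.append_inj hb (by rw [H.length, H.length])
    exact Prod.ext (H.injective this.1) (K.injective this.2)
  surj l hl hN := by
    obtain ⟨x, hx⟩ := H.surj (l.take N) (hl.take N) (by simp; omega)
    obtain ⟨y, hy⟩ := K.surj (l.drop N) (hl.drop N) (by simp; omega)
    exact ⟨(x, y), by simp [hx, hy]⟩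
  word b := isWord_append.2 ⟨H.word _, K.word _⟩
  length b := by rw [List.length_append, H.length, K.length]
  wt b := by
    simp only [Crystal.tensor, H.wt, K.wt, ← map_add, List.count_append, Nat.cast_add]
    rfl

theorem transport (H : IsWordModel c N g) (t : X ≃ Y) {h : Y → List ℕ}
    (hg : ∀ x, h (t x) = g x) : IsWordModel (c.transport t) N h where
  e i b := by
    have e1 := H.e i (t.symm b)
    rw [← hg, t.apply_symm_apply] at e1
    rw [← e1]
    simp [Crystal.transport, Option.map_map, Function.comp_def, hg]
  f i b := by
    have e1 := H.f i (t.symm b)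
    rw [← hg, t.apply_symm_apply] at e1
    rw [← e1]
    simp [Crystal.transport, Option.map_map, Function.comp_def, hg]
  injective b b' hb := by
    obtain ⟨x, rfl⟩ := t.surjective b
    obtain ⟨x', rfl⟩ := t.surjective b'
    rw [hg, hg] at hb
    rw [H.injective hb]
  surj l hl hN := by
    obtain ⟨x, hx⟩ := H.surj l hl hN
    exact ⟨t x, by rw [hg, hx]⟩
  word b := by
    obtain ⟨x, rfl⟩ := t.surjective b
    rw [hg]
    exact H.word x
  length b := by
    obtain ⟨x, rfl⟩ := t.surjective b
    rw [hg]
    exact H.length x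
  wt b := by
    obtain ⟨x, rfl⟩ := t.surjective b
    simp only [hg, Crystal.transport, Equiv.symm_apply_apply, H.wt]

theorem connected (H : IsWordModel c N g) {l l' : List ℕ} (hc : Conn n l l') :
    ∀ b b', g b = l → g b' = l' → c.Connected b b' := by
  induction hc with
  | rel l l' hc =>
    rintro b b' rfl rfl
    obtain ⟨i, hi, hc⟩ := hc
    have e1 := H.f ⟨i, by omega⟩ b
    rw [hc] at e1
    obtain ⟨b'', hb, hb'⟩ := Option.map_eq_some_iff.1 e1
    rw [H.injective hb'] at hb
    exact Relation.EqvGen.rel _ _ ⟨_, hb⟩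
  | refl l =>
    rintro b b' rfl hb
    rw [H.injective hb]
    exact Relation.EqvGen.refl _
  | symm l l' _ ih => exact fun b b' hb hb' => (ih b' b hb' hb).symm
  | trans l l' l'' h1 h2 ih1 ih2 =>
    rintro b b' rfl rfl
    have h3 : Conn n (g b) l' := h1
    obtain ⟨x, hx⟩ := H.surj l' (h3.isWord_iff.1 (H.word b)) (by rw [← h3.length, H.length])
    exact (ih1 b x rfl hx).trans _ _ _ (ih2 x b' hx rfl)

theorem conn (H : IsWordModel c N g) {b b' : X} (hc : c.Connected b b') :
    Conn n (g b) (g b') := by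
  induction hc with
  | rel b b' hc =>
    obtain ⟨i, hc⟩ := hc
    have e1 := H.f i b
    rw [hc] at e1
    exact Conn.of_f (by omega) e1.symm
  | refl b => exact Conn.refl _
  | symm b b' _ ih => exact ih.symm
  | trans b b' b'' _ _ h1 h2 => exact h1.trans h2

/-- The map of words induced by a map of a crystal of words. -/
noncomputable def _root_.CactusCrystal.mapWord (g : X → List ℕ) (ξ : X → X) (l : List ℕ) :
    List ℕ := by
  classical exact if h : ∃ b, g b = l then g (ξ h.choose) else l

theorem mapWord_apply (H : IsWordModel c N g) (ξ : X → X) (b : X) :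
    mapWord g ξ (g b) = g (ξ b) := by
  have h : ∃ b', g b' = g b := ⟨b, rfl⟩
  rw [mapWord, dif_pos h, H.injective h.choose_spec]

theorem rev_val (i : Fin (n - 1)) : ((i.rev : Fin (n - 1)) : ℕ) = n - 2 - i := by
  rw [Fin.val_rev]
  omega

theorem schLike (H : IsWordModel c N g) {ξ : X → X} (hξ : c.IsSchutzenberger ξ) :
    SchLike n N (mapWord g ξ) := by
  constructor
  · intro l hl hN
    obtain ⟨b, rfl⟩ := H.surj l hl hN
    rw [H.mapWord_apply]
    exact H.conn (hξ.connected b)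
  · intro l hl hN i hi
    obtain ⟨b, rfl⟩ := H.surj l hl hN
    have e1 := H.f ⟨i, by omega⟩ (ξ b)
    have e2 := H.e (Fin.rev ⟨i, by omega⟩) b
    rw [rev_val] at e2
    rw [H.mapWord_apply, ← e1, hξ.f, ← e2, Option.map_map, Option.map_map]
    congr 1
    funext b
    exact (H.mapWord_apply ξ b).symm
  · intro l hl hN i hi
    obtain ⟨b, rfl⟩ := H.surj l hl hN
    have e1 := H.e ⟨i, by omega⟩ (ξ b)
    have e2 := H.f (Fin.rev ⟨i, by omega⟩) b
    rw [rev_val] at e2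
    rw [H.mapWord_apply, ← e1, hξ.e, ← e2, Option.map_map, Option.map_map]
    congr 1
    funext b
    exact (H.mapWord_apply ξ b).symm

theorem apply_eq_xi (H : IsWordModel c N g) {ξ : X → X} (hξ : c.IsSchutzenberger ξ) (b : X) :
    g (ξ b) = xi n (g b) := by
  rw [← H.mapWord_apply]
  exact (H.schLike hξ).eq (xi_schLike n N) (H.word b) (H.length b)

/-- Existence transports `xi` along the model. Any other Schützenberger involution induces a map on
words satisfying `SchLike`, hence the same one. -/
theorem existsUnique_schutzenberger (H : IsWordModel c N g) : ∃! ξ, c.IsSchutzenberger ξ := by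
  have hex : ∀ b, ∃ b', g b' = xi n (g b) := fun b =>
    H.surj _ (H.word b).xi (by rw [length_xi (H.word b), H.length])
  choose ξ hξ using hex
  refine ⟨ξ, ⟨?_, ?_, ?_, ?_⟩, ?_⟩
  · intro b
    exact H.connected (xi_conn (H.word b)) _ _ rfl (hξ b)
  · intro b
    rw [H.wt, H.wt, hξ]
    have : longestWeyl n (toWeight n (fun r => ((g b).count (r : ℕ) : ℤ))) =
      toWeight n (fun r => ((g b).count ((Fin.rev r : Fin n) : ℕ) : ℤ)) := rfl
    rw [this]
    congr 1
    funext r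
    rw [count_xi (H.word b) r.2, Fin.val_rev]
    congr 2
    omega
  · intro i b
    apply Option.map_injective H.injective
    have e1 := (xi_schLike n N).e _ (H.word b) (H.length b) i (by omega)
    rw [H.e, hξ, e1, ← rev_val, ← H.f, Option.map_map, Option.map_map]
    congr 1
    funext b
    exact (hξ b).symm
  · intro i b
    apply Option.map_injective H.injective
    have e1 := (xi_schLike n N).f _ (H.word b) (H.length b) i (by omega)
    rw [H.f, hξ, e1, ← rev_val, ← H.e, Option.map_map, Option.map_map]
    congr 1
    funext b
    exact (hξ b).symm
  · intro ζ hζ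
    funext b
    apply H.injective
    rw [H.apply_eq_xi hζ, hξ]

theorem schutzenberger_eq (H : IsWordModel c N g) (b : X) :
    g (c.schutzenberger b) = xi n (g b) := by
  have hex := H.existsUnique_schutzenberger.exists
  rw [Crystal.schutzenberger, dif_pos hex]
  exact H.apply_eq_xi hex.choose_spec b

end IsWordModel

/-! ### Tensor powers of the vector representation -/

/-- The word in natural numbers of a word in `Fin n`. -/
def toWord {n k : ℕ} (a : Fin k → Fin n) : List ℕ := List.ofFn (fun j => (a j : ℕ))

theorem toWord_cons {n k : ℕ} (x : Fin n) (a : Fin k → Fin n) :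
    toWord (Fin.cons x a : Fin (k + 1) → Fin n) = (x : ℕ) :: toWord a := by
  simp [toWord, List.ofFn_succ]

theorem isWordModel_vector (n : ℕ) :
    IsWordModel (Crystal.vector n) 1 (fun b : Fin n => [(b : ℕ)]) where
  e i b := by
    rw [list_e_cons]
    simp only [Crystal.vector, letter, hiLetter, loLetter, Fin.ext_iff, list_φ_nil]
    split_ifs <;> simp_all
  f i b := by
    rw [list_f_cons]
    simp only [Crystal.vector, letter, hiLetter, loLetter, Fin.ext_iff, list_φ_nil]
    split_ifs <;> simp_all
  injective b b' h := Fin.ext (by simpa using h)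
  surj l hl hN := by
    obtain ⟨x, rfl⟩ := List.length_eq_one_iff.1 hN
    exact ⟨⟨x, hl x (by simp)⟩, rfl⟩
  word b x hx := by
    rw [List.mem_singleton.1 hx]
    exact b.2
  length b := rfl
  wt b := by
    change toWeight n _ = _
    congr 1
    funext r
    simp only [Pi.single_apply, List.count_singleton, beq_iff_eq, Fin.ext_iff,
        eq_comm (a := (b : ℕ))]
    split_ifs <;> rfl

theorem isWordModel_power (n : ℕ) :
    ∀ k, IsWordModel ((Crystal.vector n).power k) k (toWord (n := n) (k := k))
  | 0 =>
    { e := fun i b => by simp [toWord, Crystal.power, Crystal.unit]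
      f := fun i b => by simp [toWord, Crystal.power, Crystal.unit]
      injective := fun b b' _ => Subsingleton.elim _ _
      surj := fun l _ hN => ⟨Fin.elim0, by rw [List.length_eq_zero_iff.1 hN]; simp [toWord]⟩
      word := fun b x hx => by simp [toWord] at hx
      length := fun b => by simp [toWord]
      wt := fun b => by
        simp only [toWord, List.ofFn_zero, List.count_nil, Nat.cast_zero]
        exact (map_zero (toWeight n)).symm }
  | k + 1 => by
    have := ((isWordModel_vector n).tensor (isWordModel_power n k)).transport
      (Fin.consEquiv (fun _ : Fin (k + 1) => Fin n)) (h := toWord) (by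
        rintro ⟨x, a⟩
        exact toWord_cons x a)
    rwa [Nat.add_comm 1 k] at this

/-- Length is preserved and content is reversed, which leaves a single possibility. -/
theorem xi_singleton {n x : ℕ} (hx : x < n) : xi n [x] = [n - 1 - x] := by
  have hw : IsWord n [x] := by simpa [IsWord] using hx
  have h1 := length_xi hw
  obtain ⟨y, hy⟩ := List.length_eq_one_iff.1 h1
  have hyw : y < n := hw.xi y (by simp [hy])
  have h2 := count_xi hw hyw
  rw [hy, List.count_singleton_self] at h2
  have h3 : n - 1 - y ∈ [x] := List.count_pos_iff.1 (by omega)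
  rw [hy, ← List.mem_singleton.1 h3, show n - 1 - (n - 1 - y) = y by omega]

theorem toWord_snoc {n k : ℕ} (a : Fin k → Fin n) (x : Fin n) :
    toWord (Fin.snoc (α := fun _ => Fin n) a x : Fin (k + 1) → Fin n) = toWord a ++ [(x : ℕ)] := by
  simp only [toWord, List.ofFn_succ', Fin.snoc_last, Fin.snoc_castSucc, List.concat_eq_append]

theorem isWord_toWord {n k : ℕ} (a : Fin k → Fin n) : IsWord n (toWord a) :=
  (isWordModel_power n k).word a

theorem length_toWord {n k : ℕ} (a : Fin k → Fin n) : (toWord a).length = k :=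
  (isWordModel_power n k).length a

theorem toWord_injective {n k : ℕ} : Function.Injective (toWord (n := n) (k := k)) :=
  (isWordModel_power n k).injective

/-- In the recursion `xi` is applied to `long n u = xi n (revComp n u)` and gives back `revComp n
u`. The commutor then produces `xi` of `revComp n u` followed by the complement of the first letter,
and that word is the reverse complement of the whole word. -/
theorem toWord_longElement (n : ℕ) : ∀ (m : ℕ) (a : Fin m → Fin n),
    toWord ((Crystal.vector n).longElement m a) = long n (toWord a)
  | 0, a => by
    have h := length_long (isWord_toWord a)
    rw [length_toWord] at h
    rw [List.length_eq_zero_iff.1 h]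
    simp [toWord]
  | m + 1, a => by
    have ih := toWord_longElement n m (Fin.tail a)
    have h1 := ((isWordModel_power n m).tensor (isWordModel_vector n)).schutzenberger_eq
      (((Crystal.vector n).power m).schutzenberger
        ((Crystal.vector n).longElement m (Fin.tail a)), (Crystal.vector n).schutzenberger (a 0))
    have h2 := (isWordModel_power n m).schutzenberger_eq
      ((Crystal.vector n).longElement m (Fin.tail a))
    have h3 := (isWordModel_vector n).schutzenberger_eq (a 0)
    dsimp only at h1 h3
    have h4 : toWord a = (a 0 : ℕ) :: toWord (Fin.tail a) := by
      rw [← toWord_cons, Fin.cons_self_tail]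
    have hw := isWord_toWord (Fin.tail a)
    simp only [Crystal.longElement, Crystal.commutor]
    rw [toWord_snoc, h1, h2, h3, ih, h4, xi_singleton (a 0).2, long, xi_xi hw.revComp, long,
      revComp_cons]

theorem toWord_commutorAction {n k : ℕ} (p : PosPair k) (a : Fin k → Fin n) :
    toWord ((Crystal.vector n).commutorAction p a) =
      seg n p.1.1 ((p.1.2 : ℕ) - (p.1.1 : ℕ) + 1) (toWord a) := by
  have hp : (p.1.1 : ℕ) < p.1.2 := p.2
  have hp2 := p.1.2.isLt
  obtain ⟨i, hi⟩ : ∃ i, i = (p.1.1 : ℕ) := ⟨_, rfl⟩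
  obtain ⟨m, hm⟩ : ∃ m, m = (p.1.2 : ℕ) - (p.1.1 : ℕ) + 1 := ⟨_, rfl⟩
  have hU : ((toWord a).drop i).take m = toWord (fun s : Fin m => a ⟨i + (s : ℕ), by omega⟩) := by
    apply List.ext_getElem
    · simp [length_toWord]
      omega
    · intro t h1 h2
      simp [toWord]
  apply List.ext_getElem
  · rw [(seg_word (isWord_toWord a) (by rw [length_toWord]; omega)).2, length_toWord, length_toWord]
  · intro t h1 h2
    rw [length_toWord] at h1
    subst hi hm
    simp only [seg, hU, ← toWord_longElement]
    simp only [List.getElem_append, List.length_take, length_toWord, List.getElem_take,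
      List.getElem_drop]
    simp only [toWord, List.getElem_ofFn, Crystal.commutorAction, Fin.le_def]
    rcases lt_or_ge t (p.1.1 : ℕ) with h | h
    · rw [dif_neg (by omega), dif_pos (by omega)]
    · by_cases h' : t ≤ (p.1.2 : ℕ)
      · rw [dif_pos ⟨h, h'⟩, dif_neg (by omega), dif_pos (by omega)]
        congr 2
        ext
        simp only
        omega
      · rw [dif_neg (by omega), dif_neg (by omega), dif_neg (by omega)]
        congr 2
        ext
        simp only
        omega

end CactusCrystal

namespace CactusCrystal

open StringData

/-! ### Actions of the cactus group and of the virtual cactus group -/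

theorem exists_restrict_hom {G X Y : Type*} [Group G] (ρ : G →* Equiv.Perm Y) (j : X → Y)
    (hj : Function.Injective j) (h : ∀ g x, ∃ x', j x' = ρ g (j x)) :
    ∃ α : G →* Equiv.Perm X, ∀ g x, j (α g x) = ρ g (j x) := by
  choose F hF using h
  refine ⟨{ toFun := fun g => ⟨F g, F g⁻¹, fun x => hj ?_, fun x => hj ?_⟩
            map_one' := Equiv.ext fun x => hj ?_
            map_mul' := fun g h => Equiv.ext fun x => hj ?_ }, hF⟩
  · rw [hF, hF, ← Equiv.Perm.mul_apply, ← map_mul]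
    simp
  · rw [hF, hF, ← Equiv.Perm.mul_apply, ← map_mul]
    simp
  · change j (F 1 x) = j x
    rw [hF]
    simp
  · change j (F (g * h) x) = j (F g (F h x))
    rw [hF, hF, hF, map_mul]
    rfl

theorem seg_comm {n i m i' m' : ℕ} {l : List ℕ} (hl : IsWord n l) (h : i + m ≤ i')
    (h' : i' + m' ≤ l.length) : seg n i m (seg n i' m' l) = seg n i' m' (seg n i m l) := by
  obtain ⟨A, U, V, hA, hU, rfl⟩ := exists_split (i := i) (m := m) (l := l) (by omega)
  rw [isWord_append_three] at hl
  have hlU := length_long hl.2.1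
  obtain ⟨B, U', W, hB, hU', rfl⟩ := exists_split (i := i' - (i + m)) (m := m') (l := V) (by
    simp at h'
    omega)
  have e1 : ∀ K : List ℕ, K.length = m → seg n i' m' (A ++ (K ++ (B ++ (U' ++ W)))) =
      A ++ (K ++ (B ++ (long n U' ++ W))) := by
    intro K hK
    have := seg_append (n := n) (i := i') (m := m') (A := A ++ (K ++ B)) (U := U') (V := W)
      (by simp; omega) hU'
    simpa using this
  rw [e1 U hU, seg_append hA hU, seg_append hA hU, e1 _ (by omega)]

theorem seg_inner {n k m : ℕ} {A U V : List ℕ} (h : k + m ≤ U.length) :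
    seg n (A.length + k) m (A ++ (U ++ V)) = A ++ (seg n k m U ++ V) := by
  obtain ⟨B, W, C, hB, hW, rfl⟩ := exists_split h
  rw [seg_append hB hW]
  have := seg_append (n := n) (i := A.length + k) (m := m) (A := A ++ B) (U := W) (V := C ++ V)
      (by simp; omega) hW
  simpa using this

/-- The relation `long_seg` inside a context. The reversal of `[i, i + m - 1]` sends the last
position `k + m' - 1` of the inner interval to `2 * i + m - k - m'`, the start of the image. -/
theorem seg_nested {n i m k m' : ℕ} {l : List ℕ} (hl : IsWord n l) (h : i + m ≤ l.length)
    (hk : i ≤ k) (hk' : k + m' ≤ i + m) :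
    seg n i m (seg n k m' l) = seg n (2 * i + m - k - m') m' (seg n i m l) := by
  obtain ⟨A, U, V, hA, hU, rfl⟩ := exists_split h
  rw [isWord_append_three] at hl
  obtain ⟨d, rfl⟩ := Nat.exists_eq_add_of_le hk
  have hlU := length_long hl.2.1
  have hs := seg_word (i := d) (m := m') hl.2.1 (by omega)
  rw [← hA, seg_inner (by omega), hA, seg_append hA (by omega), seg_append hA hU,
    long_seg hl.2.1 (by omega), show 2 * i + m - (i + d) - m' = A.length + (m - d - m') by omega,
    seg_inner (by omega), hU]

/-- Maps of a set of words which are given by acting on factors define an action of the cactus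
group. -/
theorem exists_cactus_hom {r n : ℕ} {X : Type*} {g : X → List ℕ} (hg : Function.Injective g)
    (hw : ∀ x, IsWord r (g x)) (hlen : ∀ x, (g x).length = n) (op : PosPair n → X → X)
    (hop : ∀ p x, g (op p x) = seg r p.1.1 ((p.1.2 : ℕ) - (p.1.1 : ℕ) + 1) (g x)) :
    ∃ ρ : Cactus n →* Equiv.Perm X, ∀ p x, ρ (Cactus.s p) x = op p x := by
  have hinv : ∀ p, Function.Involutive (op p) := by
    intro p x
    have h1 := p.1.2.isLt
    have h2 : (p.1.1 : ℕ) < p.1.2 := p.2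
    apply hg
    rw [hop, hop, seg_seg (hw x) (by rw [hlen]; omega)]
  have hrel : ∀ x ∈ {x | CactusRel n x},
      FreeGroup.lift (fun p => (hinv p).toPerm) x = 1 := by
    rintro x (⟨p⟩ | ⟨p, q, h⟩ | ⟨p, q, s, h, h1, h2⟩)
    · ext x
      simp [hinv p x]
    · rw [map_mul, map_inv, mul_inv_eq_one]
      ext x
      simp only [map_mul, FreeGroup.lift_apply_of, Equiv.Perm.mul_apply,
        Function.Involutive.coe_toPerm]
      apply hg
      have hp1 := p.1.2.isLt
      have hp2 : (p.1.1 : ℕ) < p.1.2 := p.2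
      have hq1 := q.1.2.isLt
      have hq2 : (q.1.1 : ℕ) < q.1.2 := q.2
      rw [hop, hop, hop, hop]
      have hcase : (p.1.2 : ℕ) < q.1.1 ∨ (q.1.2 : ℕ) < p.1.1 := by
        by_contra! hc
        rcases le_total p.1.1 q.1.1 with hle | hle
        · refine Set.disjoint_left.1 h (show q.1.1 ∈ Set.Icc p.1.1 p.1.2 from ⟨hle, hc.1⟩)
            ⟨le_rfl, q.2.le⟩
        · refine Set.disjoint_left.1 h (show p.1.1 ∈ Set.Icc p.1.1 p.1.2 from ⟨le_rfl, p.2.le⟩)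
            ⟨hle, hc.2⟩
      rcases hcase with hc | hc
      · exact seg_comm (hw x) (by omega) (by rw [hlen]; omega)
      · exact (seg_comm (hw x) (by omega) (by rw [hlen]; omega)).symm
    · rw [map_mul, map_inv, mul_inv_eq_one]
      ext x
      simp only [map_mul, FreeGroup.lift_apply_of, Equiv.Perm.mul_apply,
        Function.Involutive.coe_toPerm]
      apply hg
      have hp1 := p.1.2.isLt
      have hp2 : (p.1.1 : ℕ) < p.1.2 := p.2
      have hq2 : (q.1.1 : ℕ) < q.1.2 := q.2
      have hq3 : p.1.1 ≤ q.1.1 ∧ q.1.1 ≤ p.1.2 := h ⟨le_rfl, q.2.le⟩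
      have hq4 : p.1.1 ≤ q.1.2 ∧ q.1.2 ≤ p.1.2 := h ⟨q.2.le, le_rfl⟩
      have e1 : (s.1.1 : ℕ) = p.1.1 + p.1.2 - q.1.2 := by
        rw [h1]
        change ((reverseFun p q.1.2 : Fin n) : ℕ) = _
        rw [reverseFun, dif_pos hq4]
      have e2 : (s.1.2 : ℕ) = p.1.1 + p.1.2 - q.1.1 := by
        rw [h2]
        change ((reverseFun p q.1.1 : Fin n) : ℕ) = _
        rw [reverseFun, dif_pos hq3]
      simp only [Fin.le_def] at hq3 hq4
      rw [hop, hop, hop, hop, seg_nested (hw x) (by rw [hlen]; omega) hq3.1 (by omega)]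
      congr 1 <;> omega
  refine ⟨PresentedGroup.toGroup hrel, fun p x => ?_⟩
  rw [Cactus.s, PresentedGroup.toGroup.of]
  rfl

theorem cactus_hom_ext {n : ℕ} {G : Type*} [Group G] {ρ ρ' : Cactus n →* G}
    (h : ∀ p, ρ (Cactus.s p) = ρ' (Cactus.s p)) : ρ = ρ' := PresentedGroup.ext h

theorem virtualCactus_hom_ext {n : ℕ} {G : Type*} [Group G] {ρ ρ' : VirtualCactus n →* G}
    (h : ∀ p, ρ (VirtualCactus.ofCactus n (Cactus.s p)) =
      ρ' (VirtualCactus.ofCactus n (Cactus.s p)))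
    (h' : ∀ w, ρ (VirtualCactus.ofPerm n w) = ρ' (VirtualCactus.ofPerm n w)) : ρ = ρ' := by
  apply QuotientGroup.monoidHom_ext
  apply Monoid.Coprod.hom_ext
  · exact cactus_hom_ext h
  · ext w
    exact h' w

theorem virtualCactus_induction {n : ℕ} {P : VirtualCactus n → Prop}
    (hs : ∀ p, P (VirtualCactus.ofCactus n (Cactus.s p)))
    (hw : ∀ w, P (VirtualCactus.ofPerm n w)) (hmul : ∀ x y, P x → P y → P (x * y))
    (hinv : ∀ x, P x → P x⁻¹) (g : VirtualCactus n) : P g := by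
  have h1 : ∀ x : FreeGroup (PosPair n),
      P (VirtualCactus.ofCactus n (PresentedGroup.mk _ x)) := by
    intro x
    induction x using FreeGroup.induction_on with
    | C1 =>
      rw [map_one, map_one, ← map_one (VirtualCactus.ofPerm n)]
      exact hw 1
    | of p => exact hs p
    | inv_of p h =>
      rw [map_inv, map_inv]
      exact hinv _ h
    | mul x y hx hy =>
      rw [map_mul, map_mul]
      exact hmul _ _ hx hy
  obtain ⟨x, rfl⟩ := QuotientGroup.mk'_surjective _ g
  induction x using Monoid.Coprod.induction_on with
  | inl c =>
    obtain ⟨x, rfl⟩ := PresentedGroup.mk_surjective _ c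
    exact h1 x
  | inr w => exact hw w
  | mul x y hx hy =>
    rw [map_mul]
    exact hmul _ _ hx hy

theorem longElement_congr {n m m' : ℕ} {X : Type} (c : Crystal n X) (hm : m = m')
    {a : Fin m → X} {a' : Fin m' → X} (ha : ∀ s h h', a ⟨s, h⟩ = a' ⟨s, h'⟩) {s s' : ℕ}
    (hs : s = s') (h : s < m) (h' : s' < m') :
    c.longElement m a ⟨s, h⟩ = c.longElement m' a' ⟨s', h'⟩ := by
  subst hm hs
  rw [show a = a' from funext fun t => ha t t.2 t.2]

/-- A translation carries one interval onto the other in order, so the long element receives the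
same word on both sides. Outside, letters are only transported. -/
theorem commutorAction_perm {n k : ℕ} {X : Type} (c : Crystal n X) {w : Equiv.Perm (Fin k)}
    {p q : PosPair k} (h : IsTranslationOn w p) (h1 : q.1.1 = w p.1.1) (h2 : q.1.2 = w p.1.2)
    {a b : Fin k → X} (hab : ∀ t, b (w t) = a t) (t : Fin k) :
    c.commutorAction q b (w t) = c.commutorAction p a t := by
  have hp : (p.1.1 : ℕ) < p.1.2 := p.2
  have hp2 := p.1.2.isLt
  have e0 := h p.1.2 p.2.le le_rfl
  rw [← h1, ← h2] at e0
  have key : (q.1.1 ≤ w t ∧ w t ≤ q.1.2) ↔ (p.1.1 ≤ t ∧ t ≤ p.1.2) := by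
    constructor
    · rintro ⟨h3, h4⟩
      rw [Fin.le_def] at h3 h4
      -- The position in the interval of `p` with the same offset is also mapped to `w t`; by
      -- injectivity it is `t`.
      have e1 := h ⟨p.1.1 + ((w t : ℕ) - q.1.1), by omega⟩ (by rw [Fin.le_def]; simp)
        (by rw [Fin.le_def]; simp only; omega)
      have e2 : w ⟨p.1.1 + ((w t : ℕ) - q.1.1), by omega⟩ = w t := by
        ext
        rw [e1, ← h1]
        simp only
        omega
      rw [← w.injective e2]
      simp only [Fin.le_def]
      omega
    · rintro ⟨h3, h4⟩
      have e1 := h t h3 h4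
      rw [Fin.le_def] at h3 h4
      rw [← h1] at e1
      simp only [Fin.le_def]
      omega
  by_cases hc : p.1.1 ≤ t ∧ t ≤ p.1.2
  · rw [Crystal.commutorAction, dif_pos (key.2 hc), Crystal.commutorAction, dif_pos hc]
    have e1 := h t hc.1 hc.2
    rw [← h1] at e1
    apply longElement_congr
    · omega
    · intro s h3 h4
      have e2 := h ⟨p.1.1 + s, by omega⟩ (by rw [Fin.le_def]; simp)
        (by rw [Fin.le_def]; simp only; omega)
      rw [← hab]
      congr 1
      ext
      rw [e2, ← h1]
      simp only
      omega
    · omega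
  · rw [Crystal.commutorAction, dif_neg (mt key.1 hc), Crystal.commutorAction, dif_neg hc, hab]

/-- The permutation action on words. -/
def permuteFactors (n : ℕ) (X : Type*) : Equiv.Perm (Fin n) →* Equiv.Perm (Fin n → X) where
  toFun w := Equiv.arrowCongr w (Equiv.refl X)
  map_one' := rfl
  map_mul' _ _ := rfl

theorem permuteFactors_apply {n : ℕ} {X : Type*} (w : Equiv.Perm (Fin n)) (a : Fin n → X)
    (k : Fin n) : permuteFactors n X w a (w k) = a k := by
  change a (w.symm (w k)) = a k
  rw [w.symm_apply_apply]

theorem existsUnique_crystalAction (n : ℕ) :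
    ∃! act : VirtualCactus n →* Equiv.Perm (Fin n → Fin n), IsCrystalAction n act := by
  obtain ⟨ρ, hρ⟩ := exists_cactus_hom (r := n) (n := n) toWord_injective isWord_toWord length_toWord
    (Crystal.vector n).commutorAction toWord_commutorAction
  have hker : Subgroup.normalClosure {x | VirtualRel n x} ≤
      (Monoid.Coprod.lift ρ (permuteFactors n (Fin n))).ker := by
    apply Subgroup.normalClosure_le_normal
    rintro x ⟨w, p, q, h, h1, h2⟩
    simp only [SetLike.mem_coe, MonoidHom.mem_ker, map_mul, map_inv, Monoid.Coprod.lift_apply_inl,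
      Monoid.Coprod.lift_apply_inr]
    rw [mul_inv_eq_one, mul_inv_eq_iff_eq_mul]
    ext a k : 2
    obtain ⟨t, rfl⟩ := w.surjective k
    rw [Equiv.Perm.mul_apply, Equiv.Perm.mul_apply, hρ, hρ, permuteFactors_apply,
      commutorAction_perm _ h h1 h2 (permuteFactors_apply w a)]
  refine ⟨QuotientGroup.lift _ _ hker, ⟨fun w a k => ?_, fun p a => ?_⟩, fun act hact => ?_⟩
  · change Monoid.Coprod.lift ρ (permuteFactors n (Fin n)) (Monoid.Coprod.inr w) a (w k) = a k
    rw [Monoid.Coprod.lift_apply_inr, permuteFactors_apply]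
  · change Monoid.Coprod.lift ρ (permuteFactors n (Fin n)) (Monoid.Coprod.inl (Cactus.s p)) a = _
    rw [Monoid.Coprod.lift_apply_inl, hρ]
  · apply virtualCactus_hom_ext
    · intro p
      ext a : 1
      rw [hact.cactus]
      change _ = Monoid.Coprod.lift ρ (permuteFactors n (Fin n))
        (Monoid.Coprod.inl (Cactus.s p)) a
      rw [Monoid.Coprod.lift_apply_inl, hρ]
    · intro w
      ext a k : 2
      obtain ⟨t, rfl⟩ := w.surjective k
      rw [hact.perm]
      change _ = Monoid.Coprod.lift ρ (permuteFactors n (Fin n)) (Monoid.Coprod.inr w) a (w t)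
      rw [Monoid.Coprod.lift_apply_inr, permuteFactors_apply]

theorem wt_act {n : ℕ} {act : VirtualCactus n →* Equiv.Perm (Fin n → Fin n)}
    (h : IsCrystalAction n act) (g : VirtualCactus n) : ∀ a,
      ((Crystal.vector n).power n).wt (act g a) = ((Crystal.vector n).power n).wt a := by
  induction g using virtualCactus_induction with
  | hs p =>
    intro a
    have hp : (p.1.1 : ℕ) < p.1.2 := p.2
    have hp2 := p.1.2.isLt
    rw [(isWordModel_power n n).wt, (isWordModel_power n n).wt, h.cactus, toWord_commutorAction]
    congr 1
    funext r
    rw [count_seg (isWord_toWord a) (by rw [length_toWord]; omega) r.2]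
  | hw w =>
    intro a
    rw [(isWordModel_power n n).wt, (isWordModel_power n n).wt]
    congr 1
    funext r
    have h1 : a = act (VirtualCactus.ofPerm n w) a ∘ w := by
      funext k
      exact (h.perm w a k).symm
    have h2 : (toWord a).Perm (toWord (act (VirtualCactus.ofPerm n w) a)) := by
      conv_lhs => rw [h1]
      exact Equiv.Perm.ofFn_comp_perm w
        (fun j => ((act (VirtualCactus.ofPerm n w) a j : Fin n) : ℕ))
    rw [h2.count_eq]
  | hmul x y hx hy =>
    intro a
    rw [map_mul, Equiv.Perm.mul_apply, hx, hy]
  | hinv x hx =>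
    intro a
    rw [← hx, ← Equiv.Perm.mul_apply, ← map_mul, mul_inv_cancel, map_one, Equiv.Perm.one_apply]

theorem permWord_injective {n : ℕ} : Function.Injective (permWord (n := n)) := by
  intro w w' h
  have : w⁻¹ = w'⁻¹ := Equiv.ext fun k => congrFun h k
  exact inv_injective this

theorem bijOn_permWord (n : ℕ) : Set.BijOn (permWord (n := n)) Set.univ
    {a | ((Crystal.vector n).power n).wt a = toWeight n (fun _ => 1)} := by
  refine ⟨?_, permWord_injective.injOn, ?_⟩
  · intro w _
    rw [Set.mem_ofPred_eq, (isWordModel_power n n).wt]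
    congr 1
    funext r
    have h1 : (toWord (permWord w)).Nodup := by
      rw [toWord, List.nodup_ofFn]
      intro j k h
      exact w⁻¹.injective (Fin.ext h)
    have h2 : (r : ℕ) ∈ toWord (permWord w) := by
      rw [toWord, List.mem_ofFn]
      exact ⟨w r, by simp [permWord]⟩
    rw [List.count_eq_one_of_mem h1 h2, Nat.cast_one]
  · intro a ha
    rw [Set.mem_ofPred_eq, (isWordModel_power n n).wt] at ha
    have h1 := QuotientAddGroup.eq.1 ha
    obtain ⟨m, hm⟩ := AddSubgroup.mem_zmultiples_iff.1 h1
    -- Weights are defined modulo `(1, …, 1)`, so the hypothesis says only that all letters occur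
    -- equally often. Since some letter occurs, all of them do, and a surjective word of length `n`
    -- is a permutation.
    have h2 : ∀ r s : Fin n, (toWord a).count (r : ℕ) = (toWord a).count (s : ℕ) := by
      intro r s
      have e1 := congrFun hm r
      have e2 := congrFun hm s
      simp at e1 e2
      omega
    have h3 : Function.Surjective a := by
      intro r
      have h4 : 0 < (toWord a).count ((a r : Fin n) : ℕ) := by
        rw [List.count_pos_iff, toWord, List.mem_ofFn]
        exact ⟨r, rfl⟩
      rw [h2 _ r, List.count_pos_iff, toWord, List.mem_ofFn] at h4
      obtain ⟨k, hk⟩ := h4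
      exact ⟨k, Fin.ext hk⟩
    have h4 : Function.Bijective a := Finite.surjective_iff_bijective.1 h3
    refine ⟨(Equiv.ofBijective a h4)⁻¹, Set.mem_univ _, ?_⟩
    funext k
    simp [permWord]

end CactusCrystal

/-! ### Standard tableaux as lowest words; the Berenstein–Kirillov action -/

namespace CactusCrystal

open StringData

/-! ### Standard tableaux as words of lowest weight -/

open Classical in
/-- The cell of the tableau which contains the entry `v`. -/
noncomputable def cellOf {μ : YoungDiagram} (T : StdTableau μ) (v : ℕ) : ℕ × ℕ :=
  if h : ∃ c ∈ μ, T.1 c.1 c.2 = v then h.choose else (0, 0)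

theorem cellOf_eq {μ : YoungDiagram} (T : StdTableau μ) {c : ℕ × ℕ} (hc : c ∈ μ) :
    cellOf T (T.1 c.1 c.2) = c := by
  have h : ∃ c' ∈ μ, T.1 c'.1 c'.2 = T.1 c.1 c.2 := ⟨c, hc, rfl⟩
  rw [cellOf, dif_pos h]
  exact T.2.injOn h.choose_spec.1 hc h.choose_spec.2

theorem cellOf_spec {μ : YoungDiagram} (T : StdTableau μ) {v : ℕ} (h1 : 1 ≤ v) (h2 : v ≤ μ.card) :
    cellOf T v ∈ μ ∧ T.1 (cellOf T v).1 (cellOf T v).2 = v := by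
  obtain ⟨c, hc, hv⟩ := T.2.surjOn ⟨h1, h2⟩
  dsimp only at hv
  rw [← hv, cellOf_eq T hc]
  exact ⟨hc, rfl⟩

theorem StdTableau.entry_mem {μ : YoungDiagram} (T : StdTableau μ) {r c : ℕ} (h : (r, c) ∈ μ) :
    1 ≤ T.1 r c ∧ T.1 r c ≤ μ.card :=
  T.2.mapsTo (x := (r, c)) h

theorem StdTableau.row_lt {μ : YoungDiagram} (T : StdTableau μ) {r c c' : ℕ} (h : c < c')
    (h' : (r, c') ∈ μ) : T.1 r c < T.1 r c' := by
  refine lt_of_le_of_ne (T.1.row_weak h h') fun he => ?_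
  have := T.2.injOn (x₁ := (r, c)) (x₂ := (r, c')) (μ.up_left_mem le_rfl h.le h') h' he
  simp only [Prod.mk.injEq, true_and] at this
  omega

/-- It bounds row indices by `n`, so that the subtraction in the letter `n - 1 - r` is not truncated
and distinct rows give distinct letters. -/
theorem StdTableau.lt_entry {μ : YoungDiagram} (T : StdTableau μ) :
    ∀ {r c : ℕ}, (r, c) ∈ μ → r < T.1 r c
  | 0, c, h => (T.entry_mem h).1
  | r + 1, c, h => by
    have h1 := StdTableau.lt_entry T (μ.up_left_mem (Nat.le_succ r) le_rfl h)
    have h2 := T.1.col_strict (Nat.lt_add_one r) h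
    omega

/-- The word of lowest weight which records, for each entry of a standard tableau, its row. -/
noncomputable def tabWord (n : ℕ) {μ : YoungDiagram} (T : StdTableau μ) : List ℕ :=
  List.ofFn fun p : Fin n => n - 1 - (cellOf T (p + 1)).1

theorem length_tabWord (n : ℕ) {μ : YoungDiagram} (T : StdTableau μ) :
    (tabWord n T).length = n := by
  simp [tabWord]

section

variable {n : ℕ} {μ : YoungDiagram}

theorem row_lt_card (hμ : μ.card = n) (T : StdTableau μ) {r c : ℕ} (h : (r, c) ∈ μ) : r < n := by
  have h1 := T.lt_entry h
  have h2 := (T.entry_mem h).2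
  omega

theorem exists_cell (hμ : μ.card = n) (T : StdTableau μ) {p : ℕ} (hp : p < n) :
    ∃ r c, (r, c) ∈ μ ∧ T.1 r c = p + 1 ∧ r < n ∧
      (tabWord n T).take (p + 1) = (tabWord n T).take p ++ [n - 1 - r] := by
  obtain ⟨h1, h2⟩ := cellOf_spec T (v := p + 1) (by omega) (by omega)
  refine ⟨(cellOf T (p + 1)).1, (cellOf T (p + 1)).2, h1, h2, row_lt_card hμ T h1, ?_⟩
  rw [List.take_succ_eq_append_getElem (by rw [length_tabWord]; exact hp)]
  simp only [tabWord, List.getElem_ofFn]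

theorem isWord_tabWord (n : ℕ) (T : StdTableau μ) : IsWord n (tabWord n T) := by
  intro x hx
  rw [tabWord, List.mem_ofFn] at hx
  obtain ⟨p, rfl⟩ := hx
  have := p.2
  omega

theorem entry_eq_iff (T : StdTableau μ) {r c r' c' : ℕ} (h : (r, c) ∈ μ) (h' : (r', c') ∈ μ) :
    T.1 r c = T.1 r' c' ↔ r = r' ∧ c = c' := by
  constructor
  · intro he
    have := T.2.injOn (x₁ := (r, c)) (x₂ := (r', c')) h h' he
    simpa using this
  · rintro ⟨rfl, rfl⟩
    rfl

/-- The entries up to `k` in row `r` fill an initial segment of that row, whose length is the number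
of letters `n - 1 - r` among the first `k`. In this form the word determines both the shape and the
entries. -/
theorem lt_count_tabWord_iff (hμ : μ.card = n) (T : StdTableau μ) : ∀ k ≤ n, ∀ r < n, ∀ c,
    c < ((tabWord n T).take k).count (n - 1 - r) ↔ (r, c) ∈ μ ∧ T.1 r c ≤ k
  | 0, _, r, _, c => by
    simp only [List.take_zero, List.count_nil, Nat.not_lt_zero, false_iff, not_and]
    intro h
    have := (T.entry_mem h).1
    omega
  | k + 1, hk, r, hr, c => by
    obtain ⟨r0, c0, h1, h2, h3, h4⟩ := exists_cell hμ T (p := k) (by omega)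
    have ih := lt_count_tabWord_iff hμ T k (by omega) r hr
    rw [h4, List.count_append, List.count_singleton]
    by_cases hrr : r = r0
    · subst hrr
      -- The entry `k + 1` stands in the first free column of its row.
      have hc0 : c0 = ((tabWord n T).take k).count (n - 1 - r) := by
        apply le_antisymm
        · by_contra! hlt
          have h5 := μ.up_left_mem le_rfl hlt.le h1
          have h6 := T.row_lt hlt h1
          exact absurd ((ih _).2 ⟨h5, by omega⟩) (lt_irrefl _)
        · by_contra! hlt
          have := ((ih _).1 hlt).2
          omega
      rw [if_pos (by simp), ← hc0]
      constructor
      · intro h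
        have h5 := μ.up_left_mem le_rfl (show c ≤ c0 by omega) h1
        refine ⟨h5, ?_⟩
        rcases (show c ≤ c0 by omega).eq_or_lt with rfl | hlt
        · omega
        · have := T.row_lt hlt h1
          omega
      · rintro ⟨h5, h6⟩
        by_contra! h7
        have := T.row_lt (show c0 < c by omega) h5
        omega
    · rw [if_neg (by simp; omega), Nat.add_zero, ih]
      refine and_congr_right fun h5 => ⟨fun h => by omega, fun h => ?_⟩
      by_contra! h6
      exact hrr ((entry_eq_iff T h5 h1).1 (by omega)).1

/-- Column strictness is the lattice condition: when an entry is placed in row `r + 1`, the cell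
above is already filled and its own cell is not. -/
theorem lowest_tabWord_take (hμ : μ.card = n) (T : StdTableau μ) : ∀ k ≤ n,
    Lowest n ((tabWord n T).take k)
  | 0, _ => fun i _ => by simp
  | k + 1, hk => by
    obtain ⟨r, c, h1, h2, h3, h4⟩ := exists_cell hμ T (p := k) (by omega)
    have key := lt_count_tabWord_iff hμ T k (by omega)
    rw [h4, lowest_snoc]
    refine ⟨lowest_tabWord_take hμ T k (by omega), fun h => ?_⟩
    obtain ⟨r, rfl⟩ : ∃ r', r = r' + 1 := ⟨r - 1, by omega⟩
    have h5 := T.1.col_strict (Nat.lt_add_one r) h1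
    have h6 := (key r (by omega) c).2 ⟨μ.up_left_mem (Nat.le_succ r) le_rfl h1, by omega⟩
    have h7 := mt (key (r + 1) h3 c).1 (by omega)
    rw [show n - 1 - (r + 1) + 1 = n - 1 - r by omega]
    omega

theorem entry_eq_of_tabWord_eq {ν : YoungDiagram} (hμ : μ.card = n) (hν : ν.card = n)
    {T : StdTableau μ} {S : StdTableau ν} (h : tabWord n T = tabWord n S) (r c : ℕ) :
    T.1 r c = S.1 r c := by
  have key : ∀ r < n, ∀ k ≤ n, ((r, c) ∈ μ ∧ T.1 r c ≤ k) ↔ (r, c) ∈ ν ∧ S.1 r c ≤ k := by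
    intro r hr k hk
    rw [← lt_count_tabWord_iff hμ T k hk r hr c, ← lt_count_tabWord_iff hν S k hk r hr c, h]
  by_cases hc : (r, c) ∈ μ
  · have hr := row_lt_card hμ T hc
    have h1 := (T.entry_mem hc).2
    have h2 := (key r hr _ (by omega)).1 ⟨hc, le_rfl⟩
    have h3 := (S.entry_mem h2.1).2
    exact le_antisymm ((key r hr _ (by omega)).2 ⟨h2.1, le_rfl⟩).2 h2.2
  · rw [T.1.zeros hc]
    by_cases hc' : (r, c) ∈ ν
    · have h3 := (S.entry_mem hc').2
      exact absurd ((key r (row_lt_card hν S hc') _ (by omega)).2 ⟨hc', le_rfl⟩).1 hc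
    · rw [S.1.zeros hc']

theorem tabWord_injective (hμ : μ.card = n) : Function.Injective (tabWord n (μ := μ)) :=
  fun _ _ h => Subtype.ext (SemistandardYoungTableau.ext (entry_eq_of_tabWord_eq hμ hμ h))

/-! ### Bender–Knuth involutions -/

theorem swap_lt_swap {i a b : ℕ} (h : a < b) (h' : ¬ (a = i ∧ b = i + 1)) :
    Equiv.swap i (i + 1) a < Equiv.swap i (i + 1) b := by
  simp only [Equiv.swap_apply_def]
  split_ifs <;> omega

/-- Exchanging consecutive entries reverses only the inequality between these two, which matters
only when they share a row or a column. -/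
theorem exists_swapped (T : StdTableau μ) {i r c r' c' : ℕ} (hc : (r, c) ∈ μ) (hc' : (r', c') ∈ μ)
    (h : T.1 r c = i) (h' : T.1 r' c' = i + 1) (hr : r ≠ r') (hcc : c ≠ c') :
    ∃ T' : StdTableau μ, ∀ r c, T'.1 r c = Equiv.swap i (i + 1) (T.1 r c) := by
  have hi := (T.entry_mem hc).1
  have hi' := (T.entry_mem hc').2
  have hsw : ∀ v, 1 ≤ v ∧ v ≤ μ.card → 1 ≤ Equiv.swap i (i + 1) v ∧
      Equiv.swap i (i + 1) v ≤ μ.card := by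
    intro v hv
    simp only [Equiv.swap_apply_def]
    split_ifs <;> omega
  refine ⟨⟨⟨fun r c => Equiv.swap i (i + 1) (T.1 r c), ?_, ?_, ?_⟩, ?_, ?_, ?_⟩, fun _ _ => rfl⟩
  · intro x j1 j2 hj hx
    refine (swap_lt_swap (T.row_lt hj hx) ?_).le
    rintro ⟨h1, h2⟩
    rw [← h] at h1
    rw [← h'] at h2
    rw [entry_eq_iff T (μ.up_left_mem le_rfl hj.le hx) hc] at h1
    rw [entry_eq_iff T hx hc'] at h2
    omega
  · intro x1 x2 j hx hj
    refine swap_lt_swap (T.1.col_strict hx hj) ?_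
    rintro ⟨h1, h2⟩
    rw [← h] at h1
    rw [← h'] at h2
    rw [entry_eq_iff T (μ.up_left_mem hx.le le_rfl hj) hc] at h1
    rw [entry_eq_iff T hj hc'] at h2
    omega
  · intro x j hx
    rw [T.1.zeros hx, Equiv.swap_apply_of_ne_of_ne (by omega) (by omega)]
  · intro x hx
    exact hsw _ (T.2.mapsTo hx)
  · intro x hx y hy he
    exact T.2.injOn hx hy ((Equiv.swap i (i + 1)).injective he)
  · intro v hv
    obtain ⟨x, hx, hxv⟩ := T.2.surjOn (hsw v hv)
    refine ⟨x, hx, ?_⟩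
    change Equiv.swap i (i + 1) (T.1 x.1 x.2) = v
    rw [show T.1 x.1 x.2 = _ from hxv, Equiv.swap_apply_self]

theorem cellOf_swapped {T T' : StdTableau μ} {i : ℕ}
    (h : ∀ r c, T'.1 r c = Equiv.swap i (i + 1) (T.1 r c)) {v : ℕ} (h1 : 1 ≤ v)
    (h2 : v ≤ μ.card) : cellOf T' (Equiv.swap i (i + 1) v) = cellOf T v := by
  obtain ⟨h3, h4⟩ := cellOf_spec T h1 h2
  have := cellOf_eq T' h3
  rwa [h, h4] at this

theorem tabWord_split (hm : m + 2 ≤ n) (T : StdTableau μ) : tabWord n T =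
    (tabWord n T).take m ++ [n - 1 - (cellOf T (m + 1)).1, n - 1 - (cellOf T (m + 2)).1] ++
      (tabWord n T).drop (m + 2) := by
  conv_lhs => rw [← List.take_append_drop (m + 2) (tabWord n T)]
  rw [List.take_succ_eq_append_getElem (by rw [length_tabWord]; omega),
    List.take_succ_eq_append_getElem (by rw [length_tabWord]; omega)]
  simp [tabWord]

/-- The exchanged tableau is standard exactly when the word with its two letters exchanged is a
different lowest word, and `bkOp` makes the exchange precisely then. -/
theorem tabWord_benderKnuth (hμ : μ.card = n) {m : ℕ} (hm : m + 2 ≤ n) (T : StdTableau μ) :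
    tabWord n (benderKnuth (m + 1) T) = bkOp n m (tabWord n T) := by
  obtain ⟨h1, h2⟩ := cellOf_spec T (v := m + 1) (by omega) (by omega)
  obtain ⟨h3, h4⟩ := cellOf_spec T (v := m + 2) (by omega) (by omega)
  have hsplit := tabWord_split (m := m) hm T
  obtain ⟨r, hr⟩ : ∃ r, r = (cellOf T (m + 1)).1 := ⟨_, rfl⟩
  obtain ⟨c, hc⟩ : ∃ c, c = (cellOf T (m + 1)).2 := ⟨_, rfl⟩
  obtain ⟨r', hr'⟩ : ∃ r, r = (cellOf T (m + 2)).1 := ⟨_, rfl⟩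
  obtain ⟨c', hc'⟩ : ∃ c, c = (cellOf T (m + 2)).2 := ⟨_, rfl⟩
  have hcell : cellOf T (m + 1) = (r, c) := by rw [hr, hc]
  have hcell' : cellOf T (m + 2) = (r', c') := by rw [hr', hc']
  rw [hcell] at h1 h2
  rw [hcell'] at h3 h4
  rw [hcell, hcell'] at hsplit
  dsimp only at h2 h4 hsplit
  have hrn := row_lt_card hμ T h1
  have hrn' := row_lt_card hμ T h3
  obtain ⟨d, hd⟩ : ∃ d, d = (tabWord n T).take m := ⟨_, rfl⟩
  have hdl : d.length = m := by
    rw [hd, List.length_take, length_tabWord]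
    omega
  rw [← hd] at hsplit
  have htake : (tabWord n T).take (m + 2) = d ++ [n - 1 - r, n - 1 - r'] := by
    rw [hsplit, List.take_left' (by simp [hdl])]
  have hw : IsWord n (d ++ [n - 1 - r, n - 1 - r']) := by
    rw [← htake]
    exact (isWord_tabWord n T).take _
  have hl : Lowest n (d ++ [n - 1 - r, n - 1 - r']) := by
    rw [← htake]
    exact lowest_tabWord_take hμ T _ hm
  have hbk := bkOp_eq hdl hw hl
  have hbk' : bkOp n m (tabWord n T) = bkOp n m (d ++ [n - 1 - r, n - 1 - r']) ++
      (tabWord n T).drop (m + 2) := by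
    conv_lhs => rw [hsplit]
    exact bkOp_append hw (by simp [hdl])
  have hswap : ∀ T' : StdTableau μ, (∀ r c, T'.1 r c = Equiv.swap (m + 1) (m + 2) (T.1 r c)) →
      tabWord n T' = d ++ [n - 1 - r', n - 1 - r] ++ (tabWord n T).drop (m + 2) := by
    intro T' hT'
    have e1 := cellOf_swapped hT' (v := m + 2) (by omega) (by omega)
    have e2 := cellOf_swapped hT' (v := m + 1) (by omega) (by omega)
    rw [Equiv.swap_apply_right] at e1
    rw [Equiv.swap_apply_left] at e2
    have e3 : ∀ p : ℕ, p < n → p ≠ m → p ≠ m + 1 → cellOf T' (p + 1) = cellOf T (p + 1) := by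
      intro p hp h5 h6
      have e4 := cellOf_swapped hT' (v := p + 1) (by omega) (by omega)
      rwa [Equiv.swap_apply_of_ne_of_ne (by omega) (by omega)] at e4
    rw [tabWord_split (m := m) hm T', e1, e2, hcell, hcell', hd]
    congr 1
    · congr 1
      apply List.ext_getElem
      · simp [length_tabWord]
      · intro p h5 h6
        simp only [List.length_take, length_tabWord] at h5
        simp only [List.getElem_take, tabWord, List.getElem_ofFn]
        rw [e3 p (by omega) (by omega) (by omega)]
    · apply List.ext_getElem
      · simp [length_tabWord]
      · intro p h5 h6
        simp only [List.length_drop, length_tabWord] at h5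
        simp only [List.getElem_drop, tabWord, List.getElem_ofFn]
        rw [e3 _ (by omega) (by omega) (by omega)]
  have key := lt_count_tabWord_iff hμ T m (by omega)
  rw [← hd] at key
  have hcr := mt (key r hrn c).1 (by omega)
  have hcr' := mt (key r' hrn' c').1 (by omega)
  rw [hbk']
  by_cases hex : ∃ T' : StdTableau μ, ∀ r c, T'.1 r c = Equiv.swap (m + 1) (m + 2) (T.1 r c)
  · have hT' := hex.choose_spec
    have e1 : tabWord n (benderKnuth (m + 1) T) =
        d ++ [n - 1 - r', n - 1 - r] ++ (tabWord n T).drop (m + 2) := by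
      rw [benderKnuth, dif_pos hex]
      exact hswap _ hT'
    -- Entries in one row have equal letters, so the exchanged tableau would have the same word as
    -- `T` and would equal it.
    have hne : r ≠ r' := by
      intro he
      rw [he] at hsplit e1
      rw [← hsplit] at e1
      have e2 := tabWord_injective hμ e1
      rw [benderKnuth, dif_pos hex] at e2
      have e3 := hT' r c
      rw [e2, h2, Equiv.swap_apply_left] at e3
      omega
    have hlow : Lowest n (d ++ [n - 1 - r', n - 1 - r]) := by
      have := lowest_tabWord_take hμ (benderKnuth (m + 1) T) (m + 2) hm
      rwa [e1, List.take_left' (by simp [hdl])] at this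
    rw [e1, hbk.1 (by omega) hlow]
  · have e1 : benderKnuth (m + 1) T = T := by
      rw [benderKnuth, dif_neg hex]
    rw [e1, hbk.2, ← hsplit]
    rintro ⟨hne, hlow⟩
    apply hex
    refine exists_swapped T h1 h3 h2 h4 (by rintro rfl; exact hne rfl) ?_
    -- Suppose both entries lie in column `c`, with `m + 2` in row `s + 1`. The lattice condition
    -- for the exchanged word forces an entry at most `m` in the cell `(s, c)`, which lies weakly
    -- below the cell of `m + 1`.
    rintro rfl
    have h5 := lowest_snoc.1 (Lowest.of_append (A := d ++ [n - 1 - r']) (B := [n - 1 - r])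
      (by simpa using hlow))
    have hlt : r < r' := by
      by_contra! hle
      rcases hle.eq_or_lt with rfl | hlt
      · exact hne rfl
      · have := T.1.col_strict hlt h1
        omega
    have h6 := h5.2 (by omega)
    obtain ⟨s, rfl⟩ : ∃ s, r' = s + 1 := ⟨r' - 1, by omega⟩
    rw [show n - 1 - (s + 1) + 1 = n - 1 - s by omega] at h6
    have h7 : c < d.count (n - 1 - (s + 1)) ∨ c = d.count (n - 1 - (s + 1)) := by
      by_contra! h8
      have h9 : (s + 1, d.count (n - 1 - (s + 1))) ∈ μ := μ.up_left_mem le_rfl (by omega) h3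
      have h10 := T.row_lt (show d.count (n - 1 - (s + 1)) < c by omega) h3
      have h12 : T.1 (s + 1) (d.count (n - 1 - (s + 1))) ≠ m + 1 := by
        intro h13
        have := (entry_eq_iff T h9 h1).1 (by omega)
        omega
      exact absurd ((key (s + 1) hrn' _).2 ⟨h9, by omega⟩) (lt_irrefl _)
    have h8 : c < d.count (n - 1 - s) := by omega
    have h9 := ((key s (by omega) c).1 h8)
    rcases (show r ≤ s by omega).eq_or_lt with rfl | hlt'
    · omega
    · have := T.1.col_strict hlt' h9.1
      omega

theorem seg_of_length_le_one {n m : ℕ} {l : List ℕ} (hl : IsWord n l) (hm : m ≤ 1) :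
    seg n 0 m l = l := by
  have key : ∀ u, IsWord n u → u.length ≤ 1 → long n u = u := by
    intro u hu h
    rcases u with _ | ⟨x, _ | ⟨y, u⟩⟩
    · have := length_long hu
      simpa using this
    · have hx := hu x (by simp)
      rw [long, revComp_cons]
      change xi n [n - 1 - x] = [x]
      rw [xi_singleton (by omega)]
      congr 1
      omega
    · simp at h
  rw [seg_zero, key _ (hl.take m) (by simp; omega), List.take_append_drop]

/-- The four factors of `bkOp` telescope, each being an involution. -/
theorem tabWord_partialPromotion (hμ : μ.card = n) : ∀ k, k + 1 ≤ n → ∀ T : StdTableau μ,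
    tabWord n (partialPromotion k T) = seg n 0 k (seg n 0 (k + 1) (tabWord n T))
  | 0, _, T => by
    have h := isWord_tabWord n T
    rw [seg_of_length_le_one h (by omega), seg_of_length_le_one h (by omega)]
    rfl
  | k + 1, hk, T => by
    have hw := isWord_tabWord n T
    have hlen := length_tabWord n T
    have w1 := seg_word (i := 0) (m := k + 1) hw (by omega)
    change tabWord n (benderKnuth (k + 1) (partialPromotion k T)) = _
    rw [tabWord_benderKnuth hμ (by omega), tabWord_partialPromotion hμ k (by omega), bkOp,
      seg_seg w1.1 (by omega), seg_seg hw (by omega)]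

theorem tabWord_partialSchutzenberger (hμ : μ.card = n) : ∀ k, k + 1 ≤ n → ∀ T : StdTableau μ,
    tabWord n (partialSchutzenberger k T) = seg n 0 (k + 1) (tabWord n T)
  | 0, _, T => by
    rw [seg_of_length_le_one (isWord_tabWord n T) le_rfl]
    rfl
  | k + 1, hk, T => by
    have hw := isWord_tabWord n T
    have hlen := length_tabWord n T
    have w1 := seg_word (i := 0) (m := k + 2) hw (by omega)
    change tabWord n (partialSchutzenberger k (partialPromotion (k + 1) T)) = _
    rw [tabWord_partialSchutzenberger hμ k (by omega), tabWord_partialPromotion hμ _ hk,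
      seg_seg w1.1 (by omega)]

/-- By the nested relation, conjugation by `s_{1j}` turns `s_{1,j-i+1}` into `s_{ij}`. Positions
start at `0`, so `p.1.2` stands for `j - 1`. -/
theorem tabWord_generator (hμ : μ.card = n) (p : PosPair n) (T : StdTableau μ) :
    tabWord n (partialSchutzenberger (p.1.2 : ℕ)
      (partialSchutzenberger ((p.1.2 : ℕ) - (p.1.1 : ℕ)) (partialSchutzenberger (p.1.2 : ℕ) T))) =
      seg n p.1.1 ((p.1.2 : ℕ) - (p.1.1 : ℕ) + 1) (tabWord n T) := by
  have hp : (p.1.1 : ℕ) < p.1.2 := p.2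
  have hp2 := p.1.2.isLt
  have hw := isWord_tabWord n T
  have hlen := length_tabWord n T
  have w1 := seg_word (i := 0) (m := (p.1.2 : ℕ) + 1) hw (by omega)
  rw [tabWord_partialSchutzenberger hμ _ (by omega), tabWord_partialSchutzenberger hμ _ (by omega),
    tabWord_partialSchutzenberger hμ _ (by omega),
    seg_nested w1.1 (by omega) le_rfl (by omega), seg_seg hw (by omega)]
  congr 1
  omega

/-- The cactus relations are inherited from words, since `tabWord` is injective and intertwines the
operators with `seg`. -/
theorem existsUnique_berensteinKirillov (n : ℕ) :
    ∃! β : (μ : Shape n) → Cactus n →* Equiv.Perm (StdTableau μ.1), IsBerensteinKirillov β := by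
  have h : ∀ μ : Shape n, ∃ ρ : Cactus n →* Equiv.Perm (StdTableau μ.1), ∀ p T,
      ρ (Cactus.s p) T = _ := fun μ =>
    exists_cactus_hom (tabWord_injective μ.2) (isWord_tabWord n) (length_tabWord n) _
      (tabWord_generator μ.2)
  choose β hβ using h
  refine ⟨β, hβ, fun β' hβ' => ?_⟩
  funext μ
  apply cactus_hom_ext
  intro p
  ext T : 1
  rw [hβ, hβ']

theorem tabWord_action {β : (μ : Shape n) → Cactus n →* Equiv.Perm (StdTableau μ.1)}
    (h : IsBerensteinKirillov β) (μ : Shape n) (p : PosPair n) (T : StdTableau μ.1) :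
    tabWord n (β μ (Cactus.s p) T) =
      seg n p.1.1 ((p.1.2 : ℕ) - (p.1.1 : ℕ) + 1) (tabWord n T) := by
  rw [h, tabWord_generator μ.2]

end

end CactusCrystal

/-! ### The Robinson–Schensted correspondence is a bijection -/

namespace CactusCrystal

/-! ### Row insertion -/

theorem rowInsert_append {x y : ℕ} {A B : List ℕ} (hA : ∀ a ∈ A, a ≤ x) (hy : x < y) :
    rowInsert x (A ++ y :: B) = (A ++ x :: B, some y) := by
  induction A with
  | nil => simp [rowInsert, hy]
  | cons a A ih =>
    have h1 := hA a (by simp)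
    have h2 := ih fun b hb => hA b (by simp [hb])
    simp only [List.cons_append, rowInsert, if_neg (not_lt.2 h1), h2]

theorem rowInsert_of_le {x : ℕ} {A : List ℕ} (hA : ∀ a ∈ A, a ≤ x) :
    rowInsert x A = (A ++ [x], none) := by
  induction A with
  | nil => rfl
  | cons a A ih =>
    have h1 := hA a (by simp)
    have h2 := ih fun b hb => hA b (by simp [hb])
    simp only [List.cons_append, rowInsert, if_neg (not_lt.2 h1), h2]

theorem rowInsert_cases (x : ℕ) (r : List ℕ) : (∀ a ∈ r, a ≤ x) ∨
    ∃ A y B, r = A ++ y :: B ∧ (∀ a ∈ A, a ≤ x) ∧ x < y := by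
  induction r with
  | nil => simp
  | cons a r ih =>
    by_cases h : x < a
    · exact Or.inr ⟨[], a, r, rfl, by simp, h⟩
    · rcases ih with ih | ⟨A, y, B, rfl, hA, hy⟩
      · exact Or.inl (by simpa using ⟨not_lt.1 h, ih⟩)
      · exact Or.inr ⟨a :: A, y, B, rfl, by simpa using ⟨not_lt.1 h, hA⟩, hy⟩

theorem insertTableau_of_le {x : ℕ} {r : List ℕ} (T : List (List ℕ)) (h : ∀ a ∈ r, a ≤ x) :
    insertTableau x (r :: T) = ((r ++ [x]) :: T, 0) := by
  rw [insertTableau, rowInsert_of_le h]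

theorem insertTableau_append {x y : ℕ} {A B : List ℕ} (T : List (List ℕ)) (hA : ∀ a ∈ A, a ≤ x)
    (hy : x < y) : insertTableau x ((A ++ y :: B) :: T) =
      ((A ++ x :: B) :: (insertTableau y T).1, (insertTableau y T).2 + 1) := by
  rw [insertTableau, rowInsert_append hA hy]

/-- The row lengths after adding a cell to the row `i`. -/
def incLen : ℕ → List ℕ → List ℕ
  | _, [] => [1]
  | 0, a :: t => (a + 1) :: t
  | i + 1, a :: t => a :: incLen i t

theorem map_length_insertTableau (x : ℕ) (T : List (List ℕ)) :
    (insertTableau x T).1.map List.length = incLen (insertTableau x T).2 (T.map List.length) ∧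
      (insertTableau x T).2 ≤ T.length := by
  induction T generalizing x with
  | nil => exact ⟨rfl, le_rfl⟩
  | cons r T ih =>
    rcases rowInsert_cases x r with h | ⟨A, y, B, rfl, hA, hy⟩
    · rw [insertTableau_of_le T h]
      simp [incLen]
    · rw [insertTableau_append T hA hy]
      simp [incLen, ih y]

theorem map_length_appendToRow (x : ℕ) : ∀ (i : ℕ) (T : List (List ℕ)),
    (appendToRow x i T).map List.length = incLen i (T.map List.length)
  | 0, [] => rfl
  | 0, r :: T => by simp [appendToRow, incLen]
  | i + 1, [] => rfl
  | i + 1, r :: T => by simp [appendToRow, incLen, map_length_appendToRow x i T]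

theorem incLen_injective_left : ∀ {i j : ℕ} {l : List ℕ}, i ≤ l.length → j ≤ l.length →
    incLen i l = incLen j l → i = j
  | i, j, [], hi, hj, _ => by simp at hi hj; omega
  | 0, 0, _ :: _, _, _, _ => rfl
  | 0, j + 1, a :: t, _, _, h => by simp [incLen] at h
  | i + 1, 0, a :: t, _, _, h => by simp [incLen] at h
  | i + 1, j + 1, a :: t, hi, hj, h => by
    simp only [incLen, List.cons.injEq, true_and] at h
    rw [incLen_injective_left (by simpa using hi) (by simpa using hj) h]

theorem incLen_injective_right : ∀ {i : ℕ} {l l' : List ℕ}, i ≤ l.length → i ≤ l'.length →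
    0 ∉ l → 0 ∉ l' → incLen i l = incLen i l' → l = l'
  | _, [], [], _, _, _, _, _ => rfl
  | 0, [], a :: t, _, _, _, h0, h => by
    simp only [incLen, List.cons.injEq] at h
    simp at h0
    omega
  | 0, a :: t, [], _, _, h0, _, h => by
    simp only [incLen, List.cons.injEq] at h
    simp at h0
    omega
  | 0, a :: t, b :: s, _, _, _, _, h => by simpa [incLen] using h
  | i + 1, a :: t, b :: s, h1, h2, h3, h4, h => by
    simp only [incLen, List.cons.injEq] at h
    simp only [List.mem_cons, not_or] at h3 h4
    rw [h.1, incLen_injective_right (by simpa using h1) (by simpa using h2) h3.2 h4.2 h.2]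

/-! ### Tableaux as lists of rows -/

/-- The row `s` may stand below the row `r`. -/
def Above (r s : List ℕ) : Prop := ∀ p, below p s ≤ below p r

/-- The rows form a tableau. -/
def IsTab : List (List ℕ) → Prop
  | [] => True
  | r :: T => r ≠ [] ∧ r.Pairwise (· < ·) ∧ Above r (T.headD []) ∧ IsTab T

theorem below_append (p : ℕ) (l l' : List ℕ) : below p (l ++ l') = below p l + below p l' := by
  simp [below]

theorem below_cons (p x : ℕ) (l : List ℕ) :
    below p (x :: l) = below p l + if x < p then 1 else 0 := by
  simp [below, List.countP_cons]

theorem below_nil (p : ℕ) : below p [] = 0 := rfl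

theorem below_eq_zero {p : ℕ} {l : List ℕ} (h : ∀ x ∈ l, p ≤ x) : below p l = 0 := by
  rw [below, List.countP_eq_zero]
  intro x hx
  simpa using h x hx

theorem below_eq_length {p : ℕ} {l : List ℕ} (h : ∀ x ∈ l, x < p) : below p l = l.length := by
  rw [below, List.countP_eq_length]
  intro x hx
  simpa using h x hx

theorem below_mono {p q : ℕ} (h : p ≤ q) (l : List ℕ) : below p l ≤ below q l := by
  apply List.countP_mono_left
  intro x _ hx
  simp only [decide_eq_true_eq] at hx ⊢
  omega

theorem below_le_length (p : ℕ) (l : List ℕ) : below p l ≤ l.length := List.countP_le_length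

theorem below_lt_of_mem {p q x : ℕ} {l : List ℕ} (hx : x ∈ l) (hp : p ≤ x) (hq : x < q) :
    below p l + 1 ≤ below q l := by
  obtain ⟨A, B, rfl⟩ := List.append_of_mem hx
  rw [below_append, below_append, below_cons, below_cons, if_neg (by omega), if_pos hq]
  have h1 := below_mono (show p ≤ q by omega) A
  have h2 := below_mono (show p ≤ q by omega) B
  omega

/-- Choosing `p` larger than all entries of `s` turns the comparison of counts into one of lengths.
-/
theorem Above.length_le {r s : List ℕ} (h : Above r s) : s.length ≤ r.length := by
  obtain ⟨p, hp⟩ : ∃ p, ∀ x ∈ s, x < p := by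
    induction s with
    | nil => exact ⟨0, by simp⟩
    | cons a s ih =>
      obtain ⟨p, hp⟩ := ih fun p => le_trans (by rw [below_cons]; omega) (h p)
      refine ⟨max p (a + 1), ?_⟩
      intro x hx
      rcases List.mem_cons.1 hx with rfl | hx
      · omega
      · have := hp x hx
        omega
  rw [← below_eq_length hp]
  exact (h p).trans (below_le_length p r)

theorem isTab_of {T : List (List ℕ)} (h : ∀ r ∈ T, r ≠ [] ∧ r.Pairwise (· < ·))
    (h' : ∀ i, Above (T.getD i []) (T.getD (i + 1) [])) : IsTab T := by
  induction T with
  | nil => trivial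
  | cons r T ih =>
    refine ⟨(h r (by simp)).1, (h r (by simp)).2, ?_, ih (fun s hs => h s (by simp [hs]))
        fun i => ?_⟩
    · have := h' 0
      cases T <;> simpa using this
    · simpa using h' (i + 1)

theorem IsTab.getD {T : List (List ℕ)} (h : IsTab T) : (∀ r ∈ T, r ≠ [] ∧ r.Pairwise (· < ·)) ∧
    ∀ i, Above (T.getD i []) (T.getD (i + 1) []) := by
  induction T with
  | nil => exact ⟨by simp, fun i p => by simp⟩
  | cons r T ih =>
    obtain ⟨h1, h2, h3, h4⟩ := h
    refine ⟨?_, ?_⟩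
    · intro s hs
      rcases List.mem_cons.1 hs with rfl | hs
      · exact ⟨h1, h2⟩
      · exact (ih h4).1 s hs
    · rintro (_ | i)
      · cases T <;> simpa using h3
      · simpa using (ih h4).2 i

theorem IsTab.zero_notMem {T : List (List ℕ)} (h : IsTab T) : 0 ∉ T.map List.length := by
  intro h0
  obtain ⟨r, hr, h1⟩ := List.mem_map.1 h0
  exact (h.getD.1 r hr).1 (List.length_eq_zero_iff.1 h1)

theorem IsTab.eq_nil {T : List (List ℕ)} (h : IsTab T) (h' : T.flatten = []) : T = [] := by
  cases T with
  | nil => rfl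
  | cons r T =>
    simp only [List.flatten_cons, List.append_eq_nil_iff] at h'
    exact absurd h'.1 h.1

theorem pairwise_replace {A B : List ℕ} {x y : ℕ} (h : (A ++ y :: B).Pairwise (· < ·))
    (hA : ∀ a ∈ A, a < x) (hB : ∀ b ∈ B, x < b) : (A ++ x :: B).Pairwise (· < ·) := by
  simp only [List.pairwise_append, List.pairwise_cons, List.mem_cons, forall_eq_or_imp] at h ⊢
  exact ⟨h.1, ⟨hB, h.2.1.2⟩, fun a ha => ⟨hA a ha, (h.2.2 a ha).2⟩⟩

/-- The last clause strengthens the induction: the first row gains an entry below `p` only if `x <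
p`, and then its count is at most one more than the old count below `x`. This is what allows it to
stand below the row from which `x` was bumped. -/
theorem isTab_insertTableau : ∀ {T : List (List ℕ)} {x : ℕ}, IsTab T → (x :: T.flatten).Nodup →
    IsTab (insertTableau x T).1 ∧ (insertTableau x T).1.flatten.Perm (x :: T.flatten) ∧
      ∀ p, below p ((insertTableau x T).1.headD []) ≤ below p (T.headD []) ∨
        (x < p ∧ below p ((insertTableau x T).1.headD []) ≤ below x (T.headD []) + 1)
  | [], x, _, _ => by
    refine ⟨⟨by simp, by simp, fun p => by simp [below_nil], trivial⟩, by simp [insertTableau], ?_⟩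
    intro p
    simp only [insertTableau, List.headD_cons, below_cons, below_nil, List.headD_nil]
    split_ifs with h
    · exact Or.inr ⟨h, le_rfl⟩
    · exact Or.inl le_rfl
  | r :: T, x, hT, hnd => by
    obtain ⟨h1, h2, h3, h4⟩ := hT
    rcases rowInsert_cases x r with h | ⟨A, y, B, rfl, hA, hy⟩
    · have hlt : ∀ a ∈ r, a < x := by
        intro a ha
        refine lt_of_le_of_ne (h a ha) ?_
        rintro rfl
        simp [ha] at hnd
      rw [insertTableau_of_le T h]
      refine ⟨⟨by simp, ?_, ?_, h4⟩, ?_, ?_⟩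
      · rw [List.pairwise_append]
        exact ⟨h2, by simp, by simpa using hlt⟩
      · intro p
        have := h3 p
        rw [below_append]
        omega
      · simp
      · intro p
        simp only [List.headD_cons, below_append, below_cons, below_nil]
        split_ifs with hp
        · refine Or.inr ⟨hp, ?_⟩
          rw [below_eq_length hlt]
          have := below_le_length p r
          omega
        · exact Or.inl (by omega)
    · have hA' : ∀ a ∈ A, a < x := by
        intro a ha
        refine lt_of_le_of_ne (hA a ha) ?_
        rintro rfl
        simp [ha] at hnd
      have hyB : ∀ b ∈ B, y < b := by
        intro b hb
        simp only [List.pairwise_append, List.pairwise_cons] at h2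
        exact h2.2.1.1 b hb
      have hnd' : (y :: T.flatten).Nodup := by
        simp only [List.flatten_cons, List.nodup_cons] at hnd
        have h5 := hnd.2
        rw [List.nodup_append'] at h5
        rw [List.nodup_cons]
        exact ⟨fun hy => h5.2.2 (by simp) hy, h5.2.1⟩
      obtain ⟨i1, i2, i3⟩ := isTab_insertTableau h4 hnd'
      rw [insertTableau_append T hA hy]
      refine ⟨⟨by simp, pairwise_replace h2 hA' fun b hb => hy.trans (hyB b hb), ?_, i1⟩, ?_, ?_⟩
      · intro p
        have e1 := h3 p
        have e2 := h3 y
        simp only [below_append, below_cons] at e1 e2 ⊢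
        rcases i3 p with h5 | ⟨h5, h6⟩
        · split_ifs at e1 e2 ⊢ <;> omega
        · have e3 := below_mono h5.le A
          rw [below_eq_zero (l := B) fun b hb => (hyB b hb).le] at e2
          rw [if_pos (hy.trans h5)]
          rw [if_neg (lt_irrefl y)] at e2
          omega
      · simp only [List.flatten_cons]
        refine ((i2.append_left _).trans ?_)
        simp only [List.append_assoc, List.cons_append]
        refine List.perm_middle.trans (List.Perm.cons _ ?_)
        refine List.Perm.append_left _ ?_
        exact List.perm_middle
      · intro p
        simp only [List.headD_cons, below_append, below_cons]
        rw [if_neg (show ¬ y < x by omega)]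
        by_cases h5 : x < p
        · by_cases h6 : y < p
          · left
            rw [if_pos h5, if_pos h6]
          · right
            refine ⟨h5, ?_⟩
            rw [if_pos h5, below_eq_length hA',
              below_eq_zero (p := p) fun b hb => (not_lt.1 h6).trans (hyB b hb).le]
            have := below_le_length p A
            omega
        · left
          rw [if_neg h5]
          omega

/-- The tableau `P` has the shape of the result and thereby guarantees that the new cell may be
added. The new entry exceeds all others, so counts below `p ≤ v` do not change. -/
theorem isTab_appendToRow {v : ℕ} : ∀ {i : ℕ} {Q P : List (List ℕ)}, IsTab P →
    P.map List.length = (appendToRow v i Q).map List.length → IsTab Q →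
    (∀ e ∈ Q.flatten, e < v) → IsTab (appendToRow v i Q) ∧
      (appendToRow v i Q).flatten.Perm (v :: Q.flatten) ∧
      ∀ p ≤ v, below p ((appendToRow v i Q).headD []) = below p (Q.headD [])
  | 0, [], _, _, _, _, _ =>
    ⟨⟨by simp, by simp, fun p => by simp [below_nil], trivial⟩, by simp [appendToRow], by
      intro p hp
      simp [appendToRow, below_cons, below_nil, hp]⟩
  | _ + 1, [], _, _, _, _, _ =>
    ⟨⟨by simp, by simp, fun p => by simp [below_nil], trivial⟩, by simp [appendToRow], by
      intro p hp
      simp [appendToRow, below_cons, below_nil, hp]⟩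
  | 0, r :: T, _, _, _, ⟨h1, h2, h3, h4⟩, hv => by
    refine ⟨⟨by simp, ?_, ?_, h4⟩, ?_, ?_⟩
    · rw [List.pairwise_append]
      refine ⟨h2, by simp, ?_⟩
      intro a ha b hb
      rw [List.mem_singleton.1 hb]
      exact hv a (by simp [ha])
    · intro p
      have := h3 p
      rw [below_append]
      omega
    · simp [appendToRow]
    · intro p hp
      simp [appendToRow, below_append, below_cons, below_nil, hp]
  | i + 1, r :: T, [], _, hl, _, _ => by simp [appendToRow] at hl
  | i + 1, r :: T, r' :: P, ⟨_, _, g3, g4⟩, hl, ⟨h1, h2, h3, h4⟩, hv => by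
    simp only [appendToRow, List.map_cons, List.cons.injEq] at hl
    obtain ⟨i1, i2, i3⟩ := isTab_appendToRow g4 hl.2 h4 fun e he => hv e (by simp [he])
    refine ⟨⟨h1, h2, ?_, i1⟩, ?_, fun p _ => rfl⟩
    · intro p
      rcases le_or_gt p v with hp | hp
      · rw [i3 p hp]
        exact h3 p
      · rw [below_eq_length (l := r) fun e he => (hv e (by simp [he])).trans hp]
        refine (below_le_length _ _).trans ?_
        have e1 := g3.length_le
        have e2 : (P.headD []).length = ((appendToRow v i T).headD []).length := by
          have := congrArg (fun l => l.headD 0) hl.2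
          cases P <;> cases h : appendToRow v i T <;> simp_all
        omega
    · simp only [appendToRow, List.flatten_cons]
      exact (i2.append_left r).trans List.perm_middle

/-! ### The recording procedure -/

theorem rskPair_nil : rskPair [] = ([], []) := rfl

theorem rskPair_snoc (l : List ℕ) (x : ℕ) : rskPair (l ++ [x]) =
    ((insertTableau x (rskPair l).1).1,
      appendToRow (l.length + 1) (insertTableau x (rskPair l).1).2 (rskPair l).2) := by
  simp [rskPair, List.zipIdx_append]

theorem rskPair_spec (l : List ℕ) (h : l.Nodup) :
    IsTab (rskPair l).1 ∧ IsTab (rskPair l).2 ∧ (rskPair l).1.flatten.Perm l ∧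
      (rskPair l).2.flatten.Perm (List.range' 1 l.length) ∧
      (rskPair l).1.map List.length = (rskPair l).2.map List.length := by
  induction l using List.reverseRecOn with
  | nil => exact ⟨trivial, trivial, by simp [rskPair_nil], by simp [rskPair_nil], rfl⟩
  | append_singleton l x ih =>
    have hnd : (x :: l).Nodup := (List.perm_append_singleton x l).nodup_iff.1 h
    obtain ⟨h1, h2, h3, h4, h5⟩ := ih (List.nodup_cons.1 hnd).2
    obtain ⟨i1, i2, -⟩ := isTab_insertTableau h1 ((h3.cons x).nodup_iff.2 hnd)
    have hlen : (insertTableau x (rskPair l).1).1.map List.length =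
        (appendToRow (l.length + 1) (insertTableau x (rskPair l).1).2 (rskPair l).2).map
          List.length := by
      rw [(map_length_insertTableau _ _).1, map_length_appendToRow, h5]
    obtain ⟨j1, j2, -⟩ := isTab_appendToRow i1 hlen h2 (by
      intro e he
      have := h4.subset he
      rw [List.mem_range'_1] at this
      omega)
    rw [rskPair_snoc]
    refine ⟨i1, j1, ?_, ?_, hlen⟩
    · exact i2.trans ((h3.cons x).trans (List.perm_append_singleton x l).symm)
    · refine j2.trans ((h4.cons _).trans ?_)
      rw [List.length_append, List.length_singleton, List.range'_concat]
      rw [Nat.add_comm 1, Nat.one_mul]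
      exact (List.perm_append_singleton _ _).symm

/-- The recording tableau depends only on the shapes. -/
theorem rskPair_snd_congr {l l' : List ℕ} (hlen : l.length = l'.length)
    (h : ∀ t, (rskPair (l.take t)).1.map List.length = (rskPair (l'.take t)).1.map List.length) :
    (rskPair l).2 = (rskPair l').2 := by
  have key : ∀ t ≤ l.length, (rskPair (l.take t)).2 = (rskPair (l'.take t)).2 := by
    intro t
    induction t with
    | zero => intro _; simp
    | succ t ih =>
      intro ht
      have e1 := h t
      have e2 := h (t + 1)
      rw [List.take_succ_eq_append_getElem (show t < l.length by omega),
        List.take_succ_eq_append_getElem (show t < l'.length by omega), rskPair_snoc,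
        rskPair_snoc] at e2 ⊢
      dsimp only at e2 ⊢
      obtain ⟨g1, g2⟩ := map_length_insertTableau (l[t]'(by omega)) (rskPair (l.take t)).1
      obtain ⟨g3, g4⟩ := map_length_insertTableau (l'[t]'(by omega)) (rskPair (l'.take t)).1
      rw [g1, g3, e1] at e2
      have hl := congrArg List.length e1
      simp only [List.length_map] at hl
      rw [ih (by omega), incLen_injective_left (by simpa [← hl] using g2) (by simpa using g4) e2]
      simp [hlen]
  have := key l.length le_rfl
  rwa [List.take_length, hlen, List.take_length] at this

end CactusCrystal

namespace CactusCrystal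

/-! ### Injectivity of the Robinson–Schensted correspondence -/

/-- The bumped entry `y` locates the bump: the entries of the new row smaller than `y` are `A`
followed by `x`, and the larger ones are `B`. -/
theorem eq_of_append_bump {A A' B B' : List ℕ} {x x' y : ℕ} (h : A ++ x :: B = A' ++ x' :: B')
    (hA : ∀ a ∈ A, a < y) (hx : x < y) (hB : ∀ b ∈ B, y < b)
    (hA' : ∀ a ∈ A', a < y) (hx' : x' < y) (hB' : ∀ b ∈ B', y < b) :
    A = A' ∧ x = x' ∧ B = B' := by
  have key : ∀ {A B : List ℕ} {x : ℕ}, (∀ a ∈ A, a < y) → x < y → (∀ b ∈ B, y < b) →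
      (A ++ x :: B).filter (· < y) = A ++ [x] ∧ (A ++ x :: B).filter (y < ·) = B := by
    intro A B x hA hx hB
    have e1 : A.filter (· < y) = A := List.filter_eq_self.2 (by simpa using hA)
    have e2 : B.filter (y < ·) = B := List.filter_eq_self.2 (by simpa using hB)
    have e3 : A.filter (y < ·) = [] :=
      List.filter_eq_nil_iff.2 fun a ha => by simpa using (hA a ha).le
    have e4 : B.filter (· < y) = [] :=
      List.filter_eq_nil_iff.2 fun b hb => by simpa using (hB b hb).le
    rw [List.filter_append, List.filter_append, List.filter_cons, List.filter_cons, e1, e2, e3, e4,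
      if_pos (by simpa using hx), if_neg (by simpa using hx.le)]
    simp
  obtain ⟨k1, k2⟩ := key hA hx hB
  obtain ⟨k3, k4⟩ := key hA' hx' hB'
  rw [h, k3] at k1
  rw [h, k4] at k2
  have := List.append_inj' k1 rfl
  exact ⟨this.1.symm, by simpa using this.2.symm, k2.symm⟩

theorem insertTableau_injective : ∀ {T T' : List (List ℕ)} {x x' : ℕ}, IsTab T → IsTab T' →
    (x :: T.flatten).Nodup → (x' :: T'.flatten).Nodup →
    insertTableau x T = insertTableau x' T' → x = x' ∧ T = T'
  | [], [], x, x', _, _, _, _, h => by simpa [insertTableau] using h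
  | [], r :: T, x, x', _, ⟨h1, _⟩, _, _, h => by
    rcases rowInsert_cases x' r with hc | ⟨A, y, B, rfl, hA, hy⟩
    · rw [insertTableau_of_le T hc] at h
      simp only [insertTableau, Prod.mk.injEq, List.cons.injEq, and_true] at h
      have := congrArg List.length h.1
      simp only [List.length_append, List.length_singleton] at this
      exact absurd (List.length_eq_zero_iff.1 (show r.length = 0 by omega)) h1
    · rw [insertTableau_append T hA hy] at h
      simp [insertTableau] at h
  | r :: T, [], x, x', ⟨h1, _⟩, _, _, _, h => by
    rcases rowInsert_cases x r with hc | ⟨A, y, B, rfl, hA, hy⟩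
    · rw [insertTableau_of_le T hc] at h
      simp only [insertTableau, Prod.mk.injEq, List.cons.injEq, and_true] at h
      have := congrArg List.length h.1
      simp only [List.length_append, List.length_singleton] at this
      exact absurd (List.length_eq_zero_iff.1 (show r.length = 0 by omega)) h1
    · rw [insertTableau_append T hA hy] at h
      simp [insertTableau] at h
  | r :: T, r' :: T', x, x', hT, hT', hnd, hnd', h => by
    obtain ⟨-, h2, -, h4⟩ := hT
    obtain ⟨-, h2', -, h4'⟩ := hT'
    rcases rowInsert_cases x r with hc | ⟨A, y, B, rfl, hA, hy⟩ <;>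
      rcases rowInsert_cases x' r' with hc' | ⟨A', y', B', rfl, hA', hy'⟩
    · rw [insertTableau_of_le T hc, insertTableau_of_le T' hc'] at h
      simp only [Prod.mk.injEq, List.cons.injEq, and_true] at h
      have := List.append_inj' h.1 rfl
      exact ⟨by simpa using this.2, by rw [this.1, h.2]⟩
    · rw [insertTableau_of_le T hc, insertTableau_append T' hA' hy'] at h
      simp at h
    · rw [insertTableau_append T hA hy, insertTableau_of_le T' hc'] at h
      simp at h
    · rw [insertTableau_append T hA hy, insertTableau_append T' hA' hy'] at h
      simp only [Prod.mk.injEq, List.cons.injEq, Nat.add_right_cancel_iff] at h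
      have key : ∀ {x y : ℕ} {A B : List ℕ} {T : List (List ℕ)}, (A ++ y :: B).Pairwise (· < ·) →
          (x :: ((A ++ y :: B) :: T).flatten).Nodup → (∀ a ∈ A, a ≤ x) → x < y →
          (y :: T.flatten).Nodup ∧ (∀ a ∈ A, a < y) ∧ ∀ b ∈ B, y < b := by
        intro x y A B T h2 hnd hA hy
        simp only [List.pairwise_append, List.pairwise_cons] at h2
        simp only [List.flatten_cons, List.nodup_cons, List.nodup_append', List.mem_append] at hnd
        refine ⟨?_, fun a ha => (hA a ha).trans_lt hy, fun b hb => h2.2.1.1 b hb⟩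
        rw [List.nodup_cons]
        exact ⟨fun hy => hnd.2.2.2 (by simp) hy, hnd.2.2.1⟩
      obtain ⟨k1, k2, k3⟩ := key h2 hnd hA hy
      obtain ⟨k1', k2', k3'⟩ := key h2' hnd' hA' hy'
      obtain ⟨rfl, rfl⟩ := insertTableau_injective h4 h4' k1 k1' (Prod.ext h.1.2 h.2)
      obtain ⟨rfl, rfl, rfl⟩ := eq_of_append_bump h.1.1 k2 hy k3 k2' hy' k3'
      exact ⟨rfl, rfl⟩

/-- Remove an entry from a tableau. -/
def strip (v : ℕ) (T : List (List ℕ)) : List (List ℕ) :=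
  (T.map (List.filter (· ≠ v))).filter (· ≠ [])

theorem strip_eq_self {v : ℕ} {T : List (List ℕ)} (hT : IsTab T) (hv : v ∉ T.flatten) :
    strip v T = T := by
  have h1 : T.map (List.filter (· ≠ v)) = T := by
    conv_rhs => rw [← List.map_id T]
    apply List.map_congr_left
    intro r hr
    rw [List.filter_eq_self.2]
    · rfl
    · intro a ha
      rw [decide_eq_true_eq]
      rintro rfl
      exact hv (List.mem_flatten.2 ⟨r, hr, ha⟩)
  rw [strip, h1, List.filter_eq_self]
  intro r hr
  simpa using (hT.getD.1 r hr).1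

theorem strip_appendToRow (v : ℕ) : ∀ (i : ℕ) (T : List (List ℕ)),
    strip v (appendToRow v i T) = strip v T
  | 0, [] => by simp [strip, appendToRow]
  | _ + 1, [] => by simp [strip, appendToRow]
  | 0, r :: T => by simp [strip, appendToRow]
  | i + 1, r :: T => by
    have := strip_appendToRow v i T
    simp only [strip] at this
    simp only [strip, appendToRow, List.map_cons, List.filter_cons, this]

/-- Deleting the largest entry of the recording tableau recovers the previous one, hence the
previous shape. The change of shape reveals the row in which insertion ended, and from there
insertion is undone. -/
theorem rskPair_injective : ∀ {l l' : List ℕ}, l.Nodup → l'.Nodup → l.length = l'.length →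
    rskPair l = rskPair l' → l = l' := by
  intro l
  induction l using List.reverseRecOn with
  | nil =>
    intro l' _ _ h _
    exact (List.length_eq_zero_iff.1 h.symm).symm
  | append_singleton l x ih =>
    intro l' hl hl' hlen h
    rcases List.eq_nil_or_concat l' with rfl | ⟨l', x', rfl⟩
    · simp at hlen
    · rw [List.concat_eq_append] at *
      have hlen' : l.length = l'.length := by simpa using hlen
      have hnd : (x :: l).Nodup := (List.perm_append_singleton x l).nodup_iff.1 hl
      have hnd' : (x' :: l').Nodup := (List.perm_append_singleton x' l').nodup_iff.1 hl'
      obtain ⟨h1, h2, h3, h4, h5⟩ := rskPair_spec l (List.nodup_cons.1 hnd).2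
      obtain ⟨h1', h2', h3', h4', h5'⟩ := rskPair_spec l' (List.nodup_cons.1 hnd').2
      rw [rskPair_snoc, rskPair_snoc, Prod.mk.injEq] at h
      obtain ⟨hP, hQ⟩ := h
      rw [← hlen'] at hQ
      have hnot : ∀ {m : ℕ} {Q : List (List ℕ)}, Q.flatten.Perm (List.range' 1 m) →
          m + 1 ∉ Q.flatten := by
        intro m Q hQ hm
        have := hQ.subset hm
        rw [List.mem_range'_1] at this
        omega
      have hQQ := congrArg (strip (l.length + 1)) hQ
      rw [strip_appendToRow, strip_appendToRow, strip_eq_self h2 (hnot h4),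
        strip_eq_self h2' (hlen' ▸ hnot h4')] at hQQ
      obtain ⟨g1, g2⟩ := map_length_insertTableau x (rskPair l).1
      obtain ⟨g3, g4⟩ := map_length_insertTableau x' (rskPair l').1
      have hl1 : (rskPair l).1.map List.length = (rskPair l').1.map List.length := by
        rw [h5, h5', hQQ]
      have hi : (insertTableau x (rskPair l).1).2 = (insertTableau x' (rskPair l').1).2 := by
        apply incLen_injective_left (l := (rskPair l).1.map List.length)
        · simpa using g2
        · rw [hl1]
          simpa using g4
        · rw [← g1, hl1, ← g3, hP]
      obtain ⟨rfl, hPP⟩ := insertTableau_injective h1 h1' ((h3.cons x).nodup_iff.2 hnd)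
        ((h3'.cons x').nodup_iff.2 hnd') (Prod.ext hP hi)
      rw [ih (List.nodup_cons.1 hnd).2 (List.nodup_cons.1 hnd').2 hlen' (Prod.ext hPP hQQ)]

/-! ### Surjectivity of the Robinson–Schensted correspondence -/

theorem exists_max_below : ∀ {r : List ℕ} {y : ℕ}, r.Pairwise (· < ·) → y ∉ r → (∃ x ∈ r, x < y) →
    ∃ A x B, r = A ++ x :: B ∧ x < y ∧ ∀ b ∈ B, y < b
  | [], _, _, _, ⟨x, hx, _⟩ => by simp at hx
  | a :: r, y, hr, hy, ⟨x, hx, hxy⟩ => by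
    rw [List.pairwise_cons] at hr
    simp only [List.mem_cons, not_or] at hy
    by_cases h : ∃ z ∈ r, z < y
    · obtain ⟨A, z, B, rfl, h1, h2⟩ := exists_max_below hr.2 hy.2 h
      exact ⟨a :: A, z, B, rfl, h1, h2⟩
    · push Not at h
      have hax : x = a := by
        rcases List.mem_cons.1 hx with h1 | h1
        · exact h1
        · exact absurd (h x h1) (by omega)
      refine ⟨[], a, r, rfl, by omega, fun b hb => ?_⟩
      refine lt_of_le_of_ne (h b hb) ?_
      rintro rfl
      exact hy.2 hb

/-- Row insertion can be undone at every removable corner. -/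
theorem exists_unbump : ∀ {i : ℕ} {T : List (List ℕ)}, IsTab T → T.flatten.Nodup →
    (T.getD (i + 1) []).length < (T.getD i []).length →
    ∃ x T', IsTab T' ∧ insertTableau x T' = (T, i) ∧ T.flatten.Perm (x :: T'.flatten) ∧
      x ∈ T.headD [] ∧ ∀ p, below p (T'.headD []) ≤ below p (T.headD [])
  | i, [], _, _, h => by simp at h
  | 0, r :: T, ⟨h1, h2, h3, h4⟩, hnd, h => by
    obtain ⟨r, x, rfl⟩ : ∃ s x, r = s ++ [x] := by
      rcases List.eq_nil_or_concat r with rfl | ⟨s, x, rfl⟩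
      · exact absurd rfl h1
      · exact ⟨s, x, by rw [List.concat_eq_append]⟩
    have hx : ∀ a ∈ r, a < x := by
      intro a ha
      rw [List.pairwise_append] at h2
      exact h2.2.2 a ha x (by simp)
    simp only [zero_add, List.getD_cons_succ, List.getD_cons_zero, List.length_append,
      List.length_singleton] at h
    rcases r with _ | ⟨a, r⟩
    · have hT : T = [] := by
        cases T with
        | nil => rfl
        | cons s T =>
          have := h4.1
          simp only [List.getD_cons_zero, List.length_nil, zero_add, Nat.lt_one_iff] at h
          exact absurd (List.length_eq_zero_iff.1 h) this
      subst hT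
      refine ⟨x, [], trivial, rfl, by simp, by simp, ?_⟩
      intro p
      simp [below_nil]
    · refine ⟨x, (a :: r) :: T, ⟨by simp, ?_, ?_, h4⟩, ?_, ?_, by simp, ?_⟩
      · rw [List.pairwise_append] at h2
        exact h2.1
      · intro p
        have e1 := h3 p
        rw [below_append, show below p [x] = if x < p then 1 else 0
            by simp [below_cons, below_nil]] at e1
        split_ifs at e1 with hp
        · rw [below_eq_length fun b hb => (hx b hb).trans hp]
          refine (below_le_length _ _).trans ?_
          rw [show T.headD [] = T.getD 0 [] by cases T <;> rfl]
          omega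
        · omega
      · exact insertTableau_of_le T fun b hb => (hx b hb).le
      · simp only [List.flatten_cons, List.append_assoc]
        exact List.perm_middle
      · intro p
        simp only [List.headD_cons, below_append]
        omega
  | i + 1, r :: T, ⟨h1, h2, h3, h4⟩, hnd, h => by
    simp only [List.getD_cons_succ] at h
    simp only [List.flatten_cons, List.nodup_append'] at hnd
    obtain ⟨y, T', k1, k2, k3, k4, k5⟩ := exists_unbump h4 hnd.2.1 h
    have hyT : y ∈ T.flatten := k3.symm.subset (by simp)
    have hyr : y ∉ r := fun hy => hnd.2.2 hy hyT
    have hex : ∃ x ∈ r, x < y := by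
      -- Otherwise the row `r` has no entry below `y + 1`, whereas the next row contains `y`.
      by_contra! hc
      have e1 := h3 (y + 1)
      have e2 := below_lt_of_mem (p := 0) k4 (Nat.zero_le y) (Nat.lt_succ_self y)
      rw [below_eq_zero (l := r)] at e1
      · simp only [Nat.succ_eq_add_one] at e2
        omega
      · intro x hx
        refine lt_of_le_of_ne (hc x hx) ?_
        rintro rfl
        exact hyr hx
    obtain ⟨A, x, B, rfl, hxy, hB⟩ := exists_max_below h2 hyr hex
    have hA : ∀ a ∈ A, a < x := by
      intro a ha
      rw [List.pairwise_append] at h2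
      exact h2.2.2 a ha x (by simp)
    refine ⟨x, (A ++ y :: B) :: T', ⟨by simp, ?_, ?_, k1⟩, ?_, ?_, by simp, ?_⟩
    · exact pairwise_replace h2 (fun a ha => (hA a ha).trans hxy) hB
    · intro p
      have e1 := h3 p
      have e2 := h3 (y + 1)
      have e3 := k5 p
      simp only [below_append, below_cons] at e1 e2 ⊢
      by_cases hyp : y < p
      · rw [if_pos (hxy.trans hyp)] at e1
        rw [if_pos hyp]
        omega
      -- For `x < p ≤ y` the new row has one entry fewer below `p`. The next row compensates: its
      -- entry `y` is counted below `y + 1` but not below `p`.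
      · by_cases hxp : x < p
        · have e4 := below_lt_of_mem k4 (not_lt.1 hyp) (Nat.lt_succ_self y)
          rw [if_pos (by omega), below_eq_zero (l := B) fun b hb => hB b hb] at e2
          have e5 : below (y + 1) A = below p A := by
            rw [below_eq_length fun a ha => (hA a ha).trans hxp,
              below_eq_length fun a ha => (hA a ha).trans (by omega)]
          simp only [Nat.succ_eq_add_one] at e4
          omega
        · rw [if_neg hxp] at e1
          omega
    · rw [insertTableau_append T' (fun a ha => (hA a ha).le) hxy, k2]
    · simp only [List.flatten_cons, List.append_assoc, List.cons_append]
      refine List.perm_middle.trans (List.Perm.cons _ (List.Perm.append_left _ ?_))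
      exact (k3.append_left B).trans List.perm_middle
    · intro p
      simp only [List.headD_cons, below_append, below_cons]
      split_ifs <;> omega

/-- The largest entry of a tableau can be removed. -/
theorem exists_appendToRow : ∀ {m : ℕ} {Q : List (List ℕ)}, IsTab Q → m ∈ Q.flatten →
    (∀ e ∈ Q.flatten, e ≤ m) → Q.flatten.Nodup →
    ∃ i Q', IsTab Q' ∧ Q = appendToRow m i Q' ∧ i ≤ Q'.length ∧
      Q.flatten.Perm (m :: Q'.flatten) ∧
      (Q.getD (i + 1) []).length < (Q.getD i []).length ∧
      ∀ p, below p (Q'.headD []) ≤ below p (Q.headD [])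
  | m, [], _, hm, _, _ => by simp at hm
  | m, r :: T, ⟨h1, h2, h3, h4⟩, hm, hle, hnd => by
    simp only [List.flatten_cons, List.nodup_append'] at hnd
    by_cases hmr : m ∈ r
    · obtain ⟨r, x, rfl⟩ : ∃ s x, r = s ++ [x] := by
        rcases List.eq_nil_or_concat r with rfl | ⟨s, x, rfl⟩
        · exact absurd rfl h1
        · exact ⟨s, x, by rw [List.concat_eq_append]⟩
      have hx : ∀ a ∈ r, a < x := by
        intro a ha
        rw [List.pairwise_append] at h2
        exact h2.2.2 a ha x (by simp)
      obtain rfl : m = x := by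
        rcases List.mem_append.1 hmr with hmr | hmr
        · have e1 := hx m hmr
          have e2 := hle x (by simp)
          omega
        · simpa using hmr
      have hT : ∀ e ∈ T.flatten, e < m := by
        intro e he
        refine lt_of_le_of_ne
            (hle e (by simp only [List.flatten_cons, List.mem_append]; exact Or.inr he)) ?_
        rintro rfl
        exact hnd.2.2 (by simp) he
      have hs : ∀ e ∈ T.headD [], e < m := by
        intro e he
        cases T with
        | nil => simp at he
        | cons s T => exact hT e (by
            simp only [List.flatten_cons, List.mem_append]
            exact Or.inl he)
      -- Dropping the largest entry `m` affects only `p > m`. There all remaining entries are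
      -- counted, as they are already at `p = m`.
      have hAb : Above r (T.headD []) := by
        intro p
        have e1 := h3 p
        have e2 := h3 m
        rw [below_append, below_cons, below_nil] at e1 e2
        by_cases hp : m < p
        · rw [if_neg (lt_irrefl m)] at e2
          rw [below_eq_length fun b hb => (hx b hb).trans hp,
            below_eq_length fun b hb => (hs b hb).trans hp]
          rw [below_eq_length hx, below_eq_length hs] at e2
          omega
        · rw [if_neg hp] at e1
          omega
      have hlen := hAb.length_le
      rcases r with _ | ⟨a, r⟩
      · have hT : T = [] := by
          cases T with
          | nil => rfl
          | cons s T => exact absurd (List.length_eq_zero_iff.1 (Nat.le_zero.1 hlen)) h4.1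
        subst hT
        exact ⟨0, [], trivial, rfl, le_rfl, by simp, by simp, fun p => by simp [below_nil]⟩
      · refine ⟨0, (a :: r) :: T, ⟨by simp, ?_, hAb, h4⟩, rfl, by simp, ?_, ?_, ?_⟩
        · rw [List.pairwise_append] at h2
          exact h2.1
        · simp only [List.flatten_cons, List.append_assoc]
          exact List.perm_middle
        · rw [show T.headD [] = T.getD 0 [] by cases T <;> rfl] at hlen
          simp only [zero_add, List.getD_cons_succ, List.getD_cons_zero, List.length_append,
            List.length_singleton]
          omega
        · intro p
          simp only [List.headD_cons, below_append]
          omega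
    · have hmT : m ∈ T.flatten := by
        simp only [List.flatten_cons, List.mem_append] at hm
        exact hm.resolve_left hmr
      obtain ⟨i, Q', k1, k2, k3, k4, k5, k6⟩ := exists_appendToRow h4 hmT
        (fun e he => hle e (by simp only [List.flatten_cons, List.mem_append]; exact Or.inr he))
        hnd.2.1
      refine ⟨i + 1, r :: Q', ⟨h1, h2, fun p => (k6 p).trans (h3 p), k1⟩, ?_, by simpa using k3, ?_,
        by simpa using k5, fun p => le_rfl⟩
      · rw [appendToRow, ← k2]
      · simp only [List.flatten_cons]
        exact (k4.append_left r).trans List.perm_middle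

/-- The largest entry of `Q` marks a removable corner, at which insertion into `P` is undone. The
entries of `P` need only be distinct, since removing one leaves an arbitrary set. -/
theorem rskPair_surjective : ∀ (N : ℕ) {P Q : List (List ℕ)}, IsTab P → IsTab Q →
    P.map List.length = Q.map List.length → P.flatten.Nodup →
    Q.flatten.Perm (List.range' 1 N) → ∃ l : List ℕ, l.Perm P.flatten ∧ rskPair l = (P, Q)
  | 0, P, Q, hP, hQ, hlen, _, hQn => by
    have h1 : Q = [] := hQ.eq_nil (by simpa using hQn)
    subst h1
    have h2 : P = [] := by simpa using hlen
    subst h2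
    exact ⟨[], by simp, rfl⟩
  | N + 1, P, Q, hP, hQ, hlen, hPn, hQn => by
    have hnd : Q.flatten.Nodup := hQn.nodup_iff.2 List.nodup_range'
    obtain ⟨i, Q', k1, k2, k3, k4, k5, -⟩ := exists_appendToRow (m := N + 1) hQ
      (hQn.symm.subset (by rw [List.mem_range'_1]; omega)) (by
        intro e he
        have := hQn.subset he
        rw [List.mem_range'_1] at this
        omega) hnd
    have hget : ∀ j, (P.getD j []).length = (Q.getD j []).length := by
      intro j
      have e1 : ∀ T : List (List ℕ), (T.getD j []).length = (T.map List.length).getD j 0 :=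
        fun T => (List.getD_map T [] List.length).symm
      rw [e1, e1, hlen]
    obtain ⟨x, P', j1, j2, j3, -, -⟩ := exists_unbump hP hPn (i := i) (by rw [hget, hget]; exact k5)
    obtain ⟨g1, g2⟩ := map_length_insertTableau x P'
    rw [j2] at g1 g2
    have hlen' : P'.map List.length = Q'.map List.length := by
      apply incLen_injective_right (i := i)
      · simpa using g2
      · simpa using k3
      · exact j1.zero_notMem
      · exact k1.zero_notMem
      · rw [← g1, ← map_length_appendToRow (N + 1), ← k2]
        exact hlen
    have hQn' : Q'.flatten.Perm (List.range' 1 N) := by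
      have e1 := k4.symm.trans hQn
      rw [List.range'_concat, Nat.one_mul, Nat.add_comm 1] at e1
      exact (List.perm_cons _).1 (e1.trans (List.perm_append_singleton _ _))
    have hPn' := (j3.nodup_iff.1 hPn)
    obtain ⟨l, l1, l2⟩ := rskPair_surjective N j1 k1 hlen' (List.nodup_cons.1 hPn').2 hQn'
    have hN : l.length = N := by
      have e1 := l1.length_eq
      have e2 := hQn'.length_eq
      rw [List.length_flatten] at e1 e2
      rw [e1, hlen', e2, List.length_range']
    refine ⟨l ++ [x], ?_, ?_⟩
    · exact (List.perm_append_singleton x l).trans ((l1.cons x).trans j3.symm)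
    · rw [rskPair_snoc, l2, hN]
      dsimp only
      rw [j2, ← k2]

end CactusCrystal

namespace CactusCrystal

/-! ### Standard tableaux and lists of rows -/

theorem lt_below_iff {p : ℕ} : ∀ {s : List ℕ} {j : ℕ}, s.Pairwise (· < ·) → (h : j < s.length) →
    (j < below p s ↔ s[j] < p)
  | a :: s, j, hs, h => by
    rw [List.pairwise_cons] at hs
    rw [below_cons]
    by_cases ha : a < p
    · rw [if_pos ha]
      cases j with
      | zero => simpa using ha
      | succ j =>
        have := lt_below_iff (p := p) hs.2 (by simpa using h : j < s.length)
        simpa using this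
    · rw [if_neg ha, below_eq_zero fun b hb => (not_lt.1 ha).trans (hs.1 b hb).le]
      cases j with
      | zero => simpa using ha
      | succ j =>
        have := hs.1 _ (List.getElem_mem (by simpa using h : j < s.length))
        simp only [List.getElem_cons_succ]
        omega

theorem exists_shape {L : List ℕ} (h : Antitone fun i => L.getD i 0) :
    ∃ μ : YoungDiagram, ∀ i j, (i, j) ∈ μ ↔ j < L.getD i 0 := by
  have hs : L.SortedGE := by
    intro i j hij
    have := h (show (i : ℕ) ≤ j from hij)
    simpa using this
  refine ⟨YoungDiagram.ofRowLens L hs, fun i j => ?_⟩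
  rw [YoungDiagram.mem_ofRowLens]
  by_cases hi : i < L.length
  · simp [hi]
  · simp [hi]

theorem getD_map_length (R : List (List ℕ)) (i : ℕ) :
    (R.map List.length).getD i 0 = (R.getD i []).length :=
  List.getD_map R [] List.length

theorem IsTab.antitone {R : List (List ℕ)} (h : IsTab R) :
    Antitone fun i => (R.map List.length).getD i 0 := by
  apply antitone_nat_of_succ_le
  intro i
  rw [getD_map_length, getD_map_length]
  exact (h.getD.2 i).length_le

theorem getD_pairwise {R : List (List ℕ)} (h : IsTab R) (i : ℕ) :
    (R.getD i []).Pairwise (· < ·) := by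
  rw [List.getD_eq_getElem?_getD]
  cases hi : R[i]? with
  | none => simp
  | some r => exact (h.getD.1 r (List.mem_of_getElem? hi)).2

theorem mem_flatten_of_getD {R : List (List ℕ)} {i v : ℕ} (h : v ∈ R.getD i []) :
    v ∈ R.flatten := by
  rw [List.getD_eq_getElem?_getD] at h
  cases hi : R[i]? with
  | none => simp [hi] at h
  | some r =>
    rw [hi] at h
    exact List.mem_flatten.2 ⟨r, List.mem_of_getElem? hi, h⟩

theorem index_unique {R : List (List ℕ)} (h : R.flatten.Nodup) {i i' v : ℕ}
    (hv : v ∈ R.getD i []) (hv' : v ∈ R.getD i' []) : i = i' := by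
  have key : ∀ {i i' : ℕ}, i < i' → v ∈ R.getD i [] → v ∈ R.getD i' [] → False := by
    intro i i' hlt hv hv'
    have hi' : i' < R.length := by
      by_contra hc
      rw [List.getD_eq_default _ _ (not_lt.1 hc)] at hv'
      simp at hv'
    rw [List.getD_eq_getElem _ _ hi'] at hv'
    rw [List.getD_eq_getElem _ _ (hlt.trans hi')] at hv
    exact List.pairwise_iff_getElem.1 (List.nodup_flatten.1 h).2 i i' _ hi' hlt hv hv'
  rcases lt_trichotomy i i' with h | h | h
  · exact (key h hv hv').elim
  · exact h
  · exact (key h hv' hv).elim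

theorem exists_stdTableau {n : ℕ} {R : List (List ℕ)} (hR : IsTab R)
    (hn : R.flatten.Perm (List.range' 1 n)) {μ : YoungDiagram}
    (hμ : ∀ i j, (i, j) ∈ μ ↔ j < (R.map List.length).getD i 0) :
    μ.card = n ∧ ∃ T : StdTableau μ, HasRows T R := by
  have hnd : R.flatten.Nodup := hn.nodup_iff.2 List.nodup_range'
  have hμ' : ∀ {i j}, (i, j) ∈ μ ↔ j < (R.getD i []).length := fun {i j} => by
    rw [hμ, getD_map_length]
  have hent : ∀ {i j} (h : (i, j) ∈ μ), (R.getD i []).getD j 0 = (R.getD i [])[j]'(hμ'.1 h) :=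
    fun h => List.getD_eq_getElem _ _ _
  have hmem : ∀ {i j}, (i, j) ∈ μ → (R.getD i []).getD j 0 ∈ R.getD i [] := fun h => by
    rw [hent h]
    exact List.getElem_mem _
  have hinj : ∀ {i j i' j'}, (i, j) ∈ μ → (i', j') ∈ μ →
      (R.getD i []).getD j 0 = (R.getD i' []).getD j' 0 → (i, j) = (i', j') := by
    intro i j i' j' h h' he
    obtain rfl : i = i' := index_unique hnd (hmem h) (he ▸ hmem h')
    rw [hent h, hent h'] at he
    have h1 : (R.getD i []).Nodup := (getD_pairwise hR i).imp fun h => h.ne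
    rw [(h1.getElem_inj_iff).1 he]
  have hbij : Set.BijOn (fun c : ℕ × ℕ => (R.getD c.1 []).getD c.2 0) (μ.cells : Set (ℕ × ℕ))
      (Set.Icc 1 n) := by
    refine ⟨?_, ?_, ?_⟩
    · rintro ⟨i, j⟩ h
      have := hn.subset (mem_flatten_of_getD (hmem (YoungDiagram.mem_cells _ |>.1 h)))
      rw [List.mem_range'_1] at this
      exact ⟨this.1, by dsimp only; omega⟩
    · rintro ⟨i, j⟩ h ⟨i', j'⟩ h' he
      exact hinj h h' he
    · intro v hv
      have h1 : v ∈ R.flatten := hn.symm.subset (by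
        rw [List.mem_range'_1]
        exact ⟨hv.1, by have := hv.2; omega⟩)
      obtain ⟨r, hr, hvr⟩ := List.mem_flatten.1 h1
      obtain ⟨i, hi, rfl⟩ := List.getElem_of_mem hr
      obtain ⟨j, hj, rfl⟩ := List.getElem_of_mem hvr
      have h2 : R.getD i [] = R[i] := List.getD_eq_getElem _ _ hi
      refine ⟨(i, j), ?_, ?_⟩
      · exact hμ'.2 (by rw [h2]; exact hj)
      · dsimp only
        rw [h2]
        exact List.getD_eq_getElem _ _ hj
  have hcard : μ.card = n := by
    have := hbij.ncard_eq
    rw [Set.ncard_coe_finset, ← Finset.coe_Icc, Set.ncard_coe_finset] at this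
    simpa using this
  have hcol : ∀ {i j}, (i + 1, j) ∈ μ →
      (R.getD i []).getD j 0 < (R.getD (i + 1) []).getD j 0 := by
    intro i j h
    have h' := μ.up_left_mem (Nat.le_succ i) le_rfl h
    refine lt_of_le_of_ne ?_ fun he => by simpa using hinj h' h he
    have h1 := hR.getD.2 i ((R.getD (i + 1) []).getD j 0 + 1)
    rw [hent h] at h1 ⊢
    rw [hent h']
    have h2 := (lt_below_iff (p := (R.getD (i + 1) [])[j]'(hμ'.1 h) + 1) (getD_pairwise hR (i + 1))
      (hμ'.1 h)).2 (by omega)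
    have h3 := (lt_below_iff (getD_pairwise hR i) (hμ'.1 h')).1 (h2.trans_le h1)
    omega
  refine ⟨hcard, ⟨⟨fun i j => (R.getD i []).getD j 0, ?_, ?_, ?_⟩, hcard ▸ hbij⟩, fun i j => rfl⟩
  · intro i j1 j2 hj h
    rw [hent h, hent (μ.up_left_mem le_rfl hj.le h)]
    exact (List.pairwise_iff_getElem.1 (getD_pairwise hR i) _ _ _ _ hj).le
  · intro i1 i2 j hi h
    obtain ⟨d, rfl⟩ := Nat.exists_eq_add_of_lt hi
    clear hi
    induction d with
    | zero => exact hcol h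
    | succ d ih => exact (ih (μ.up_left_mem (by omega) le_rfl h)).trans (hcol h)
  · intro i j h
    rw [List.getD_eq_default]
    exact not_lt.1 (mt hμ'.2 h)

/-- Because the default value is not in the lists, reading it means being past the end, so lengths
are compared as well. -/
theorem eq_of_getD {X : Type} [DecidableEq X] {d : X} {l l' : List X} (hl : d ∉ l) (hl' : d ∉ l')
    (h : ∀ j, l.getD j d = l'.getD j d) : l = l' := by
  have key : ∀ {l : List X}, d ∉ l → ∀ j, l[j]? = if l.getD j d = d then none else
      some (l.getD j d) := by
    intro l hl j
    rw [List.getD_eq_getElem?_getD]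
    cases hj : l[j]? with
    | none => simp
    | some x =>
      have : x ≠ d := fun hx => hl (hx ▸ List.mem_of_getElem? hj)
      simp [this]
  apply List.ext_getElem?
  intro j
  rw [key hl, key hl', h]

theorem HasRows.unique {n : ℕ} {μ ν : YoungDiagram} {T : StdTableau μ} {S : StdTableau ν}
    {R R' : List (List ℕ)} (hTS : ∀ i j, T.1 i j = S.1 i j) (h : HasRows T R) (h' : HasRows S R')
    (hR : IsTab R) (hR' : IsTab R') (hn : R.flatten.Perm (List.range' 1 n))
    (hn' : R'.flatten.Perm (List.range' 1 n)) : R = R' := by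
  have key : ∀ {R : List (List ℕ)}, R.flatten.Perm (List.range' 1 n) → ∀ i, 0 ∉ R.getD i [] := by
    intro R hn i h0
    have := hn.subset (mem_flatten_of_getD h0)
    rw [List.mem_range'_1] at this
    omega
  refine eq_of_getD (d := []) (fun h0 => (hR.getD.1 _ h0).1 rfl) (fun h0 => (hR'.getD.1 _ h0).1 rfl)
    fun i => eq_of_getD (key hn i) (key hn' i) fun j => ?_
  rw [← h, ← h', hTS]

theorem exists_rows {n : ℕ} {μ : YoungDiagram} (hμ : μ.card = n) (T : StdTableau μ) :
    ∃ R, IsTab R ∧ R.flatten.Perm (List.range' 1 n) ∧ HasRows T R ∧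
      ∀ i, (R.map List.length).getD i 0 = μ.rowLen i := by
  obtain ⟨R, hRdef⟩ : ∃ R, R = (List.range (μ.colLen 0)).map
    fun i => (List.range (μ.rowLen i)).map (T.1 i) := ⟨_, rfl⟩
  have hcol : ∀ i, i < μ.colLen 0 ↔ 0 < μ.rowLen i := fun i => by
    rw [← YoungDiagram.mem_iff_lt_colLen, ← YoungDiagram.mem_iff_lt_rowLen]
  have hget : ∀ i, R.getD i [] = (List.range (μ.rowLen i)).map (T.1 i) := by
    intro i
    rw [hRdef]
    by_cases hi : i < μ.colLen 0
    · rw [List.getD_eq_getElem _ _ (by simpa using hi)]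
      simp
    · rw [List.getD_eq_default _ _ (by simpa using hi)]
      rw [hcol] at hi
      simp [Nat.le_zero.1 (not_lt.1 hi)]
  have hsorted : ∀ i, ((List.range (μ.rowLen i)).map (T.1 i)).Pairwise (· < ·) := by
    intro i
    rw [List.pairwise_map]
    refine (List.pairwise_lt_range (n := μ.rowLen i)).imp_of_mem ?_
    intro a b _ hb hab
    exact T.row_lt hab (YoungDiagram.mem_iff_lt_rowLen.2 (List.mem_range.1 hb))
  have hmem : ∀ v, v ∈ R.flatten ↔ ∃ i j, (i, j) ∈ μ ∧ T.1 i j = v := by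
    intro v
    simp only [hRdef, List.mem_flatten, List.mem_map, List.mem_range]
    constructor
    · rintro ⟨_, ⟨i, hi, rfl⟩, hv⟩
      obtain ⟨j, hj, rfl⟩ := List.mem_map.1 hv
      exact ⟨i, j, YoungDiagram.mem_iff_lt_rowLen.2 (List.mem_range.1 hj), rfl⟩
    · rintro ⟨i, j, h, rfl⟩
      have hj := YoungDiagram.mem_iff_lt_rowLen.1 h
      exact ⟨_, ⟨i, (hcol i).2 (by omega), rfl⟩, List.mem_map.2 ⟨j, List.mem_range.2 hj, rfl⟩⟩
  refine ⟨R, isTab_of ?_ ?_, ?_, ?_, ?_⟩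
  · intro r hr
    rw [hRdef] at hr
    obtain ⟨i, hi, rfl⟩ := List.mem_map.1 hr
    refine ⟨?_, hsorted i⟩
    have := (hcol i).1 (List.mem_range.1 hi)
    simp only [ne_eq, List.map_eq_nil_iff, List.range_eq_nil]
    omega
  · intro i p
    rw [hget, hget, below, below, List.countP_map, List.countP_map]
    have h1 : (List.range (μ.rowLen (i + 1))).Sublist (List.range (μ.rowLen i)) :=
      List.range_sublist.2 (μ.rowLen_anti _ _ (Nat.le_succ i))
    refine le_trans ?_ h1.countP_le
    apply List.countP_mono_left
    intro j hj hjp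
    have := T.1.col_strict (Nat.lt_add_one i)
      (YoungDiagram.mem_iff_lt_rowLen.2 (List.mem_range.1 hj))
    simp only [Function.comp_apply, decide_eq_true_eq] at hjp ⊢
    exact this.trans hjp
  · rw [List.perm_ext_iff_of_nodup _ List.nodup_range']
    · intro v
      rw [hmem, List.mem_range'_1]
      constructor
      · rintro ⟨i, j, h, rfl⟩
        have := T.entry_mem h
        omega
      · rintro ⟨h1, h2⟩
        obtain ⟨h3, h4⟩ := cellOf_spec T h1 (by omega)
        exact ⟨(cellOf T v).1, (cellOf T v).2, h3, h4⟩
    · rw [List.nodup_flatten]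
      constructor
      · intro r hr
        rw [hRdef] at hr
        obtain ⟨i, hi, rfl⟩ := List.mem_map.1 hr
        exact (hsorted i).imp fun h => h.ne
      · rw [hRdef, List.pairwise_map]
        refine (List.pairwise_lt_range (n := μ.colLen 0)).imp ?_
        intro a b hab
        rw [List.disjoint_left]
        intro v hv hv'
        obtain ⟨j, hj, rfl⟩ := List.mem_map.1 hv
        obtain ⟨j', hj', he⟩ := List.mem_map.1 hv'
        have := (entry_eq_iff T (YoungDiagram.mem_iff_lt_rowLen.2 (List.mem_range.1 hj'))
          (YoungDiagram.mem_iff_lt_rowLen.2 (List.mem_range.1 hj))).1 he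
        omega
  · intro i j
    rw [hget]
    by_cases hj : j < μ.rowLen i
    · rw [List.getD_eq_getElem _ _ (by simpa using hj)]
      simp
    · rw [List.getD_eq_default _ _ (by simpa using hj)]
      exact T.1.zeros (by rwa [YoungDiagram.mem_iff_lt_rowLen])
  · intro i
    rw [getD_map_length, hget]
    simp

/-! ### The Robinson–Schensted correspondence for permutations -/

theorem mem_iff_entry_pos {μ : YoungDiagram} (T : StdTableau μ) (i j : ℕ) :
    (i, j) ∈ μ ↔ T.1 i j ≠ 0 := by
  constructor
  · intro h
    have := (T.entry_mem h).1
    omega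
  · intro h
    by_contra hc
    exact h (T.1.zeros hc)

/-- Entries are positive exactly on the cells of the diagram, so the entry functions determine the
shape. -/
theorem tableauPair_ext {n : ℕ} {x y : Σ μ : Shape n, StdTableau μ.1 × StdTableau μ.1}
    (h : ∀ i j, x.2.1.1 i j = y.2.1.1 i j) (h' : ∀ i j, x.2.2.1 i j = y.2.2.1 i j) : x = y := by
  obtain ⟨⟨μ, hμ⟩, P, Q⟩ := x
  obtain ⟨⟨ν, hν⟩, P', Q'⟩ := y
  dsimp only at h h'
  obtain rfl : μ = ν := by
    ext ⟨i, j⟩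
    rw [YoungDiagram.mem_cells, YoungDiagram.mem_cells, mem_iff_entry_pos P,
        mem_iff_entry_pos P', h]
  rw [show P = P' from Subtype.ext (SemistandardYoungTableau.ext h),
    show Q = Q' from Subtype.ext (SemistandardYoungTableau.ext h')]

theorem nodup_oneLine {n : ℕ} (w : Equiv.Perm (Fin n)) : (oneLine w).Nodup := by
  rw [oneLine, List.nodup_ofFn]
  intro j k h
  exact w.injective (Fin.ext (by simpa using h))

theorem length_oneLine {n : ℕ} (w : Equiv.Perm (Fin n)) : (oneLine w).length = n := by
  simp [oneLine]

theorem perm_oneLine {n : ℕ} (w : Equiv.Perm (Fin n)) :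
    (oneLine w).Perm (List.range' 1 n) := by
  rw [List.perm_ext_iff_of_nodup (nodup_oneLine w) List.nodup_range']
  intro v
  rw [oneLine, List.mem_ofFn, List.mem_range'_1]
  constructor
  · rintro ⟨k, rfl⟩
    have := (w k).2
    omega
  · rintro ⟨h1, h2⟩
    exact ⟨w⁻¹ ⟨v - 1, by omega⟩, by simp; omega⟩

theorem exists_perm_of_perm_range {n : ℕ} {l : List ℕ} (h : l.Perm (List.range' 1 n)) :
    ∃ w : Equiv.Perm (Fin n), oneLine w = l := by
  have hlen : l.length = n := by rw [h.length_eq, List.length_range']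
  have hnd : l.Nodup := h.nodup_iff.2 List.nodup_range'
  have hb : ∀ k (hk : k < l.length), 1 ≤ l[k] ∧ l[k] < 1 + n := fun k hk =>
    List.mem_range'_1.1 (h.subset (List.getElem_mem hk))
  have hinj : Function.Injective fun k : Fin n =>
      (⟨l[(k : ℕ)]'(by omega) - 1, by have := hb k (by omega); omega⟩ : Fin n) := by
    intro j k hjk
    simp only [Fin.mk.injEq] at hjk
    have h1 := hb j (by omega)
    have h2 := hb k (by omega)
    exact Fin.ext ((hnd.getElem_inj_iff (hi := by omega) (hj := by omega)).1 (by omega))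
  refine ⟨Equiv.ofBijective _ (Finite.injective_iff_bijective.1 hinj), ?_⟩
  apply List.ext_getElem
  · rw [length_oneLine, hlen]
  · intro k h1 h2
    have := hb k h2
    simp only [oneLine, List.getElem_ofFn, Equiv.ofBijective_apply]
    omega

theorem oneLine_injective {n : ℕ} : Function.Injective (oneLine (n := n)) := by
  intro w w' h
  ext k
  have := congrFun (List.ofFn_injective h) k
  simpa using this

theorem rskPair_oneLine {n : ℕ} (w : Equiv.Perm (Fin n)) :
    IsTab (rskPair (oneLine w)).1 ∧ IsTab (rskPair (oneLine w)).2 ∧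
      (rskPair (oneLine w)).1.flatten.Perm (List.range' 1 n) ∧
      (rskPair (oneLine w)).2.flatten.Perm (List.range' 1 n) ∧
      (rskPair (oneLine w)).1.map List.length = (rskPair (oneLine w)).2.map List.length := by
  obtain ⟨h1, h2, h3, h4, h5⟩ := rskPair_spec _ (nodup_oneLine w)
  rw [length_oneLine] at h4
  exact ⟨h1, h2, h3.trans (perm_oneLine w), h4, h5⟩

theorem existsUnique_rsk (n : ℕ) :
    ∃! rsk : Equiv.Perm (Fin n) ≃ (Σ μ : Shape n, StdTableau μ.1 × StdTableau μ.1), IsRSK rsk := by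
  have hex : ∀ w : Equiv.Perm (Fin n), ∃ x : Σ μ : Shape n, StdTableau μ.1 × StdTableau μ.1,
      HasRows x.2.1 (rskPair (oneLine w)).1 ∧ HasRows x.2.2 (rskPair (oneLine w)).2 := by
    intro w
    obtain ⟨h1, h2, h3, h4, h5⟩ := rskPair_oneLine w
    obtain ⟨μ, hμ⟩ := exists_shape h1.antitone
    obtain ⟨hc, P, hP⟩ := exists_stdTableau h1 h3 hμ
    rw [h5] at hμ
    obtain ⟨-, Q, hQ⟩ := exists_stdTableau h2 h4 hμ
    exact ⟨⟨⟨μ, hc⟩, P, Q⟩, hP, hQ⟩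
  choose F hF using hex
  have hbij : Function.Bijective F := by
    constructor
    · intro w w' h
      obtain ⟨h1, h2, h3, h4, h5⟩ := rskPair_oneLine w
      obtain ⟨h1', h2', h3', h4', h5'⟩ := rskPair_oneLine w'
      apply oneLine_injective
      apply rskPair_injective (nodup_oneLine w) (nodup_oneLine w')
      · rw [length_oneLine, length_oneLine]
      · exact Prod.ext
          (HasRows.unique (fun i j => by rw [h]) (hF w).1 (hF w').1 h1 h1' h3 h3')
          (HasRows.unique (fun i j => by rw [h]) (hF w).2 (hF w').2 h2 h2' h4 h4')
    · rintro ⟨μ, P, Q⟩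
      obtain ⟨R, r1, r2, r3, r4⟩ := exists_rows μ.2 P
      obtain ⟨S, s1, s2, s3, s4⟩ := exists_rows μ.2 Q
      obtain ⟨l, l1, l2⟩ := rskPair_surjective n r1 s1
        (eq_of_getD r1.zero_notMem s1.zero_notMem fun j => by rw [r4, s4])
        (r2.nodup_iff.2 List.nodup_range') s2
      obtain ⟨w, rfl⟩ := exists_perm_of_perm_range (l1.trans r2)
      refine ⟨w, ?_⟩
      have h := hF w
      rw [l2] at h
      apply tableauPair_ext
      · intro i j
        rw [h.1, r3]
      · intro i j
        rw [h.2, s3]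
  refine ⟨Equiv.ofBijective F hbij, hF, fun rsk h => Equiv.ext fun w => tableauPair_ext ?_ ?_⟩
  · intro i j
    rw [(h w).1, Equiv.ofBijective_apply, (hF w).1]
  · intro i j
    rw [(h w).2, Equiv.ofBijective_apply, (hF w).2]

end CactusCrystal

/-! ### Row insertion as a sequence of lowering operators -/

namespace CactusCrystal

open StringData

/-! ### Lowering as far as possible -/

/-- Apply `f_i` as often as possible. -/
def lowerMax (i : ℕ) (l : List ℕ) : List ℕ :=
  (fun l => ((wordData i).f l).getD l)^[(wordData i).φ l] l

theorem lowerMax_of_f {i : ℕ} {l l' : List ℕ} (h : (wordData i).f l = some l') :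
    lowerMax i l = lowerMax i l' := by
  have h1 := (wordData i).φ_f _ _ h
  rw [lowerMax, h1, Function.iterate_succ_apply, h]
  rfl

theorem lowerMax_of_φ {i : ℕ} {l : List ℕ} (h : (wordData i).φ l = 0) : lowerMax i l = l := by
  rw [lowerMax, h]
  rfl

theorem Auto.lowerMax {n N : ℕ} {g : List ℕ → List ℕ} (h : Auto n N g) {i : ℕ} (hi : i + 1 < n)
    {l : List ℕ} (hl : IsWord n l) (hN : l.length = N) :
    lowerMax i (g l) = g (lowerMax i l) ∧ IsWord n (CactusCrystal.lowerMax i l) ∧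
      (CactusCrystal.lowerMax i l).length = N := by
  induction hk : (wordData i).φ l generalizing l with
  | zero =>
    rw [lowerMax_of_φ hk, lowerMax_of_φ (by rw [h.φ_eq hl hN hi, hk])]
    exact ⟨rfl, hl, hN⟩
  | succ k ih =>
    obtain ⟨l', hl'⟩ := (wordData i).exists_f (x := l) (by omega)
    have h1 := (wordData i).φ_f _ _ hl'
    have h2 := h.f l hl hN i hi
    rw [hl', Option.map_some] at h2
    rw [lowerMax_of_f hl', lowerMax_of_f h2]
    exact ih (isWord_of_f hi hl' hl) (by rw [(letter i).list_f_length hl', hN]) (by omega)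

/-- Apply `f_{t-1}`, …, `f_0`, each as often as possible. -/
def sweep : ℕ → List ℕ → List ℕ
  | 0, l => l
  | t + 1, l => sweep t (lowerMax t l)

/-- The state of the word after `t` insertions. -/
def lam : ℕ → List ℕ → List ℕ
  | 0, l => l
  | t + 1, l => sweep t (lam t l)

theorem Auto.sweep {n N : ℕ} {g : List ℕ → List ℕ} (h : Auto n N g) : ∀ {t : ℕ}, t < n →
    ∀ {l : List ℕ}, IsWord n l → l.length = N → CactusCrystal.sweep t (g l) =
      g (CactusCrystal.sweep t l) ∧
      IsWord n (CactusCrystal.sweep t l) ∧ (CactusCrystal.sweep t l).length = N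
  | 0, _, _, hl, hN => ⟨rfl, hl, hN⟩
  | t + 1, ht, l, hl, hN => by
    obtain ⟨h1, h2, h3⟩ := h.lowerMax ht hl hN
    rw [CactusCrystal.sweep, CactusCrystal.sweep, h1]
    exact h.sweep (by omega) h2 h3

theorem Auto.lam {n N : ℕ} {g : List ℕ → List ℕ} (h : Auto n N g) {l : List ℕ} (hl : IsWord n l)
    (hN : l.length = N) : ∀ {t : ℕ}, t ≤ n → CactusCrystal.lam t (g l) = g (CactusCrystal.lam t l) ∧
      IsWord n (CactusCrystal.lam t l) ∧ (CactusCrystal.lam t l).length = N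
  | 0, _ => ⟨rfl, hl, hN⟩
  | t + 1, ht => by
    obtain ⟨h1, h2, h3⟩ := Auto.lam h hl hN (t := t) (by omega)
    rw [CactusCrystal.lam, CactusCrystal.lam, h1]
    exact h.sweep (by omega) h2 h3

/-! ### An explicit formula -/

/-- `l'` is obtained from `l` by applying `f_i` some number of times. -/
def Down (i : ℕ) : List ℕ → List ℕ → Prop :=
  Relation.ReflTransGen fun l l' => (wordData i).f l = some l'

theorem Down.φ_le {i : ℕ} {l l' : List ℕ} (h : Down i l l') :
    (wordData i).φ l' ≤ (wordData i).φ l := by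
  induction h with
  | refl => exact le_rfl
  | tail _ h ih =>
    have := (wordData i).φ_f _ _ h
    omega

theorem Down.lowerMax {i : ℕ} {l l' : List ℕ} (h : Down i l l') :
    lowerMax i l = lowerMax i l' := by
  induction h with
  | refl => rfl
  | tail _ h ih => rw [ih, lowerMax_of_f h]

theorem Down.cons {i x : ℕ} {l l' : List ℕ} (h : Down i l l')
    (hx : (letter i).ε x ≤ (wordData i).φ l') : Down i (x :: l) (x :: l') := by
  induction h using Relation.ReflTransGen.head_induction_on with
  | refl => exact Relation.ReflTransGen.refl
  | @head a b h h' ih =>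
    refine Relation.ReflTransGen.head ?_ ih
    have h1 := (wordData i).φ_f _ _ h
    have h2 := Down.φ_le (i := i) h'
    simp only [wordData] at h h1 h2 hx ⊢
    rw [list_f_cons, if_neg (by omega), h]
    rfl

theorem Down.head {i : ℕ} {l : List ℕ} (h : (wordData i).φ l = 0) :
    Down i (i :: l) ((i + 1) :: l) := by
  apply Relation.ReflTransGen.single
  simp only [wordData] at h ⊢
  rw [list_f_cons, if_pos (by omega)]
  simp [letter]

/-- Raise all letters `i`. -/
def raiseAll (i : ℕ) (l : List ℕ) : List ℕ := l.map fun z => if z = i then i + 1 else z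

/-- Raise all letters `i` but the first one. -/
def keepFirst (i : ℕ) : List ℕ → List ℕ
  | [] => []
  | z :: l => if z = i then i :: raiseAll i l else z :: keepFirst i l

/-- Raise all letters `i` but the first one which follows a letter `i + 1`. -/
def bumpWord (i : ℕ) : List ℕ → List ℕ
  | [] => []
  | z :: l => if z = i + 1 then (i + 1) :: keepFirst i l else
    (if z = i then i + 1 else z) :: bumpWord i l

theorem word_φ_cons (i x : ℕ) (l : List ℕ) : (wordData i).φ (x :: l) =
    (if x = i then 1 else 0) + ((wordData i).φ l - if x = i + 1 then 1 else 0) := by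
  simp only [wordData]
  rw [list_φ_cons]
  rfl

theorem down_raiseAll {i : ℕ} : ∀ {l : List ℕ}, i + 1 ∉ l →
    Down i l (raiseAll i l) ∧ (wordData i).φ (raiseAll i l) = 0
  | [], _ => ⟨Relation.ReflTransGen.refl, rfl⟩
  | z :: l, h => by
    simp only [List.mem_cons, not_or] at h
    obtain ⟨h1, h2⟩ := down_raiseAll h.2
    have e1 : raiseAll i (z :: l) = (if z = i then i + 1 else z) :: raiseAll i l := rfl
    have e2 : (letter i).ε z = 0 := if_neg (Ne.symm h.1)
    rw [e1]
    have h3 := h1.cons (x := z) (by omega)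
    by_cases hz : z = i
    · subst hz
      rw [if_pos rfl, word_φ_cons, h2]
      exact ⟨h3.trans (Down.head h2), by simp⟩
    · rw [if_neg hz, word_φ_cons, h2]
      exact ⟨h3, by simp [hz]⟩

theorem down_keepFirst {i : ℕ} : ∀ {l : List ℕ}, i + 1 ∉ l →
    Down i l (keepFirst i l) ∧ (wordData i).φ (keepFirst i l) = if i ∈ l then 1 else 0
  | [], _ => ⟨Relation.ReflTransGen.refl, by simp [keepFirst]⟩
  | z :: l, h => by
    simp only [List.mem_cons, not_or] at h
    have e2 : (letter i).ε z = 0 := if_neg (Ne.symm h.1)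
    by_cases hz : z = i
    · subst hz
      obtain ⟨h1, h2⟩ := down_raiseAll h.2
      have h3 := h1.cons (x := z) (by omega)
      rw [keepFirst, if_pos rfl, word_φ_cons, h2]
      exact ⟨h3, by simp⟩
    · obtain ⟨h1, h2⟩ := down_keepFirst h.2
      have h3 := h1.cons (x := z) (by omega)
      rw [keepFirst, if_neg hz, word_φ_cons, h2]
      refine ⟨h3, ?_⟩
      simp only [List.mem_cons, hz, Ne.symm hz, false_or, if_false]
      rw [if_neg (Ne.symm h.1)]
      omega

/-- In the signature rule a letter `i + 1` cancels the nearest free letter `i` to its right. With at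
most one `i + 1`, every `i` is raised except the first one after it. -/
theorem down_bumpWord {i : ℕ} : ∀ {l : List ℕ}, l.count (i + 1) ≤ 1 →
    Down i l (bumpWord i l) ∧ (wordData i).φ (bumpWord i l) = 0
  | [], _ => ⟨Relation.ReflTransGen.refl, rfl⟩
  | z :: l, h => by
    by_cases hz1 : z = i + 1
    · subst hz1
      rw [List.count_cons_self] at h
      have h0 : i + 1 ∉ l := by
        rw [← List.count_eq_zero]
        omega
      obtain ⟨h1, h2⟩ := down_keepFirst h0
      rw [bumpWord, if_pos rfl]
      by_cases hil : i ∈ l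
      · rw [if_pos hil] at h2
        refine ⟨h1.cons ?_, ?_⟩
        · rw [h2]
          exact (if_pos rfl).le
        · rw [word_φ_cons, h2]
          simp
      · have h3 : keepFirst i l = l := by
          clear h h0 h1 h2
          induction l with
          | nil => rfl
          | cons a l ih =>
            simp only [List.mem_cons, not_or] at hil
            rw [keepFirst, if_neg (Ne.symm hil.1), ih hil.2]
        rw [if_neg hil] at h2
        rw [word_φ_cons, h2, h3]
        exact ⟨Relation.ReflTransGen.refl, by simp⟩
    · rw [List.count_cons_of_ne hz1] at h
      have e2 : (letter i).ε z = 0 := if_neg hz1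
      obtain ⟨h1, h2⟩ := down_bumpWord h
      have h3 := h1.cons (x := z) (by omega)
      rw [bumpWord, if_neg hz1]
      by_cases hz : z = i
      · subst hz
        rw [if_pos rfl, word_φ_cons, h2]
        exact ⟨h3.trans (Down.head h2), by simp⟩
      · rw [if_neg hz, word_φ_cons, h2]
        exact ⟨h3, by simp [hz]⟩

theorem lowerMax_eq_bumpWord {i : ℕ} {l : List ℕ} (h : l.count (i + 1) ≤ 1) :
    lowerMax i l = bumpWord i l := by
  obtain ⟨h1, h2⟩ := down_bumpWord h
  rw [h1.lowerMax, lowerMax_of_φ h2]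

/-! ### Positions of letters -/

/-- The positions of the letter `i`, counted from `k`. -/
def pos (i : ℕ) : ℕ → List ℕ → List ℕ
  | _, [] => []
  | k, z :: l => if z = i then k :: pos i (k + 1) l else pos i (k + 1) l

theorem mem_pos {i v : ℕ} : ∀ {k : ℕ} {l : List ℕ}, v ∈ pos i k l ↔ k ≤ v ∧ l[v - k]? = some i
  | k, [] => by simp [pos]
  | k, z :: l => by
    have ih := mem_pos (i := i) (v := v) (k := k + 1) (l := l)
    have e : k + 1 ≤ v → (z :: l)[v - k]? = l[v - (k + 1)]? := by
      intro h
      rw [show v - k = v - (k + 1) + 1 by omega, List.getElem?_cons_succ]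
    rw [pos]
    rcases lt_trichotomy v k with h | h | h
    · split_ifs <;> simp only [List.mem_cons, ih] <;> omega
    · subst h
      split_ifs with hz
      · simp [hz]
      · rw [ih]
        simp [hz]
    · rw [e (by omega)]
      split_ifs <;> simp only [List.mem_cons, ih] <;> constructor <;> intro h' <;>
        first
        | exact ⟨by omega, h'.2⟩
        | exact Or.inr ⟨by omega, h'.2⟩
        | exact ⟨by omega, (h'.resolve_left (by omega)).2⟩

theorem length_pos (i : ℕ) : ∀ (k : ℕ) (l : List ℕ), (pos i k l).length = l.count i
  | _, [] => rfl
  | k, z :: l => by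
    rw [pos, List.count_cons, ← length_pos i (k + 1) l]
    split_ifs <;> simp_all

theorem pos_eq_nil {i k : ℕ} {l : List ℕ} : pos i k l = [] ↔ i ∉ l := by
  rw [← List.length_eq_zero_iff, length_pos, List.count_eq_zero]

theorem pos_raiseAll {i : ℕ} : ∀ {k : ℕ} {l : List ℕ}, i + 1 ∉ l →
    pos (i + 1) k (raiseAll i l) = pos i k l ∧ pos i k (raiseAll i l) = []
  | _, [], _ => ⟨rfl, rfl⟩
  | k, z :: l, h => by
    simp only [List.mem_cons, not_or] at h
    obtain ⟨h1, h2⟩ := pos_raiseAll (k := k + 1) h.2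
    have e1 : raiseAll i (z :: l) = (if z = i then i + 1 else z) :: raiseAll i l := rfl
    rw [e1]
    by_cases hz : z = i
    · simp [pos, hz, h1, h2]
    · simp [pos, hz, h1, h2, Ne.symm h.1]

theorem pos_raiseAll_of_ne {i j : ℕ} (h : j ≠ i) (h' : j ≠ i + 1) : ∀ (k : ℕ) (l : List ℕ),
    pos j k (raiseAll i l) = pos j k l
  | _, [] => rfl
  | k, z :: l => by
    have h1 := pos_raiseAll_of_ne h h' (k + 1) l
    have e1 : raiseAll i (z :: l) = (if z = i then i + 1 else z) :: raiseAll i l := rfl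
    rw [e1]
    by_cases hz : z = i
    · simp [pos, hz, h1, Ne.symm h, Ne.symm h']
    · simp [pos, hz, h1]

theorem pos_keepFirst {i x : ℕ} : ∀ {k : ℕ} {l : List ℕ}, i + 1 ∉ l → x < k →
    x :: pos (i + 1) k (keepFirst i l) = (rowInsert x (pos i k l)).1 ∧
      pos i k (keepFirst i l) = (rowInsert x (pos i k l)).2.toList
  | _, [], _, _ => ⟨rfl, rfl⟩
  | k, z :: l, h, hx => by
    simp only [List.mem_cons, not_or] at h
    by_cases hz : z = i
    · obtain ⟨h1, h2⟩ := pos_raiseAll (k := k + 1) h.2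
      simp [pos, hz, keepFirst, h1, h2, rowInsert, hx]
    · obtain ⟨h1, h2⟩ := pos_keepFirst (x := x) (k := k + 1) h.2 (by omega)
      rw [keepFirst, if_neg hz, pos, if_neg (Ne.symm h.1), pos, if_neg hz, pos, if_neg hz]
      exact ⟨h1, h2⟩

theorem pos_keepFirst_of_ne {i j : ℕ} (h : j ≠ i) (h' : j ≠ i + 1) : ∀ (k : ℕ) (l : List ℕ),
    pos j k (keepFirst i l) = pos j k l
  | _, [] => rfl
  | k, z :: l => by
    by_cases hz : z = i
    · rw [keepFirst, if_pos hz, pos, if_neg (Ne.symm h), pos, if_neg (hz ▸ Ne.symm h),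
        pos_raiseAll_of_ne h h']
    · rw [keepFirst, if_neg hz, pos, pos, pos_keepFirst_of_ne h h' (k + 1) l]

theorem pos_bumpWord_of_ne {i j : ℕ} (h : j ≠ i) (h' : j ≠ i + 1) : ∀ (k : ℕ) (l : List ℕ),
    pos j k (bumpWord i l) = pos j k l
  | _, [] => rfl
  | k, z :: l => by
    by_cases hz1 : z = i + 1
    · rw [bumpWord, if_pos hz1, pos, if_neg (Ne.symm h'), pos, if_neg (hz1 ▸ Ne.symm h'),
        pos_keepFirst_of_ne h h']
    · rw [bumpWord, if_neg hz1]
      by_cases hz : z = i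
      · rw [if_pos hz, pos, if_neg (Ne.symm h'), pos, if_neg (hz ▸ Ne.symm h),
          pos_bumpWord_of_ne h h' (k + 1) l]
      · rw [if_neg hz, pos, pos, pos_bumpWord_of_ne h h' (k + 1) l]

/-- Lowering performs the row insertion of the position of the letter `i + 1`. -/
theorem pos_bumpWord {i x : ℕ} : ∀ {k : ℕ} {l : List ℕ}, pos (i + 1) k l = [x] →
    pos (i + 1) k (bumpWord i l) = (rowInsert x (pos i k l)).1 ∧
      pos i k (bumpWord i l) = (rowInsert x (pos i k l)).2.toList
  | _, [], h => by simp [pos] at h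
  | k, z :: l, h => by
    rw [pos] at h
    by_cases hz1 : z = i + 1
    · rw [if_pos hz1, List.cons.injEq, pos_eq_nil] at h
      obtain ⟨rfl, h⟩ := h
      obtain ⟨h1, h2⟩ := pos_keepFirst (x := k) (k := k + 1) h (by omega)
      rw [bumpWord, if_pos hz1, pos, if_pos rfl, pos, if_neg (by omega), pos, if_neg (by omega)]
      exact ⟨h1, h2⟩
    · rw [if_neg hz1] at h
      obtain ⟨h1, h2⟩ := pos_bumpWord h
      have hxk : k < x := (mem_pos.1 (show x ∈ pos (i + 1) (k + 1) l by rw [h]; simp)).1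
      rw [bumpWord, if_neg hz1]
      by_cases hz : z = i
      · subst hz
        have e1 : pos (z + 1) k ((z + 1) :: bumpWord z l) =
            k :: pos (z + 1) (k + 1) (bumpWord z l) := by rw [pos, if_pos rfl]
        have e2 : pos z k ((z + 1) :: bumpWord z l) = pos z (k + 1) (bumpWord z l) := by
          rw [pos, if_neg (by omega)]
        have e3 : pos z k (z :: l) = k :: pos z (k + 1) l := by rw [pos, if_pos rfl]
        rw [if_pos rfl, e1, e2, e3, h1, h2, rowInsert, if_neg (by omega)]
        exact ⟨rfl, rfl⟩
      · rw [if_neg hz, pos, if_neg hz1, pos, if_neg hz, pos, if_neg hz]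
        exact ⟨h1, h2⟩

theorem pos_bumpWord_of_notMem {i : ℕ} : ∀ {k : ℕ} {l : List ℕ}, i + 1 ∉ l →
    pos (i + 1) k (bumpWord i l) = pos i k l ∧ pos i k (bumpWord i l) = []
  | _, [], _ => ⟨rfl, rfl⟩
  | k, z :: l, h => by
    simp only [List.mem_cons, not_or] at h
    obtain ⟨h1, h2⟩ := pos_bumpWord_of_notMem (k := k + 1) h.2
    rw [bumpWord, if_neg (Ne.symm h.1)]
    by_cases hz : z = i
    · simp [pos, hz, h1, h2]
    · simp [pos, hz, h1, h2, Ne.symm h.1]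

/-! ### Insertion as lowering -/

/-- When no bumped entry is pending, the sweep merely turns each letter `j < t` into `j + 1`. Rows
keep their contents; the shift reflects that rows are numbered from the largest letter used. -/
theorem pos_sweep_of_notMem (k : ℕ) : ∀ {t : ℕ} {l : List ℕ}, t ∉ l →
    (∀ j < t, pos (j + 1) k (sweep t l) = pos j k l) ∧ pos 0 k (sweep t l) = [] ∧
      ∀ j > t, pos j k (sweep t l) = pos j k l
  | 0, l, h => ⟨by simp, pos_eq_nil.2 h, fun _ _ => rfl⟩
  | t + 1, l, h => by
    have e1 := lowerMax_eq_bumpWord (i := t) (l := l) (by rw [List.count_eq_zero.2 h]; omega)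
    obtain ⟨h1, h2⟩ := pos_bumpWord_of_notMem (k := k) h
    obtain ⟨h3, h4, h5⟩ := pos_sweep_of_notMem k (pos_eq_nil.1 h2)
    rw [sweep, e1]
    refine ⟨fun j hj => ?_, h4, fun j hj => ?_⟩
    · rcases (show j ≤ t by omega).eq_or_lt with rfl | hjt
      · rw [h5 _ (by omega), h1]
      · rw [h3 j hjt, pos_bumpWord_of_ne (by omega) (by omega)]
    · rw [h5 j (by omega), pos_bumpWord_of_ne (by omega) (by omega)]

theorem getD_insertTableau (x : ℕ) (R : List (List ℕ)) :
    (insertTableau x R).1.getD 0 [] = (rowInsert x (R.getD 0 [])).1 ∧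
      ((rowInsert x (R.getD 0 [])).2 = none → ∀ r, (insertTableau x R).1.getD (r + 1) [] =
        R.getD (r + 1) []) ∧
      ∀ y, (rowInsert x (R.getD 0 [])).2 = some y → ∀ r, (insertTableau x R).1.getD (r + 1) [] =
        (insertTableau y R.tail).1.getD r [] := by
  cases R with
  | nil => simp [insertTableau, rowInsert]
  | cons r T =>
    rcases rowInsert_cases x r with h | ⟨A, y, B, rfl, hA, hy⟩
    · rw [insertTableau_of_le T h]
      simp [rowInsert_of_le h]
    · rw [insertTableau_append T hA hy]
      simp [rowInsert_append hA hy]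

/-- Row `r` consists of the positions of the letter `m - 1 - r`, and the letter `m` marks the
position `x` to be inserted. Each maximal lowering inserts into one row, and the bumped entry
becomes the only position of the next smaller letter, ready for insertion into the row below. -/
theorem insertTableau_sweep (k : ℕ) : ∀ {m x : ℕ} {R : List (List ℕ)} {b : List ℕ},
    (∀ r, R.getD r [] = if r < m then pos (m - 1 - r) k b else []) → pos m k b = [x] →
    (∀ r, (insertTableau x R).1.getD r [] =
      if r < m + 1 then pos (m - r) k (sweep m b) else []) ∧
      ∀ j > m, pos j k (sweep m b) = pos j k b
  | 0, x, R, b, hR, hx => by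
    have hR' : R.getD 0 [] = [] := by rw [hR, if_neg (by omega)]
    obtain ⟨h1, h2, -⟩ := getD_insertTableau x R
    rw [hR'] at h1 h2
    refine ⟨fun r => ?_, fun _ _ => rfl⟩
    rcases r with _ | r
    · rw [h1, if_pos (by omega)]
      exact hx.symm
    · rw [h2 rfl, hR, if_neg (by omega), if_neg (by omega)]
  | m + 1, x, R, b, hR, hx => by
    obtain ⟨h1, h2, h3⟩ := getD_insertTableau x R
    have hR0 : R.getD 0 [] = pos m k b := by
      rw [hR, if_pos (by omega)]
      rfl
    rw [hR0] at h1 h2 h3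
    have e1 := lowerMax_eq_bumpWord (i := m) (l := b) (by rw [← length_pos (m + 1) k, hx]; rfl)
    obtain ⟨g1, g2⟩ := pos_bumpWord hx
    rw [sweep, e1]
    cases hc : (rowInsert x (pos m k b)).2 with
    | none =>
      rw [hc] at g2
      obtain ⟨h4, h5, h6⟩ := pos_sweep_of_notMem k (pos_eq_nil.1 g2)
      refine ⟨fun r => ?_, fun j hj => ?_⟩
      · rcases r with _ | r
        · rw [h1, if_pos (by omega), Nat.sub_zero, h6 _ (by omega), g1]
        · rw [h2 hc, hR]
          by_cases hr : r + 1 < m + 1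
          · rw [if_pos hr, if_pos (by omega), show m + 1 - (r + 1) = (m - 1 - r) + 1 by omega,
              h4 _ (by omega), pos_bumpWord_of_ne (by omega) (by omega)]
            congr 1
            omega
          · rw [if_neg hr]
            split_ifs with hr'
            · rw [show m + 1 - (r + 1) = 0 by omega, h5]
            · rfl
      · rw [h6 j (by omega), pos_bumpWord_of_ne (by omega) (by omega)]
    | some y =>
      rw [hc] at g2
      have hT : ∀ r, R.tail.getD r [] = if r < m then pos (m - 1 - r) k (bumpWord m b) else [] := by
        intro r
        have e2 : R.tail.getD r [] = R.getD (r + 1) [] := by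
          cases R <;> simp
        rw [e2, hR]
        by_cases hr : r < m
        · rw [if_pos (by omega), if_pos hr, pos_bumpWord_of_ne (by omega) (by omega)]
          congr 1
          omega
        · rw [if_neg (by omega), if_neg hr]
      obtain ⟨h4, h5⟩ := insertTableau_sweep k hT g2
      refine ⟨fun r => ?_, fun j hj => ?_⟩
      · rcases r with _ | r
        · rw [h1, if_pos (by omega), Nat.sub_zero, h5 _ (by omega), g1]
        · rw [h3 y hc, h4]
          by_cases hr : r < m + 1
          · rw [if_pos hr, if_pos (by omega)]
            congr 1
            omega
          · rw [if_neg hr, if_neg (by omega)]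
      · rw [h5 j (by omega), pos_bumpWord_of_ne (by omega) (by omega)]

theorem pos_permWord {n : ℕ} (w : Equiv.Perm (Fin n)) (t : ℕ) (ht : t < n) :
    pos t 1 (toWord (permWord w)) = [(w ⟨t, ht⟩ : ℕ) + 1] := by
  have hmem : ∀ v, v ∈ pos t 1 (toWord (permWord w)) ↔ v = (w ⟨t, ht⟩ : ℕ) + 1 := by
    intro v
    rw [mem_pos, List.getElem?_eq_some_iff]
    constructor
    · rintro ⟨h1, h2, h3⟩
      rw [length_toWord] at h2
      simp only [toWord, List.getElem_ofFn, permWord] at h3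
      have h4 : w⁻¹ ⟨v - 1, h2⟩ = ⟨t, ht⟩ := Fin.ext h3
      rw [← h4]
      simp
      omega
    · rintro rfl
      refine ⟨by omega, by rw [length_toWord]; simp, ?_⟩
      simp [toWord, permWord]
  have hlen : (pos t 1 (toWord (permWord w))).length = 1 := by
    rw [length_pos, List.count_eq_one_of_mem]
    · rw [toWord, List.nodup_ofFn]
      intro j k h
      exact w⁻¹.injective (Fin.ext h)
    · rw [toWord, List.mem_ofFn]
      exact ⟨w ⟨t, ht⟩, by simp [permWord]⟩
  obtain ⟨v, hv⟩ := List.length_eq_one_iff.1 hlen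
  rw [hv] at hmem ⊢
  rw [(hmem v).1 (by simp)]

/-- The letters from `t` on are untouched during the first `t` insertions. At the next stage the
single position of the letter `t` is the value to be inserted. -/
theorem rskPair_lam {n : ℕ} (w : Equiv.Perm (Fin n)) : ∀ t ≤ n,
    (∀ r, (rskPair ((oneLine w).take t)).1.getD r [] =
      if r < t then pos (t - 1 - r) 1 (lam t (toWord (permWord w))) else []) ∧
      ∀ j ≥ t, pos j 1 (lam t (toWord (permWord w))) = pos j 1 (toWord (permWord w))
  | 0, _ => by simp [rskPair_nil, lam]
  | t + 1, ht => by
    obtain ⟨h1, h2⟩ := rskPair_lam w t (by omega)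
    have e1 : (oneLine w).take (t + 1) = (oneLine w).take t ++ [(w ⟨t, ht⟩ : ℕ) + 1] := by
      rw [List.take_succ_eq_append_getElem (by rw [length_oneLine]; exact ht)]
      simp [oneLine]
    obtain ⟨h3, h4⟩ := insertTableau_sweep 1 h1 ((h2 t le_rfl).trans (pos_permWord w t ht))
    rw [e1, rskPair_snoc, lam]
    refine ⟨fun r => ?_, fun j hj => ?_⟩
    · rw [h3]
      simp only [Nat.add_sub_cancel]
    · rw [h4 j hj, h2 j (by omega)]

theorem tabWord_eq_lam {n : ℕ} (w : Equiv.Perm (Fin n)) {μ : YoungDiagram} (hμ : μ.card = n)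
    {T : StdTableau μ} (hT : HasRows T (rskPair (oneLine w)).1) :
    tabWord n T = lam n (toWord (permWord w)) := by
  have h := (rskPair_lam w n le_rfl).1
  rw [List.take_of_length_le (by rw [length_oneLine])] at h
  -- Only the statement on lengths is used, and any automorphism provides it.
  have hlen : (lam n (toWord (permWord w))).length = n :=
    ((auto_long n n).lam (isWord_toWord _) (length_toWord _) le_rfl).2.2
  apply List.ext_getElem
  · rw [length_tabWord, hlen]
  · intro p h1 h2
    rw [length_tabWord] at h1
    obtain ⟨h3, h4⟩ := cellOf_spec T (v := p + 1) (by omega) (by omega)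
    have hr := row_lt_card hμ T (r := (cellOf T (p + 1)).1) (c := (cellOf T (p + 1)).2) h3
    rw [hT, h, if_pos hr] at h4
    have h5 : p + 1 ∈ pos (n - 1 - (cellOf T (p + 1)).1) 1 (lam n (toWord (permWord w))) := by
      rw [List.getD_eq_getElem?_getD] at h4
      cases hc : (pos (n - 1 - (cellOf T (p + 1)).1) 1
          (lam n (toWord (permWord w))))[(cellOf T (p + 1)).2]? with
      | none =>
        rw [hc] at h4
        simp at h4
      | some v =>
        rw [hc] at h4
        have h7 : v = p + 1 := h4
        rw [h7] at hc
        exact List.mem_of_getElem? hc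
    have h6 := (mem_pos.1 h5).2
    rw [Nat.add_sub_cancel, List.getElem?_eq_getElem h2] at h6
    rw [Option.some.inj h6]
    simp [tabWord]

/-- Automorphisms commute with the lowering steps that perform insertion. The shape after `t`
insertions is given by letter counts, which `g` preserves, and the recording tableau depends only on
these shapes. -/
theorem rskPair_of_auto {n : ℕ} {w w' : Equiv.Perm (Fin n)} {g : List ℕ → List ℕ}
    (hg : Auto n n g) (hc : ∀ l, IsWord n l → l.length = n → ∀ r < n, (g l).count r = l.count r)
    (h : toWord (permWord w') = g (toWord (permWord w))) :
    (rskPair (oneLine w')).2 = (rskPair (oneLine w)).2 ∧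
      lam n (toWord (permWord w')) = g (lam n (toWord (permWord w))) := by
  have key : ∀ {t}, t ≤ n → _ := fun {t} ht =>
    hg.lam (isWord_toWord (permWord w)) (length_toWord _) (t := t) ht
  refine ⟨rskPair_snd_congr (by rw [length_oneLine, length_oneLine]) fun t => ?_, ?_⟩
  -- Prefixes longer than the word are the whole word.
  · wlog ht : t ≤ n generalizing t
    · have := this n le_rfl
      rw [List.take_of_length_le (by rw [length_oneLine]),
        List.take_of_length_le (by rw [length_oneLine])] at this
      rwa [List.take_of_length_le (by rw [length_oneLine]; omega),
        List.take_of_length_le (by rw [length_oneLine]; omega)]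
    · obtain ⟨h1, h2, h3⟩ := key ht
      have e1 := (rskPair_lam w t ht).1
      have e2 := (rskPair_lam w' t ht).1
      rw [h, h1] at e2
      have hz : ∀ w : Equiv.Perm (Fin n), 0 ∉ (rskPair ((oneLine w).take t)).1.map List.length :=
        fun w => (rskPair_spec _ ((nodup_oneLine w).sublist (List.take_sublist _ _))).1.zero_notMem
      apply eq_of_getD (hz w') (hz w)
      intro r
      rw [getD_map_length, getD_map_length, e1, e2]
      split_ifs with hr
      · rw [length_pos, length_pos, hc _ h2 h3 _ (by omega)]
      · rfl
  · rw [h]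
    exact (key le_rfl).1

end CactusCrystal

/-! ### The induced action on permutations -/

namespace CactusCrystal

/-! ### The action on permutations -/

/-- The action of `C_n` on permutations through the left tableau. -/
def leftTableauAction {n : ℕ}
    (rsk : Equiv.Perm (Fin n) ≃ (Σ μ : Shape n, StdTableau μ.1 × StdTableau μ.1))
    (β : (μ : Shape n) → Cactus n →* Equiv.Perm (StdTableau μ.1)) :
    Cactus n →* Equiv.Perm (Equiv.Perm (Fin n)) where
  toFun s := (rsk.trans (Equiv.sigmaCongrRight fun μ =>
    Equiv.prodCongr (β μ s) (Equiv.refl (StdTableau μ.1)))).trans rsk.symm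
  map_one' := by
    ext w : 1
    simp
  map_mul' s s' := by
    ext w : 1
    simp
    rfl

theorem rsk_leftTableauAction {n : ℕ}
    (rsk : Equiv.Perm (Fin n) ≃ (Σ μ : Shape n, StdTableau μ.1 × StdTableau μ.1))
    (β : (μ : Shape n) → Cactus n →* Equiv.Perm (StdTableau μ.1)) (s : Cactus n)
    (w : Equiv.Perm (Fin n)) : rsk (leftTableauAction rsk β s w) =
      ⟨(rsk w).1, β (rsk w).1 s (rsk w).2.1, (rsk w).2.2⟩ :=
  rsk.apply_symm_apply _

/-- On words the generator is a `seg`, so `rskPair_of_auto` fixes the recording tableau and applies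
the same `seg` to the lowest word of the insertion tableau, where it is the Berenstein–Kirillov
action. -/
theorem rsk_generator {n : ℕ} {act : VirtualCactus n →* Equiv.Perm (Fin n → Fin n)}
    {rsk : Equiv.Perm (Fin n) ≃ (Σ μ : Shape n, StdTableau μ.1 × StdTableau μ.1)}
    {β : (μ : Shape n) → Cactus n →* Equiv.Perm (StdTableau μ.1)} (hact : IsCrystalAction n act)
    (hrsk : IsRSK rsk) (hβ : IsBerensteinKirillov β) {p : PosPair n} {w w' : Equiv.Perm (Fin n)}
    (h : permWord w' = act (VirtualCactus.ofCactus n (Cactus.s p)) (permWord w)) :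
    rsk w' = ⟨(rsk w).1, β (rsk w).1 (Cactus.s p) (rsk w).2.1, (rsk w).2.2⟩ := by
  have hp : (p.1.1 : ℕ) < p.1.2 := p.2
  have hp2 := p.1.2.isLt
  rw [hact.cactus] at h
  have h1 := congrArg toWord h
  rw [toWord_commutorAction] at h1
  obtain ⟨h2, h3⟩ := rskPair_of_auto (auto_seg (by omega))
    (fun l hl hN r hr => count_seg hl (by omega) hr) h1
  apply tableauPair_ext
  · apply entry_eq_of_tabWord_eq (rsk w').1.2 (rsk w).1.2
    rw [tabWord_action hβ, tabWord_eq_lam w' (rsk w').1.2 (hrsk w').1,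
      tabWord_eq_lam w (rsk w).1.2 (hrsk w).1, h3]
  · intro i j
    rw [(hrsk w').2, (hrsk w).2, h2]

end CactusCrystal

theorem mainTheorem8 (n : ℕ) :
    -- the crystals involved have a unique Schützenberger involution
    (∃! ξ, (Crystal.vector n).IsSchutzenberger ξ) ∧
    (∀ k : ℕ, (∃! ξ, ((Crystal.vector n).power k).IsSchutzenberger ξ) ∧
      (∃! ξ, (((Crystal.vector n).power k).tensor (Crystal.vector n)).IsSchutzenberger ξ)) ∧
    -- the action of `vC_n`, the RSK correspondence and the action of `C_n` on tableaux exist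
    (∃! act : VirtualCactus n →* Equiv.Perm (Fin n → Fin n), IsCrystalAction n act) ∧
    (∃! rsk : Equiv.Perm (Fin n) ≃ (Σ μ : Shape n, StdTableau μ.1 × StdTableau μ.1),
      IsRSK rsk) ∧
    (∃! β : (μ : Shape n) → Cactus n →* Equiv.Perm (StdTableau μ.1),
      IsBerensteinKirillov β) ∧
    -- `S_n` is identified with the subset of weight `(1, …, 1)`
    Set.BijOn (permWord (n := n)) Set.univ
      {a | ((Crystal.vector n).power n).wt a = toWeight n (fun _ => 1)} ∧
    ∀ (act : VirtualCactus n →* Equiv.Perm (Fin n → Fin n))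
      (rsk : Equiv.Perm (Fin n) ≃ (Σ μ : Shape n, StdTableau μ.1 × StdTableau μ.1))
      (β : (μ : Shape n) → Cactus n →* Equiv.Perm (StdTableau μ.1)),
      IsCrystalAction n act → IsRSK rsk → IsBerensteinKirillov β →
      -- the action preserves the weight
      (∀ g a, ((Crystal.vector n).power n).wt (act g a) = ((Crystal.vector n).power n).wt a) ∧
      -- the induced action on `S_n` is the unique one with the two stated properties
      ∃ α : VirtualCactus n →* Equiv.Perm (Equiv.Perm (Fin n)),
        (∀ g w, permWord (α g w) = act g (permWord w)) ∧
        (∀ u w : Equiv.Perm (Fin n), α (VirtualCactus.ofPerm n u) w = u * w) ∧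
        (∀ (s : Cactus n) (w : Equiv.Perm (Fin n)),
          rsk (α (VirtualCactus.ofCactus n s) w) =
            ⟨(rsk w).1, β (rsk w).1 s (rsk w).2.1, (rsk w).2.2⟩) ∧
        ∀ α' : VirtualCactus n →* Equiv.Perm (Equiv.Perm (Fin n)),
          (∀ u w : Equiv.Perm (Fin n), α' (VirtualCactus.ofPerm n u) w = u * w) →
          (∀ (s : Cactus n) (w : Equiv.Perm (Fin n)),
            rsk (α' (VirtualCactus.ofCactus n s) w) =
              ⟨(rsk w).1, β (rsk w).1 s (rsk w).2.1, (rsk w).2.2⟩) →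
          α' = α := by
  refine ⟨(isWordModel_vector n).existsUnique_schutzenberger, fun k =>
    ⟨(isWordModel_power n k).existsUnique_schutzenberger,
      ((isWordModel_power n k).tensor (isWordModel_vector n)).existsUnique_schutzenberger⟩,
    existsUnique_crystalAction n, existsUnique_rsk n, existsUnique_berensteinKirillov n,
    bijOn_permWord n, ?_⟩
  intro act rsk β hact hrsk hβ
  refine ⟨wt_act hact, ?_⟩
  -- The action preserves weights, hence the subset of words identified with permutations.
  obtain ⟨α, hα⟩ := exists_restrict_hom act permWord permWord_injective fun g w => by
    obtain ⟨w', -, h⟩ := (bijOn_permWord n).surjOn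
      ((wt_act hact g _).trans ((bijOn_permWord n).mapsTo (Set.mem_univ w)))
    exact ⟨w', h⟩
  have hperm : ∀ u w : Equiv.Perm (Fin n), α (VirtualCactus.ofPerm n u) w = u * w := by
    intro u w
    apply permWord_injective
    rw [hα]
    funext k
    obtain ⟨t, rfl⟩ := u.surjective k
    rw [hact.perm]
    simp [permWord]
  -- Both sides are homomorphisms on `C_n`, so the second property need only be checked on
  -- generators.
  have hcactus : α.comp (VirtualCactus.ofCactus n) = leftTableauAction rsk β := by
    apply cactus_hom_ext
    intro p
    ext w : 1
    apply rsk.injective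
    rw [rsk_leftTableauAction]
    exact rsk_generator hact hrsk hβ (hα _ _)
  refine ⟨α, hα, hperm, fun s w => ?_, fun α' h1 h2 => ?_⟩
  · rw [← rsk_leftTableauAction, ← hcactus]
    rfl
  · apply virtualCactus_hom_ext
    · intro p
      ext w : 1
      apply rsk.injective
      rw [h2, ← rsk_leftTableauAction, ← hcactus]
      rfl
    · intro u
      ext w : 1
      rw [h1, hperm]
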